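/- Conventions. For a group $G$, a subgroup $H\le G$ and $a,b\in G$: $H$ is *malnormal* in $G$, written $H\le_{\rm m}G$, if $g^{-1}hg\notin H$ for all $h\in H\setminus\{1\}$ and $g\in G\setminus H$; and $a,b$ are *good fellows over $H$* (in $G$) if $a\notin HbH\cup Hb^{-1}H$. Let $\varrho(x,y)$ be the word $xyx^2yx^3y\cdots x^{80}y$. For groups $K,L$ with $K\cap L=H$ a common subgroup, let $K*_HL$ be their free amalgam over $H$. A *canonical form* of $g\in K*_HL$ is an expression $g=g_0g_1\cdots g_{n-1}$ with all $g_i\in K\cup L$ such that either $n=1$, or $n>1$, no $g_i$ is in $H$ and the $g_i$ alternate between $K$ and $L$. An element $g\ne1$ is *weakly cyclically reduced* if it has a canonical form with $n=1$, or $n$ even, or $g_{n-1}g_0\notin H$. A set $R\subseteq K*_HL$ is *symmetrized* if it is closed under inverses and under passing to weakly cyclically reduced conjugates; the *symmetric closure* of a set is the smallest symmetrized set containing it. A set $X\subseteq K*_HL$ satisfies $C'(\chi)$ if whenever $g_{n-1}\cdots g_1g_0$ and $g'_0g'_1\cdots g'_{m-1}$ are canonical forms of elements of $X$ whose product $g_{n-1}\cdots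 g_0\,g'_0\cdots g'_{m-1}$ is not $1$, $\ell<n,m$, and $g_{\ell-1}\cdots g_0\,g'_0\cdots g'_{\ell-1}\in H$, then $\ell<\chi\cdot\min(n,m)$. **Lemma (extended Hesse amalgamation lemma).** Let $H\le K$ and $H\le_{\rm m}L$ be groups with $K\cap L=H$, and let $(h_i,a_i,b_i,b_i')_{i\in I}$ be a family in $H\times(K\setminus H)\times(L\setminus H)\times(L\setminus H)$ such that 1. for every $i\in I$, $b_i$ and $b_i'$ are good fellows over $H$; 2. for all $i\ne j$ in $I$ at least one of the following holds: (a) $a_i$ and $a_j$ are good fellows over $H$ (in $K$); (b) $b_i=b_j$, $b_i'=b_j'$ and $a_i\ne a_j$; (c) $b_i$ and $b_j$ are good fellows over $H$; (d) there are subgroups $H'\le H$ and $K'\le K$ with $K'\cap H=H'$, $a_i,a_j\in K'\setminus H$, $b_i$ and $b_j$ good fellows over $H'$ (in $L$), $b_i$ and $b_j'$ good fellows over $H$, and $(K'\setminus H)\cdot(H\setminus K')\cdot(K'\setminus H)\subseteq K\setminus H$. Let $M=K*_HL$, let $R\subseteq M$ be the symmetric closure of $\{h_i^{-1}\varrho(b_ia_i,b_i'a_i)\mid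 i\in I\}$, let $N$ be the normal subgroup of $M$ generated by $R$, let $M^*=M/N$, and let $\pi:M\to M^*$ be the canonical map. Then: (A) $R$ is symmetrized and satisfies $C'(\frac1{10})$, and $\pi\restriction(K\cup L)$ is injective (so $K$ and $L$ are identified with subgroups of $M^*$); (B) $K\le_{\rm m}M^*$, and if $H\le_{\rm m}K$, then $L\le_{\rm m}M^*$; (C) if $b,b'\in L\setminus H$ are not good fellows over $H$ and $d\in K\setminus H$, then $db'$ and $dbdb$ are good fellows over $K$ in $M^*$; (D) if $b,b'\in L\setminus H$ and $a\in K\setminus H$, then $bab'\notin K$ and $ba\notin K$ in $M^*$; likewise, if $a,a'\in K\setminus H$ and $b\in L\setminus H$, then $aba'\notin L$ and $ab\notin L$ in $M^*$; (E) if $H'\le H$, $a,a'\in K$ are good fellows over $H'$ (in $K$) and are not both in $H$, and $L'\le L$ satisfies $L'\cap K=L'\cap H=H'$, then $a,a'$ are good fellows over $L'$ in $M^*$; (F) if $b,b'\in L$ are good fellows over $H$, then they are good fellows over $K$ in $M^*$; (G) if $K$ and $L$ are torsion-free (no element other than $1$ has finite order), then so is $M^*$. -/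

import Mathlib

universe u v w

namespace HesseAmalgam

section Basic

variable {G : Type u} [Group G]

/-- `H` is a malnormal subgroup of `G`. -/
def Malnormal (H : Subgroup G) : Prop :=
  ∀ h ∈ H, h ≠ 1 → ∀ g : G, g ∉ H → g⁻¹ * h * g ∉ H

/-- `a` and `b` are good fellows over `H`: `a` lies neither in `H b H` nor in `H b⁻¹ H`. -/
def GoodFellows (H : Subgroup G) (a b : G) : Prop :=
  ∀ x ∈ H, ∀ y ∈ H, a ≠ x * b * y ∧ a ≠ x * b⁻¹ * y

/-- The only element of finite order is `1`. (Mathlib's `IsMulTorsionFree` asks for uniqueness of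
roots, which is stronger for non-commutative groups.) -/
def TorsionFree (G : Type u) [Group G] : Prop :=
  ∀ g : G, g ≠ 1 → ¬ IsOfFinOrder g

/-- The word `x y x² y x³ y … x⁸⁰ y`, evaluated in `G`. -/
def rho (x y : G) : G :=
  ((List.range 80).map fun k => x ^ (k + 1) * y).prod

end Basic

/-! ### Words over two subgroups

`M` is a group with subgroups `H`, `K`, `L`; it will be the amalgam of `K` and `L` over `H`. -/

section Words

variable {M : Type u} [Group M] (H K L : Subgroup M)

/-- A canonical form: a word over `K ∪ L` which consists of a single letter, or has at least two
letters, none of them in `H`, with letters from `K` and from `L` alternating. -/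
def IsCanonical (w : List M) : Prop :=
  (∀ x ∈ w, x ∈ K ∨ x ∈ L) ∧
    (w.length = 1 ∨
      (1 < w.length ∧ (∀ x ∈ w, x ∉ H) ∧ w.IsChain fun x y => (x ∈ K ↔ y ∈ L)))

/-- `g ≠ 1` is weakly cyclically reduced: it has a canonical form `g₀ ⋯ gₙ₋₁` with `n = 1`, or `n`
even, or `gₙ₋₁ g₀ ∉ H`. -/
def WeaklyCyclicallyReduced (g : M) : Prop :=
  g ≠ 1 ∧ ∃ w : List M, ∃ hw : w ≠ [], IsCanonical H K L w ∧ w.prod = g ∧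
    (w.length = 1 ∨ Even w.length ∨ w.getLast hw * w.head hw ∉ H)

/-- `R` is closed under inverses and under weakly cyclically reduced conjugates. -/
def Symmetrized (R : Set M) : Prop :=
  ∀ g ∈ R, g⁻¹ ∈ R ∧ ∀ g', IsConj g g' → WeaklyCyclicallyReduced H K L g' → g' ∈ R

/-- The smallest symmetrized set containing `X`. -/
def symmetricClosure (X : Set M) : Set M :=
  ⋂₀ {R | X ⊆ R ∧ Symmetrized H K L R}

/-- The small cancellation condition `C'(χ)`: if `u₁ ++ u₂` and `v₁ ++ v₂` are canonical forms, of
lengths `n` and `m`, of elements of `X` whose product is not `1`, if `u₂` and `v₁` have the same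
length `ℓ < n, m`, and the product of `u₂` and `v₁` is in `H`, then `ℓ < min n m * χ`. -/
def SmallCancellation (χ : ℝ) (X : Set M) : Prop :=
  ∀ (u₁ u₂ v₁ v₂ : List M) (ℓ : ℕ),
    IsCanonical H K L (u₁ ++ u₂) → IsCanonical H K L (v₁ ++ v₂) →
    (u₁ ++ u₂).prod ∈ X → (v₁ ++ v₂).prod ∈ X →
    (u₁ ++ u₂).prod * (v₁ ++ v₂).prod ≠ 1 →
    u₂.length = ℓ → v₁.length = ℓ →
    ℓ < (u₁ ++ u₂).length → ℓ < (v₁ ++ v₂).length →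
    u₂.prod * v₁.prod ∈ H →
    (ℓ : ℝ) < (min (u₁ ++ u₂).length (v₁ ++ v₂).length : ℕ) * χ

end Words

/-! ### The amalgam and its quotient -/

/-- The two-member family consisting of `K` (at `true`) and `L` (at `false`). -/
def Factor (K L : Type u) : Bool → Type u
  | true => K
  | false => L

instance factorGroup (K L : Type u) [Group K] [Group L] : (t : Bool) → Group (Factor K L t)
  | true => inferInstanceAs (Group K)
  | false => inferInstanceAs (Group L)

section Amalgam

variable {H : Type v} {K L : Type u} [Group H] [Group K] [Group L]

/-- The two embeddings of `H`, as a family. -/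
def factorMap (φ : H →* K) (ψ : H →* L) : (t : Bool) → H →* Factor K L t
  | true => φ
  | false => ψ

variable (φ : H →* K) (ψ : H →* L)

/-- The amalgam `K *_H L`. -/
abbrev Amalgam : Type _ := Monoid.PushoutI (factorMap φ ψ)

/-- The canonical map `K → K *_H L`. -/
def inK : K →* Amalgam φ ψ := Monoid.PushoutI.of (φ := factorMap φ ψ) true

/-- The canonical map `L → K *_H L`. -/
def inL : L →* Amalgam φ ψ := Monoid.PushoutI.of (φ := factorMap φ ψ) false

/-- The canonical map `H → K *_H L`. -/
def inH : H →* Amalgam φ ψ := Monoid.PushoutI.base (factorMap φ ψ)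

/-- `Symmetrized` in `K *_H L`. -/
abbrev SymmetrizedInAmalgam (R : Set (Amalgam φ ψ)) : Prop :=
  Symmetrized (inH φ ψ).range (inK φ ψ).range (inL φ ψ).range R

/-- The condition `C'(χ)` in `K *_H L`. -/
abbrev SmallCancellationInAmalgam (χ : ℝ) (R : Set (Amalgam φ ψ)) : Prop :=
  SmallCancellation (inH φ ψ).range (inK φ ψ).range (inL φ ψ).range χ R

variable {I : Type w} (h : I → H) (a : I → K) (b b' : I → L)

/-- The element `hᵢ⁻¹ ϱ(bᵢ aᵢ, bᵢ' aᵢ)` of `K *_H L`. -/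
def relator (i : I) : Amalgam φ ψ :=
  (inH φ ψ (h i))⁻¹ *
    rho (inL φ ψ (b i) * inK φ ψ (a i)) (inL φ ψ (b' i) * inK φ ψ (a i))

/-- The symmetric closure `R` of the set of all the elements `hᵢ⁻¹ ϱ(bᵢ aᵢ, bᵢ' aᵢ)`. -/
def relators : Set (Amalgam φ ψ) :=
  symmetricClosure (inH φ ψ).range (inK φ ψ).range (inL φ ψ).range
    (Set.range (relator φ ψ h a b b'))

/-- The quotient `M*` of `K *_H L` by the normal subgroup generated by `R`. -/
abbrev MStar : Type _ :=
  Amalgam φ ψ ⧸ Subgroup.normalClosure (relators φ ψ h a b b')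

/-- The projection `π : K *_H L → M*`. -/
def proj : Amalgam φ ψ →* MStar φ ψ h a b b' :=
  QuotientGroup.mk' _

/-- The canonical map `K → M*`. -/
def toMStarK : K →* MStar φ ψ h a b b' := (proj φ ψ h a b b').comp (inK φ ψ)

/-- The canonical map `L → M*`. -/
def toMStarL : L →* MStar φ ψ h a b b' := (proj φ ψ h a b b').comp (inL φ ψ)

/-- The compatibility condition on two indices `i`, `k` (good fellows, or equal `b`-parts and
distinct `a`-parts, or the condition with auxiliary subgroups `H' ≤ H` and `K' ≤ K`). -/
def Compatible (i k : I) : Prop :=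
  GoodFellows φ.range (a i) (a k) ∨
  (b i = b k ∧ b' i = b' k ∧ a i ≠ a k) ∨
  GoodFellows ψ.range (b i) (b k) ∨
  ∃ (H' : Subgroup H) (K' : Subgroup K),
    K' ⊓ φ.range = H'.map φ ∧
    (a i ∈ K' ∧ a i ∉ φ.range) ∧ (a k ∈ K' ∧ a k ∉ φ.range) ∧
    GoodFellows (H'.map ψ) (b i) (b k) ∧
    GoodFellows ψ.range (b i) (b' k) ∧
    ∀ x ∈ K', x ∉ φ.range → ∀ y ∈ φ.range, y ∉ K' → ∀ z ∈ K', z ∉ φ.range →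
      x * y * z ∉ φ.range

end Amalgam

end HesseAmalgam

/-! The amalgam `M` of `K` and `L` over `H` acts on its Bass–Serre tree with vertex stabilizers `K`,
`L` and edge stabilizer `H`. The word ϱ has 1 + 2 + … + 80 letters `x` and 80 letters `y`, together
3320, each contributing two syllables. So a relator is hyperbolic of translation length τ = 6640,
and its axis carries a periodic word `⋯ l₀ a l₁ a ⋯` in which each `lₘ` is `b` or `b'`, up to one
factor `h⁻¹` per period.

Everything rests on one fact (`RelatorData.smallOverlap`): the axes of distinct conjugates of
relators overlap in length at most Δ = 605. Along a longer overlap the letters of two such words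
agree up to elements of `H`. Hypothesis 2 then forces equal `b` and equal `b'`
(`RelatorData.segment_aux`), and hypothesis 1 makes the patterns of `b` and `b'` agree. The gaps
between the letters `b'` are 2, 3, …, 81, cyclically, so the patterns can only be shifted by whole
periods and never run in opposite directions. Now equal letters face each other, and malnormality of
`H` in `L` kills the elements of `H` by which the words differ. Hence the indices are equal and the
conjugators differ by a power of the relator.

As 5Δ < τ, a geometric Greendlinger lemma follows (`greendlinger`): for `1 ≠ g ∈ N` and any vertex
`v`, some relator axis has the projections of `v` and `g v` at least τ − 3Δ = 4825 apart. It is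
proved with windmills: a convex set `W` invariant under a group `G` is enlarged by the axes that
meet it, and `G` by the corresponding relators. Ping-pong on projections controls the new elements,
and Zorn's lemma finishes.

So elements of `M` with small displacement are separated by the projection to `M*`. This gives
injectivity in (A), and it turns (C)–(F) into statements about distances and double cosets in the
tree. For (B) and (G) one takes a representative modulo `N` of minimal displacement. A long stretch
along a relator axis then either permits a shortening by that relator, or makes an axis overlap its
translate, so that the translating element is a power of the relator. For the `C'(1/10)` part of
(A), `R` lies in the set of conjugates of relators and their inverses whose axis contains a base
vertex. Their canonical forms run along the axis, so a piece of length `ℓ ≥ 664` would give an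
overlap of length `ℓ - 1 > Δ`. -/

namespace HesseAmalgam

/-! ### Gates on convex subsets of trees -/

section Trees

variable {V : Type*} {d : V → V → ℕ}

/-- The path metric of a tree on its vertex set. -/
structure TreeMetric (d : V → V → ℕ) : Prop where
  eq_of_zero : ∀ x y, d x y = 0 → x = y
  self : ∀ x, d x x = 0
  symm : ∀ x y, d x y = d y x
  four : ∀ x y z w, d x y + d z w ≤ d x z + d y w ∨ d x y + d z w ≤ d x w + d y z
  step : ∀ x y, x ≠ y → ∃ z, d x z = 1 ∧ d z y + 1 = d x y
  ne : ∀ x y z, d y z = 1 → d x y ≠ d x z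

/-- A set containing every geodesic between its points. -/
def GeodConvex (d : V → V → ℕ) (C : Set V) : Prop :=
  ∀ x ∈ C, ∀ y ∈ C, ∀ z, d x z + d z y = d x y → z ∈ C

/-- `p` is the nearest point of `C` to `z`, and all geodesics from `z` to `C` pass through it. -/
def IsGate (d : V → V → ℕ) (C : Set V) (z p : V) : Prop :=
  p ∈ C ∧ ∀ w ∈ C, d z w = d z p + d p w

namespace TreeMetric

variable (hd : TreeMetric d)
include hd

theorem tri (x y z : V) : d x z ≤ d x y + d y z := by
  have h1 := hd.four x z y y
  have h2 := hd.self y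
  have h3 := hd.symm y z
  omega

/-- A geodesic `[x, y]` lies in `[x, q] ∪ [q, y]`. -/
theorem thin (x y q z : V) (h : d x z + d z y = d x y) :
    d x z + d z q = d x q ∨ d q z + d z y = d q y := by
  have h1 := hd.four x y z q
  have h2 := hd.tri x z q
  have h3 := hd.tri q z y
  have h4 := hd.symm y z
  have h5 := hd.symm y q
  have h6 := hd.symm z q
  omega

/-- A nearest point `p` works: the neighbour of `p` towards `w` stays in `C`, so it is not nearer to
`z`, and by `ne` not equally near. Hence the path from `z` to `p` continues to `w` without turning
back. -/
theorem exists_gate {C : Set V} (hC : GeodConvex d C) (hne : C.Nonempty) (z : V) :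
    ∃ p, IsGate d C z p := by
  obtain ⟨p, hp, hmin⟩ : ∃ p ∈ C, ∀ q ∈ C, d z p ≤ d z q := by
    obtain ⟨p, hp, h⟩ := WellFounded.has_min (measure (d z)).wf C hne
    exact ⟨p, hp, fun q hq => not_lt.1 (h q hq)⟩
  refine ⟨p, hp, fun w hw => ?_⟩
  by_cases hpw : p = w
  · subst hpw; simp [hd.self]
  obtain ⟨q, h1, h2⟩ := hd.step p w hpw
  have hq : q ∈ C := hC p hp w hw q (by omega)
  have h3 := hmin q hq
  have h4 := hd.ne z p q h1
  have h5 := hd.four z q p w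
  have h6 := hd.tri z p w
  have h7 := hd.symm q p
  have h8 := hd.symm p q
  have h9 := hd.four z q w p
  have h10 := hd.symm w p
  omega

theorem gate_unique {C : Set V} {z p q : V} (hp : IsGate d C z p) (hq : IsGate d C z q) :
    p = q := by
  apply hd.eq_of_zero
  have h1 := hp.2 q hq.1
  have h2 := hq.2 p hp.1
  omega

/-- The main tool: two points with different projections are joined by a geodesic that runs along
`C` between the projections. -/
theorem gate_pair {C : Set V} {x y p q : V} (hp : IsGate d C x p) (hq : IsGate d C y q)
    (h : p ≠ q) : d x y = d x p + d p q + d q y := by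
  have h0 : d p q ≠ 0 := fun h' => h (hd.eq_of_zero _ _ h')
  have h1 := hp.2 q hq.1
  have h2 := hq.2 p hp.1
  have h3 := hd.four x q y p
  have h4 := hd.tri x p y
  have h5 := hd.tri p q y
  have h6 := hd.symm p q
  have h7 := hd.symm y q
  omega

omit hd in
/-- Gates of the points of a convex set `W` on a set `C` that meets `W` lie in `W`. -/
theorem gate_mem {C W : Set V} (hW : GeodConvex d W) {x p c : V} (hx : x ∈ W) (hc : c ∈ C)
    (hcW : c ∈ W) (hp : IsGate d C x p) : p ∈ W :=
  hW x hx c hcW p (hp.2 c hc).symm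

/-- Disjoint convex sets: all gates coincide. -/
theorem gate_eq_of_disjoint {C W : Set V} (hW : GeodConvex d W) (hCW : ∀ x ∈ W, x ∉ C)
    {x y p q : V} (hx : x ∈ W) (hy : y ∈ W) (hp : IsGate d C x p) (hq : IsGate d C y q) :
    p = q := by
  by_contra h
  have h1 := hd.gate_pair hp hq h
  have h2 := hd.tri p q y
  have h3 := hd.tri x p y
  exact hCW p (hW x hx y hy p (by omega)) hp.1

/-- Behrstock's alternative for gates on two sets. -/
theorem gate_behrstock {A B : Set V} {z a b a' b' : V} (ha : IsGate d A z a) (hb : IsGate d B z b)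
    (ha' : IsGate d A b a') (hb' : IsGate d B a b') : a = a' ∨ b = b' := by
  by_cases h : a = a'
  · exact Or.inl h
  right
  -- Different gates on `A` put `a` on the geodesic from `z` to `b`, so `B` is entered at `b` also
  -- when coming from `a`.
  have h1 := hd.gate_pair ha ha' h
  refine hd.gate_unique ⟨hb.1, fun w hw => ?_⟩ hb'
  have h2 := hb.2 w hw
  have h3 := hd.tri z a w
  have h4 := hd.tri a b w
  have h5 := hd.tri a a' b
  omega

end TreeMetric

end Trees

/-! ### Windmills and Greendlinger's lemma -/

section Windmill

variable {M V : Type*} [Group M] [MulAction M V]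

/-- The points which `r` displaces by exactly `τ`. -/
def Axis (d : V → V → ℕ) (τ : ℕ) (r : M) : Set V := {x | d x (r • x) = τ}

/-- A conjugation invariant set of hyperbolic isometries of a tree, of translation length `τ`,
whose axes have overlaps of length at most `Δ`. -/
structure SmallOverlap (d : V → V → ℕ) (τ Δ : ℕ) (R : Set M) : Prop where
  tree : TreeMetric d
  isom : ∀ (g : M) x y, d (g • x) (g • y) = d x y
  conj : ∀ r ∈ R, ∀ g : M, g * r * g⁻¹ ∈ R
  nonempty : ∀ r ∈ R, (Axis d τ r).Nonempty
  convex : ∀ r ∈ R, GeodConvex d (Axis d τ r)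
  trans : ∀ r ∈ R, ∀ x ∈ Axis d τ r, ∀ k : ℤ, k ≠ 0 → τ ≤ d x (r ^ k • x)
  overlap : ∀ r ∈ R, ∀ s ∈ R, r ≠ s → ∀ x ∈ Axis d τ r, x ∈ Axis d τ s →
    ∀ y ∈ Axis d τ r, y ∈ Axis d τ s → d x y ≤ Δ
  small : 5 * Δ < τ

/-- A choice of gates. -/
noncomputable def gate (d : V → V → ℕ) (C : Set V) (z : V) : V :=
  open Classical in if h : ∃ p, IsGate d C z p then h.choose else z

variable {d : V → V → ℕ} {τ Δ : ℕ} {R : Set M}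

theorem mem_axis_conj (isom : ∀ (g : M) x y, d (g • x) (g • y) = d x y) (r g : M) (x : V) :
    g • x ∈ Axis d τ (g * r * g⁻¹) ↔ x ∈ Axis d τ r := by
  simp only [Axis, Set.mem_ofPred_eq, mul_smul, inv_smul_smul, isom]

namespace SmallOverlap

variable (hR : SmallOverlap d τ Δ R)
include hR

theorem isGate {r : M} (hr : r ∈ R) (z : V) :
    IsGate d (Axis d τ r) z (gate d (Axis d τ r) z) := by
  have h := hR.tree.exists_gate (hR.convex r hr) (hR.nonempty r hr) z
  unfold gate
  rw [dif_pos h]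
  exact h.choose_spec

theorem smul_mem_axis {r : M} {x : V} (g : M) (hx : x ∈ Axis d τ r) :
    g • x ∈ Axis d τ (g * r * g⁻¹) :=
  (mem_axis_conj hR.isom r g x).2 hx

theorem zpow_smul_mem_axis {r : M} {x : V} (k : ℤ) (hx : x ∈ Axis d τ r) :
    r ^ k • x ∈ Axis d τ r := by
  have h := hR.smul_mem_axis (r ^ k) hx
  rwa [show r ^ k * r * (r ^ k)⁻¹ = r by group] at h

theorem isGate_smul {r : M} {z p : V} (g : M) (h : IsGate d (Axis d τ r) z p) :
    IsGate d (Axis d τ (g * r * g⁻¹)) (g • z) (g • p) := by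
  refine ⟨hR.smul_mem_axis g h.1, fun w hw => ?_⟩
  have hw' : g⁻¹ • w ∈ Axis d τ r := by
    rw [← mem_axis_conj hR.isom r g, smul_inv_smul]; exact hw
  have h1 := h.2 _ hw'
  have h2 : ∀ y, d (g • y) w = d y (g⁻¹ • w) := fun y => by
    rw [← hR.isom g y, smul_inv_smul]
  rw [h2, h2, hR.isom]; exact h1

theorem gate_smul {r : M} (hr : r ∈ R) (z : V) (g : M) :
    gate d (Axis d τ (g * r * g⁻¹)) (g • z) = g • gate d (Axis d τ r) z :=
  hR.tree.gate_unique (hR.isGate (hR.conj r hr g) _) (hR.isGate_smul g (hR.isGate hr z))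

theorem gate_zpow_smul {r : M} (hr : r ∈ R) (z : V) (k : ℤ) :
    gate d (Axis d τ r) (r ^ k • z) = r ^ k • gate d (Axis d τ r) z := by
  have h := hR.gate_smul hr z (r ^ k)
  rwa [show r ^ k * r * (r ^ k)⁻¹ = r by group] at h

/-- The projection of an axis to another one is small. -/
theorem gate_axis_le {r s : M} (hr : r ∈ R) (hs : s ∈ R) (hrs : r ≠ s) {x y : V}
    (hx : x ∈ Axis d τ s) (hy : y ∈ Axis d τ s) :
    d (gate d (Axis d τ r) x) (gate d (Axis d τ r) y) ≤ Δ := by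
  have hp := hR.isGate hr x
  have hq := hR.isGate hr y
  set p := gate d (Axis d τ r) x
  set q := gate d (Axis d τ r) y
  by_cases h : p = q
  · simp [h, hR.tree.self]
  -- Distinct gates lie on the geodesic from `x` to `y`, hence on both axes.
  have h1 := hR.tree.gate_pair hp hq h
  have h2 := hR.tree.tri p q y
  have h3 := hR.tree.tri x p y
  have h4 := hR.tree.tri x p q
  have h5 := hR.tree.tri x q y
  exact hR.overlap r hr s hs hrs p hp.1 (hR.convex s hs x hx y hy p (by omega)) q hq.1
    (hR.convex s hs x hx y hy q (by omega))

end SmallOverlap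

/-- Reduced expressions `r₁ ^ k₁ • r₂ ^ k₂ • ⋯ • x` over `T`, with `x` in `X₀` or in the set `Y r`
belonging to some letter `r`; the first argument is the first letter. -/
inductive Form {X : Type*} [MulAction M X] (T : Set M) (X₀ : Set X) (Y : M → Set X) :
    Option M → X → Prop
  | base {x} : x ∈ X₀ → Form T X₀ Y none x
  | axis {r x} : r ∈ T → x ∈ Y r → Form T X₀ Y (some r) x
  | pow {r : M} {k : ℤ} {o x} : r ∈ T → k ≠ 0 → Form T X₀ Y o x → o ≠ some r →
      Form T X₀ Y (some r) (r ^ k • x)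

section Form

variable {X : Type*} [MulAction M X] {T : Set M} {X₀ : Set X} {Y : M → Set X} {G : Subgroup M}

theorem Form.smul (hT : ∀ r ∈ T, ∀ g ∈ G, g * r * g⁻¹ ∈ T)
    (hX : ∀ g ∈ G, ∀ x ∈ X₀, g • x ∈ X₀) (hY : ∀ g ∈ G, ∀ r, ∀ x ∈ Y r, g • x ∈ Y (g * r * g⁻¹))
    {g : M} (hg : g ∈ G) {o : Option M} {x : X} (h : Form T X₀ Y o x) :
    Form T X₀ Y (o.map fun r => g * r * g⁻¹) (g • x) := by
  induction h with
  | base hx => exact Form.base (hX g hg _ hx)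
  | axis hr hx => exact Form.axis (hT _ hr g hg) (hY g hg _ _ hx)
  | @pow r k o x hr hk _ ho ih =>
    have : g • r ^ k • x = (g * r * g⁻¹) ^ k • g • x := by
      rw [conj_zpow]; simp [mul_smul]
    rw [this]
    refine Form.pow (hT r hr g hg) hk ih ?_
    cases o with
    | none => simp
    | some s => simpa using ho

theorem Form.zpow_smul (hYr : ∀ r, ∀ x ∈ Y r, ∀ k : ℤ, r ^ k • x ∈ Y r)
    {r : M} (hr : r ∈ T) (k : ℤ) {o : Option M} {x : X} (h : Form T X₀ Y o x) :
    ∃ o', Form T X₀ Y o' (r ^ k • x) := by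
  by_cases hk : k = 0
  · subst hk; exact ⟨o, by simpa using h⟩
  by_cases ho : o = some r
  · subst ho
    cases h with
    | axis _ hx => exact ⟨_, Form.axis hr (hYr r _ hx k)⟩
    | @pow _ l o' x' _ _ h' ho' =>
      rw [← mul_smul, ← zpow_add]
      by_cases hl : k + l = 0
      · rw [hl]; exact ⟨o', by simpa using h'⟩
      · exact ⟨_, Form.pow hr hl h' ho'⟩
  · exact ⟨_, Form.pow hr hk h ho⟩

/-- `X` is arbitrary so that this serves for vertices and, with `X = M`, for group elements. `u` and
`u⁻¹` are treated together because the induction has an inversion step. -/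
theorem Form.closure_smul (hT : ∀ r ∈ T, ∀ g ∈ G, g * r * g⁻¹ ∈ T)
    (hX : ∀ g ∈ G, ∀ x ∈ X₀, g • x ∈ X₀) (hY : ∀ g ∈ G, ∀ r, ∀ x ∈ Y r, g • x ∈ Y (g * r * g⁻¹))
    (hYr : ∀ r, ∀ x ∈ Y r, ∀ k : ℤ, r ^ k • x ∈ Y r)
    {u : M} (hu : u ∈ Subgroup.closure ((G : Set M) ∪ T)) {o : Option M} {x : X}
    (h : Form T X₀ Y o x) : ∃ o', Form T X₀ Y o' (u • x) := by
  suffices H : (∀ o x, Form T X₀ Y o x → ∃ o', Form T X₀ Y o' (u • x)) ∧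
      (∀ o x, Form T X₀ Y o x → ∃ o', Form T X₀ Y o' (u⁻¹ • x)) from H.1 o x h
  clear h o x
  induction hu using Subgroup.closure_induction with
  | mem u hu =>
    rcases hu with hu | hu
    · exact ⟨fun o x h => ⟨_, h.smul hT hX hY hu⟩, fun o x h => ⟨_, h.smul hT hX hY (inv_mem hu)⟩⟩
    · refine ⟨fun o x h => ?_, fun o x h => ?_⟩
      · simpa using h.zpow_smul hYr hu 1
      · simpa using h.zpow_smul hYr hu (-1)
  | one => exact ⟨fun o x h => ⟨o, by simpa using h⟩, fun o x h => ⟨o, by simpa using h⟩⟩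
  | mul a b _ _ iha ihb =>
    refine ⟨fun o x h => ?_, fun o x h => ?_⟩
    · obtain ⟨o', h'⟩ := ihb.1 o x h
      rw [mul_smul]; exact iha.1 _ _ h'
    · obtain ⟨o', h'⟩ := iha.2 o x h
      rw [mul_inv_rev, mul_smul]; exact ihb.2 _ _ h'
  | inv a _ iha => exact ⟨iha.2, by simpa using iha.1⟩

end Form

/-- A partial result on the way to Greendlinger's lemma: a subgroup `G` for which the lemma holds,
together with a convex invariant set which has small overlap with the axes not yet used. -/
structure IsWindmill (d : V → V → ℕ) (τ Δ : ℕ) (R : Set M) (v₀ : V) (W : Set V)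
    (G : Subgroup M) : Prop where
  base : v₀ ∈ W
  convex : GeodConvex d W
  inv : ∀ g ∈ G, ∀ x ∈ W, g • x ∈ W
  long : ∀ g ∈ G, g ≠ 1 → ∃ r ∈ R,
    τ ≤ 3 * Δ + d (gate d (Axis d τ r) v₀) (gate d (Axis d τ r) (g • v₀))
  out : ∀ r ∈ R, r ∉ G → ∀ x ∈ W, x ∈ Axis d τ r → ∀ y ∈ W, y ∈ Axis d τ r → d x y ≤ 2 * Δ

namespace IsWindmill

variable {v₀ : V} {W : Set V} {G : Subgroup M}

/-- The unused relators whose axes meet `W`. -/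
def front (d : V → V → ℕ) (τ : ℕ) (R : Set M) (W : Set V) (G : Subgroup M) : Set M :=
  {r | r ∈ R ∧ r ∉ G ∧ ∃ p ∈ W, p ∈ Axis d τ r}

/-- The projection of `z` to the axis of `r` is near that of `W`. -/
def Near (d : V → V → ℕ) (τ Δ : ℕ) (W : Set V) (r : M) (z : V) : Prop :=
  ∃ w ∈ W, d (gate d (Axis d τ r) z) (gate d (Axis d τ r) w) ≤ Δ

/-- `W` together with the axes meeting it. -/
def core (d : V → V → ℕ) (τ : ℕ) (R : Set M) (W : Set V) (G : Subgroup M) : Set V :=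
  {x | x ∈ W ∨ ∃ r ∈ front d τ R W G, x ∈ Axis d τ r}

/-- The translates of the core. -/
def spread (d : V → V → ℕ) (τ : ℕ) (R : Set M) (W : Set V) (G : Subgroup M) : Set V :=
  {x | ∃ u ∈ Subgroup.closure ((G : Set M) ∪ front d τ R W G), ∃ y ∈ core d τ R W G, x = u • y}

theorem front_conj (hR : SmallOverlap d τ Δ R) (hW : IsWindmill d τ Δ R v₀ W G) {r : M}
    (hr : r ∈ front d τ R W G) {g : M} (hg : g ∈ G) : g * r * g⁻¹ ∈ front d τ R W G := by
  obtain ⟨h1, h2, p, h3, h4⟩ := hr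
  refine ⟨hR.conj r h1 g, fun h => h2 ?_, g • p, hW.inv g hg p h3, hR.smul_mem_axis g h4⟩
  have := G.mul_mem (G.mul_mem (G.inv_mem hg) h) hg
  rwa [show g⁻¹ * (g * r * g⁻¹) * g = r by group] at this

theorem gate_le (hR : SmallOverlap d τ Δ R) (hW : IsWindmill d τ Δ R v₀ W G) {r : M}
    (hr : r ∈ front d τ R W G) {x y : V} (hx : x ∈ W) (hy : y ∈ W) :
    d (gate d (Axis d τ r) x) (gate d (Axis d τ r) y) ≤ 2 * Δ := by
  obtain ⟨h1, h2, p, h3, h4⟩ := hr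
  have hgx := hR.isGate h1 x
  have hgy := hR.isGate h1 y
  exact hW.out r h1 h2 _ (TreeMetric.gate_mem hW.convex hx h4 h3 hgx) hgx.1 _
    (TreeMetric.gate_mem hW.convex hy h4 h3 hgy) hgy.1

/-- By Behrstock's alternative the gate of `z` on one of the two axes is the gate of a point of the
other axis, and axes project to each other with diameter at most `Δ`. -/
theorem near_of_not_near (hR : SmallOverlap d τ Δ R) {r s : M}
    (hr : r ∈ front d τ R W G) (hs : s ∈ front d τ R W G) (hrs : r ≠ s) {z : V}
    (h : ¬ Near d τ Δ W s z) : Near d τ Δ W r z := by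
  obtain ⟨hr1, -, p, hpW, hp⟩ := hr
  obtain ⟨hs1, -, q, hqW, hq⟩ := hs
  rcases hR.tree.gate_behrstock (hR.isGate hr1 z) (hR.isGate hs1 z) (hR.isGate hr1 _)
    (hR.isGate hs1 _) with h' | h'
  · refine ⟨q, hqW, ?_⟩
    rw [h']
    exact hR.gate_axis_le hr1 hs1 hrs (hR.isGate hs1 z).1 hq
  · refine absurd ⟨p, hpW, ?_⟩ h
    rw [h']
    exact hR.gate_axis_le hs1 hr1 hrs.symm (hR.isGate hr1 z).1 hp

theorem near_axis (hR : SmallOverlap d τ Δ R) {r s : M} (hr : r ∈ front d τ R W G)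
    (hs : s ∈ front d τ R W G) (hrs : r ≠ s) {z : V} (hz : z ∈ Axis d τ s) :
    Near d τ Δ W r z := by
  obtain ⟨hs1, -, q, hqW, hq⟩ := hs
  exact ⟨q, hqW, hR.gate_axis_le hr.1 hs1 hrs hz hq⟩

/-- The power of `r` translates by at least `τ`. Of the loss `3 * Δ`, one `Δ` is due to `Near` and
two to the projection of `W`. -/
theorem far_of_near (hR : SmallOverlap d τ Δ R) (hW : IsWindmill d τ Δ R v₀ W G) {r : M}
    (hr : r ∈ front d τ R W G) {z x : V} (hz : Near d τ Δ W r z) {k : ℤ} (hk : k ≠ 0)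
    (hx : x ∈ W) :
    τ ≤ 3 * Δ + d (gate d (Axis d τ r) x) (gate d (Axis d τ r) (r ^ k • z)) := by
  obtain ⟨w, hw, h1⟩ := hz
  rw [hR.gate_zpow_smul hr.1]
  have h2 := hR.trans r hr.1 _ (hR.isGate hr.1 z).1 k hk
  have h3 := hW.gate_le hR hr hw hx
  have h4 := hR.tree.tri (gate d (Axis d τ r) z) (gate d (Axis d τ r) w) (gate d (Axis d τ r) x)
  have h5 := hR.tree.tri (gate d (Axis d τ r) z) (gate d (Axis d τ r) x)
    (r ^ k • gate d (Axis d τ r) z)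
  omega

theorem far_of_near_of_near (hR : SmallOverlap d τ Δ R) (hW : IsWindmill d τ Δ R v₀ W G) {r : M}
    (hr : r ∈ front d τ R W G) {z x : V} (hz : Near d τ Δ W r z) {k : ℤ} (hk : k ≠ 0)
    (hx : Near d τ Δ W r x) :
    τ ≤ 4 * Δ + d (gate d (Axis d τ r) x) (gate d (Axis d τ r) (r ^ k • z)) := by
  obtain ⟨w, hw, h1⟩ := hx
  have h2 := far_of_near hR hW hr hz hk hw
  have h3 := hR.tree.tri (gate d (Axis d τ r) w) (gate d (Axis d τ r) x)
    (gate d (Axis d τ r) (r ^ k • z))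
  have h4 := hR.tree.symm (gate d (Axis d τ r) w) (gate d (Axis d τ r) x)
  omega

theorem not_near_zpow (hR : SmallOverlap d τ Δ R) (hW : IsWindmill d τ Δ R v₀ W G) {r : M}
    (hr : r ∈ front d τ R W G) {z : V} (hz : Near d τ Δ W r z) {k : ℤ} (hk : k ≠ 0) :
    ¬ Near d τ Δ W r (r ^ k • z) := by
  rintro ⟨w, hw, h1⟩
  have h2 := far_of_near hR hW hr hz hk hw
  have h3 := hR.tree.symm (gate d (Axis d τ r) w) (gate d (Axis d τ r) (r ^ k • z))
  have h4 := hR.small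
  omega

/-- Ping-pong: a point whose expression starts with `s` lies on the axis of `s` or projects there
far from `W`; in both cases it is near `W` as seen on every other axis of the front. -/
theorem near_of_form (hR : SmallOverlap d τ Δ R) (hW : IsWindmill d τ Δ R v₀ W G)
    {o : Option M} {z : V} (h : Form (front d τ R W G) W (Axis d τ) o z) :
    ∀ r ∈ front d τ R W G, o ≠ some r → Near d τ Δ W r z := by
  induction h with
  | base hx => exact fun r hr _ => ⟨_, hx, by simp [hR.tree.self]⟩
  | axis hs hx => exact fun r hr hne => near_axis hR hr hs (fun h => hne (by rw [h])) hx
  | pow hs hk _ ho ih =>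
    exact fun r hr hne => near_of_not_near hR hr hs (fun h => hne (by rw [h]))
      (not_near_zpow hR hW hs (ih _ hs ho) hk)

theorem form_vertex (hR : SmallOverlap d τ Δ R) (hW : IsWindmill d τ Δ R v₀ W G) {u : M}
    (hu : u ∈ Subgroup.closure ((G : Set M) ∪ front d τ R W G)) {o : Option M} {x : V}
    (hx : Form (front d τ R W G) W (Axis d τ) o x) :
    ∃ o, Form (front d τ R W G) W (Axis d τ) o (u • x) :=
  Form.closure_smul (fun _ hr _ hg => front_conj hR hW hr hg) hW.inv
    (fun g _ _ _ h => hR.smul_mem_axis g h) (fun _ _ h k => hR.zpow_smul_mem_axis k h) hu hx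

theorem form_of_mem_core {x : V} (hx : x ∈ core d τ R W G) :
    ∃ o, Form (front d τ R W G) W (Axis d τ) o x := by
  rcases hx with hx | ⟨r, hr, hx⟩
  · exact ⟨_, Form.base hx⟩
  · exact ⟨_, Form.axis hr hx⟩

/-- Reduced expressions are used for elements here, with base set `G`. An element outside `G` starts
with a power of some `r` in the front, and this `r` is the relator sought. -/
theorem long_closure (hR : SmallOverlap d τ Δ R) (hW : IsWindmill d τ Δ R v₀ W G) {g : M}
    (hg : g ∈ Subgroup.closure ((G : Set M) ∪ front d τ R W G)) (hg1 : g ≠ 1) :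
    ∃ r ∈ R, τ ≤ 3 * Δ + d (gate d (Axis d τ r) v₀) (gate d (Axis d τ r) (g • v₀)) := by
  have hmap : ∀ {o : Option M} {g : M}, Form (front d τ R W G) (G : Set M) (fun _ => ∅) o g →
      Form (front d τ R W G) W (Axis d τ) o (g • v₀) := by
    intro o g h
    induction h with
    | base hx => exact Form.base (hW.inv _ hx _ hW.base)
    | axis _ hx => exact hx.elim
    | pow hr hk _ ho ih =>
      rw [smul_eq_mul, mul_smul]; exact Form.pow hr hk ih ho
  obtain ⟨o, h⟩ := Form.closure_smul (X := M) (X₀ := (G : Set M)) (Y := fun _ => ∅)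
    (fun _ hr _ hg => front_conj hR hW hr hg) (fun a ha b hb => G.mul_mem ha hb)
    (fun _ _ _ _ h => h.elim) (fun _ _ h _ => h.elim) hg (Form.base G.one_mem)
  rw [smul_eq_mul, mul_one] at h
  cases h with
  | base hx => exact hW.long g hx hg1
  | axis _ hx => exact hx.elim
  | pow hr hk h' ho =>
    refine ⟨_, hr.1, ?_⟩
    rw [smul_eq_mul, mul_smul]
    exact far_of_near hR hW hr (near_of_form hR hW (hmap h') _ hr ho) hk hW.base

end IsWindmill
end Windmill
section Windmill

variable {M V : Type*} [Group M] [MulAction M V]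
variable {d : V → V → ℕ} {τ Δ : ℕ} {R : Set M}

namespace IsWindmill

variable {v₀ : V} {W : Set V} {G : Subgroup M}

/-- Each point of the core is joined to `W` inside the core, and triangles in a tree are tripods. -/
theorem core_convex (hR : SmallOverlap d τ Δ R) (hW : IsWindmill d τ Δ R v₀ W G) :
    GeodConvex d (core d τ R W G) := by
  have key : ∀ x ∈ core d τ R W G, ∃ p ∈ W, ∀ z, d x z + d z p = d x p →
      z ∈ core d τ R W G := by
    rintro x (hx | ⟨r, hr, hx⟩)
    · exact ⟨x, hx, fun z hz => Or.inl (hW.convex x hx x hx z hz)⟩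
    · obtain ⟨p, hp, hp'⟩ := hr.2.2
      exact ⟨p, hp, fun z hz => Or.inr ⟨r, hr, hR.convex r hr.1 x hx p hp' z hz⟩⟩
  intro x hx y hy z hz
  obtain ⟨p, hp, h1⟩ := key x hx
  obtain ⟨q, hq, h2⟩ := key y hy
  rcases hR.tree.thin x y p z hz with h | h
  · exact h1 z h
  rcases hR.tree.thin p y q z h with h | h
  · exact Or.inl (hW.convex p hp q hq z h)
  · refine h2 z ?_
    rw [hR.tree.symm y z, hR.tree.symm z q, hR.tree.symm y q]; omega

theorem smul_mem_spread {u : M}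
    (hu : u ∈ Subgroup.closure ((G : Set M) ∪ front d τ R W G)) {x : V}
    (hx : x ∈ spread d τ R W G) : u • x ∈ spread d τ R W G := by
  obtain ⟨v, hv, y, hy, rfl⟩ := hx
  exact ⟨u * v, mul_mem hu hv, y, hy, by rw [mul_smul]⟩

theorem core_subset_spread : core d τ R W G ⊆ spread d τ R W G :=
  fun x hx => ⟨1, one_mem _, x, hx, by simp⟩

theorem spread_convex (hR : SmallOverlap d τ Δ R) (hW : IsWindmill d τ Δ R v₀ W G) :
    GeodConvex d (spread d τ R W G) := by
  have hshift : ∀ (u : M) (x y z : V), d x z + d z (u • y) = d x (u • y) →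
      d (u⁻¹ • x) (u⁻¹ • z) + d (u⁻¹ • z) y = d (u⁻¹ • x) y := by
    intro u x y z h
    rw [← hR.isom u (u⁻¹ • x), ← hR.isom u (u⁻¹ • z) y, ← hR.isom u (u⁻¹ • x) y]
    simpa using h
  -- For a generator `u` the core meets its translate, so thin triangles suffice; for a product the
  -- path is cut at `a • v₀`.
  have key : ∀ u ∈ Subgroup.closure ((G : Set M) ∪ front d τ R W G),
      ∀ x ∈ core d τ R W G, ∀ y ∈ core d τ R W G, ∀ z,
      d x z + d z (u • y) = d x (u • y) → z ∈ spread d τ R W G := by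
    intro u hu
    induction hu using Subgroup.closure_induction with
    | mem u hu =>
      intro x hx y hy z hz
      obtain ⟨p, hp, hp'⟩ : ∃ p ∈ core d τ R W G, u • p ∈ core d τ R W G := by
        rcases hu with hu | hu
        · exact ⟨v₀, Or.inl hW.base, Or.inl (hW.inv u hu _ hW.base)⟩
        · obtain ⟨p, hp, hp'⟩ := hu.2.2
          refine ⟨p, Or.inl hp, Or.inr ⟨u, hu, ?_⟩⟩
          simpa using hR.zpow_smul_mem_axis 1 hp'
      rcases hR.tree.thin x (u • y) (u • p) z hz with h | h
      · exact core_subset_spread (core_convex hR hW x hx _ hp' z h)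
      · have h' := hshift _ _ _ _ h
        rw [inv_smul_smul] at h'
        have h2 := core_subset_spread (core_convex hR hW p hp y hy _ h')
        simpa using smul_mem_spread (Subgroup.subset_closure hu) h2
    | one =>
      intro x hx y hy z hz
      rw [one_smul] at hz
      exact core_subset_spread (core_convex hR hW x hx y hy z hz)
    | mul a b ha hb iha ihb =>
      intro x hx y hy z hz
      rw [mul_smul] at hz
      rcases hR.tree.thin x (a • b • y) (a • v₀) z hz with h | h
      · exact iha x hx v₀ (Or.inl hW.base) z h
      · have h' := hshift _ _ _ _ h
        rw [inv_smul_smul] at h'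
        simpa using smul_mem_spread ha (ihb v₀ (Or.inl hW.base) y hy _ h')
    | inv a ha iha =>
      intro x hx y hy z hz
      have h' := hshift _ _ _ _ hz
      rw [inv_inv] at h'
      have h2 := iha y hy x hx (a • z) (by
        rw [hR.tree.symm y (a • z), hR.tree.symm (a • z) (a • x), hR.tree.symm y (a • x)]; omega)
      simpa using smul_mem_spread (inv_mem ha) h2
  rintro _ ⟨u, hu, x, hx, rfl⟩ _ ⟨v, hv, y, hy, rfl⟩ z hz
  have h1 : d x (u⁻¹ • z) + d (u⁻¹ • z) ((u⁻¹ * v) • y) = d x ((u⁻¹ * v) • y) := by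
    rw [← hR.isom u x, ← hR.isom u (u⁻¹ • z) ((u⁻¹ * v) • y), ← hR.isom u x]
    simpa [mul_smul] using hz
  simpa using smul_mem_spread hu (key _ (mul_mem (inv_mem hu) hv) x hx y hy _ h1)

/-- An axis which avoids the translates of `W` has small overlap with two axes of the core. -/
theorem le_of_mem_axis_of_mem_axis (hR : SmallOverlap d τ Δ R) (hW : IsWindmill d τ Δ R v₀ W G)
    {b : M} (hb : b ∈ R) (hbW : ∀ x ∈ W, x ∉ Axis d τ b) {r s : M}
    (hr : r ∈ front d τ R W G) (hs : s ∈ front d τ R W G) (hrb : r ≠ b) (hsb : s ≠ b)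
    {x y : V} (hx : x ∈ Axis d τ r) (hxb : x ∈ Axis d τ b) (hy : y ∈ Axis d τ s)
    (hyb : y ∈ Axis d τ b) : d x y ≤ 2 * Δ := by
  obtain ⟨hr1, -, p, hpW, hp⟩ := hr
  obtain ⟨hs1, -, q, hqW, hq⟩ := hs
  have hgp := hR.isGate hb p
  have hgq := hR.isGate hb q
  -- All of `W` projects to one point of the axis of `b`. The axes of `r` and `s` meet `W`, so they
  -- pass through that point, and each contributes at most `Δ`.
  have e := hR.tree.gate_eq_of_disjoint hW.convex hbW hpW hqW hgp hgq
  have h1 := hR.overlap r hr1 b hb hrb x hx hxb _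
    (TreeMetric.gate_mem (hR.convex r hr1) hp hxb hx hgp) hgp.1
  have h2 := hR.overlap s hs1 b hb hsb y hy hyb _
    (TreeMetric.gate_mem (hR.convex s hs1) hq hyb hy hgq) hgq.1
  rw [← e] at h2
  have h3 := hR.tree.tri x (gate d (Axis d τ b) p) y
  have h4 := hR.tree.symm y (gate d (Axis d τ b) p)
  omega

/-- Translating `x` into the core puts it on the axis of some `r` in the front. An expression of the
translated `y` starting with a power of some `s ≠ r` would spread the two points far apart along the
axis of `s`, which the axis of `b` cannot follow. -/
theorem out_spread (hR : SmallOverlap d τ Δ R) (hW : IsWindmill d τ Δ R v₀ W G) {b : M}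
    (hb : b ∈ R) (hbG : b ∉ Subgroup.closure ((G : Set M) ∪ front d τ R W G)) {x y : V}
    (hx : x ∈ spread d τ R W G) (hxb : x ∈ Axis d τ b)
    (hy : y ∈ spread d τ R W G) (hyb : y ∈ Axis d τ b) : d x y ≤ 2 * Δ := by
  have hfr : ∀ r ∈ front d τ R W G, r ∈ Subgroup.closure ((G : Set M) ∪ front d τ R W G) :=
    fun r hr => Subgroup.subset_closure (Or.inr hr)
  have hconj : ∀ u ∈ Subgroup.closure ((G : Set M) ∪ front d τ R W G), ∀ b : M,
      b ∉ Subgroup.closure ((G : Set M) ∪ front d τ R W G) →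
      u⁻¹ * b * u ∉ Subgroup.closure ((G : Set M) ∪ front d τ R W G) := by
    intro u hu b hb h
    have := mul_mem (mul_mem hu h) (inv_mem hu)
    rw [show u * (u⁻¹ * b * u) * u⁻¹ = b by group] at this
    exact hb this
  have hne : ∀ b, b ∉ Subgroup.closure ((G : Set M) ∪ front d τ R W G) →
      ∀ r ∈ front d τ R W G, r ≠ b := fun b hb r hr h => hb (h ▸ hfr r hr)
  have havoid : ∀ b ∈ R, b ∉ Subgroup.closure ((G : Set M) ∪ front d τ R W G) →
      ∀ x ∈ W, x ∉ Axis d τ b := by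
    intro b hb hbG x hx hxb
    by_cases h : b ∈ G
    · exact hbG (Subgroup.subset_closure (Or.inl h))
    · exact hbG (hfr b ⟨hb, h, x, hx, hxb⟩)
  have hmove : ∀ (u b : M) (x : V), x ∈ Axis d τ b → u⁻¹ • x ∈ Axis d τ (u⁻¹ * b * u) := by
    intro u b x hx
    simpa using hR.smul_mem_axis u⁻¹ hx
  have hRc : ∀ (u b : M), b ∈ R → u⁻¹ * b * u ∈ R := by
    intro u b hb; simpa using hR.conj b hb u⁻¹
  -- the case where `x` lies on an axis of the core and `y` has a form starting with another axis
  have key : ∀ b ∈ R, b ∉ Subgroup.closure ((G : Set M) ∪ front d τ R W G) →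
      ∀ r ∈ front d τ R W G, ∀ x y o, x ∈ Axis d τ r → x ∈ Axis d τ b →
      Form (front d τ R W G) W (Axis d τ) o y → y ∈ Axis d τ b → o ≠ some r →
      d x y ≤ 2 * Δ := by
    intro b hb hbG r hr x y o hx hxb hf hyb ho
    cases hf with
    | base hy => exact absurd hyb (havoid b hb hbG y hy)
    | axis hs hy =>
      exact le_of_mem_axis_of_mem_axis hR hW hb (havoid b hb hbG) hr hs (hne b hbG r hr)
        (hne b hbG _ hs) hx hxb hy hyb
    | @pow s k o' y' hs hk hf' ho' =>
      -- Here `5 * Δ < τ` is used in full: the gates on the axis of `s` are at least `τ - 4 * Δ`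
      -- apart, while the axis of `b` projects with diameter at most `Δ`.
      exfalso
      have hsr : s ≠ r := fun h => ho (by rw [h])
      have h1 := far_of_near_of_near hR hW hs (near_of_form hR hW hf' s hs ho') hk
        (near_axis hR hs hr hsr hx)
      have h2 := hR.gate_axis_le hs.1 hb (hne b hbG s hs) hxb hyb
      have h3 := hR.small
      omega
  obtain ⟨u, hu, x, hx', rfl⟩ := hx
  rcases hx' with hx' | ⟨r, hr, hx'⟩
  · refine absurd (hmove u b _ hxb) ?_
    rw [inv_smul_smul]
    exact havoid _ (hRc u b hb) (hconj u hu b hbG) x hx'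
  obtain ⟨v, hv, y, hy', rfl⟩ := hy
  obtain ⟨o₀, hf₀⟩ := form_of_mem_core (d := d) hy'
  obtain ⟨o, hf⟩ := form_vertex hR hW (mul_mem (inv_mem hu) hv) hf₀
  have hxb' := hmove u b _ hxb
  have hyb' := hmove u b _ hyb
  rw [inv_smul_smul] at hxb'
  rw [← mul_smul] at hyb'
  have hb' := hRc u b hb
  have hbG' := hconj u hu b hbG
  rw [← hR.isom u⁻¹, inv_smul_smul, ← mul_smul]
  by_cases ho : o = some r
  -- A leading power of `r` can be removed, since it preserves the axis of `r`, on which `x` lies.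
  · subst ho
    generalize (u⁻¹ * v) • y = y₁ at *
    cases hf with
    | axis _ hy1 =>
      have := hR.overlap r hr.1 _ hb' (hne _ hbG' r hr) x hx' hxb' _ hy1 hyb'
      omega
    | @pow _ k o' y' _ hk hf' ho' =>
      have h1 := hmove (r ^ k) _ _ hxb'
      have h2 := hmove (r ^ k) _ _ hyb'
      rw [inv_smul_smul] at h2
      have h3 := key _ (hRc (r ^ k) _ hb')
        (hconj (r ^ k) (zpow_mem (hfr r hr) k) _ hbG') r hr _ y' o'
        (by simpa using hR.zpow_smul_mem_axis (-k) hx') h1 hf' h2 ho'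
      rwa [← hR.isom (r ^ k), smul_inv_smul] at h3
  · exact key _ hb' hbG' r hr x _ o hx' hxb' hf hyb' ho

theorem isWindmill_spread (hR : SmallOverlap d τ Δ R) (hW : IsWindmill d τ Δ R v₀ W G) :
    IsWindmill d τ Δ R v₀ (spread d τ R W G)
      (Subgroup.closure ((G : Set M) ∪ front d τ R W G)) where
  base := core_subset_spread (Or.inl hW.base)
  convex := spread_convex hR hW
  inv _ hg _ hx := smul_mem_spread hg hx
  long _ hg hg1 := long_closure hR hW hg hg1
  out _ hb hbG _ hx hxb _ hy hyb := out_spread hR hW hb hbG hx hxb hy hyb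

/-- The points at distance at most one from `W`. -/
def thicken (d : V → V → ℕ) (W : Set V) : Set V := {x | ∃ w ∈ W, d x w ≤ 1}

/-- An unused axis is disjoint from `W`, so it can touch the neighbourhood only at the common gate
of all points of `W`. -/
theorem isWindmill_thicken (hR : SmallOverlap d τ Δ R) (hW : IsWindmill d τ Δ R v₀ W G)
    (hT : ∀ r ∈ R, r ∉ G → ∀ x ∈ W, x ∉ Axis d τ r) :
    IsWindmill d τ Δ R v₀ (thicken d W) G where
  base := ⟨v₀, hW.base, by simp [hR.tree.self]⟩
  convex := by
    have key : ∀ x w z, w ∈ W → d x w ≤ 1 → d x z + d z w = d x w → z = x ∨ z = w := by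
      intro x w z _ h1 h2
      rcases Nat.eq_zero_or_pos (d x z) with h | h
      · exact Or.inl (hR.tree.eq_of_zero _ _ h).symm
      · exact Or.inr (hR.tree.eq_of_zero _ _ (by omega))
    rintro x ⟨p, hp, hxp⟩ y ⟨q, hq, hyq⟩ z hz
    have hsub : ∀ w ∈ W, w ∈ thicken d W := fun w hw => ⟨w, hw, by simp [hR.tree.self]⟩
    rcases hR.tree.thin x y p z hz with h | h
    · rcases key x p z hp hxp h with rfl | rfl
      · exact ⟨p, hp, hxp⟩
      · exact hsub _ hp
    rcases hR.tree.thin p y q z h with h | h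
    · exact hsub _ (hW.convex p hp q hq z h)
    · have h' : d y z + d z q = d y q := by
        rw [hR.tree.symm y z, hR.tree.symm z q, hR.tree.symm y q]; omega
      rcases key y q z hq hyq h' with rfl | rfl
      · exact ⟨q, hq, hyq⟩
      · exact hsub _ hq
  inv := by
    rintro g hg x ⟨p, hp, hxp⟩
    exact ⟨g • p, hW.inv g hg p hp, by rwa [hR.isom]⟩
  long := hW.long
  out := by
    rintro r hr hrG x ⟨p, hp, hxp⟩ hx y ⟨q, hq, hyq⟩ hy
    have hdis := hT r hr hrG
    have key : ∀ x p, p ∈ W → d x p ≤ 1 → x ∈ Axis d τ r →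
        x = gate d (Axis d τ r) p := by
      intro x p hp h1 hx
      have hg := hR.isGate hr p
      have h2 := hg.2 x hx
      have h3 : d p (gate d (Axis d τ r) p) ≠ 0 := by
        intro h
        have h4 := hR.tree.eq_of_zero _ _ h
        exact hdis p hp (h4 ▸ hg.1)
      have h5 := hR.tree.symm x p
      exact (hR.tree.eq_of_zero _ _ (by omega)).symm
    have e := hR.tree.gate_eq_of_disjoint hW.convex hdis hp hq (hR.isGate hr p) (hR.isGate hr q)
    rw [key x p hp hxp hx, key y q hq hyq hy, e]
    simp [hR.tree.self]

end IsWindmill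

open IsWindmill in
/-- **Greendlinger's lemma**, for groups acting on trees. -/
theorem greendlinger (hR : SmallOverlap d τ Δ R) {g : M} (hg : g ∈ Subgroup.normalClosure R)
    (hg1 : g ≠ 1) (v₀ : V) :
    ∃ r ∈ R, τ ≤ 3 * Δ + d (gate d (Axis d τ r) v₀) (gate d (Axis d τ r) (g • v₀)) := by
  -- A maximal windmill above the trivial one exists, since all conditions pass to unions of chains.
  obtain ⟨⟨W, G⟩, -, hW : IsWindmill d τ Δ R v₀ W G, hmax⟩ := zorn_le_nonempty₀
    {p : Set V × Subgroup M | IsWindmill d τ Δ R v₀ p.1 p.2} (by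
      intro c hc hchain p₀ hp₀
      have hdir : DirectedOn (· ≤ ·) (Prod.snd '' c) := by
        rintro _ ⟨p, hp, rfl⟩ _ ⟨q, hq, rfl⟩
        rcases hchain.total hp hq with h | h
        · exact ⟨q.2, ⟨q, hq, rfl⟩, h.2, le_rfl⟩
        · exact ⟨p.2, ⟨p, hp, rfl⟩, le_rfl, h.2⟩
      have hc : ∀ p ∈ c, IsWindmill d τ Δ R v₀ p.1 p.2 := fun p hp => hc hp
      have hmem : ∀ g, g ∈ sSup (Prod.snd '' c) ↔ ∃ p ∈ c, g ∈ p.2 := by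
        intro g
        rw [Subgroup.mem_sSup_of_directedOn (Set.Nonempty.image _ ⟨p₀, hp₀⟩) hdir]
        simp only [Set.exists_mem_image]
      have hpair : ∀ p ∈ c, ∀ q ∈ c, ∃ s ∈ c, p ≤ s ∧ q ≤ s := by
        intro p hp q hq
        rcases hchain.total hp hq with h | h
        · exact ⟨q, hq, h, le_rfl⟩
        · exact ⟨p, hp, le_rfl, h⟩
      refine ⟨((⋃ p ∈ c, p.1 : Set V), sSup (Prod.snd '' c)), ?_, fun p hp =>
        ⟨Set.subset_biUnion_of_mem (u := Prod.fst) hp,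
          le_sSup (Set.mem_image_of_mem Prod.snd hp)⟩⟩
      change IsWindmill d τ Δ R v₀ _ _
      constructor
      · exact Set.mem_biUnion hp₀ (hc _ hp₀).base
      · intro x hx y hy z hz
        simp only [Set.mem_iUnion] at hx hy ⊢
        obtain ⟨p, hp, hx⟩ := hx
        obtain ⟨q, hq, hy⟩ := hy
        obtain ⟨s, hs, hps, hqs⟩ := hpair p hp q hq
        exact ⟨s, hs, (hc _ hs).convex x (hps.1 hx) y (hqs.1 hy) z hz⟩
      · intro g hg x hx
        simp only [Set.mem_iUnion] at hx ⊢
        obtain ⟨p, hp, hx⟩ := hx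
        obtain ⟨q, hq, hg⟩ := (hmem g).1 hg
        obtain ⟨s, hs, hps, hqs⟩ := hpair p hp q hq
        exact ⟨s, hs, (hc _ hs).inv g (hqs.2 hg) x (hps.1 hx)⟩
      · intro g hg
        obtain ⟨q, hq, hg⟩ := (hmem g).1 hg
        exact (hc _ hq).long g hg
      · intro r hr hrG x hx hxr y hy hyr
        simp only [Set.mem_iUnion] at hx hy
        obtain ⟨p, hp, hx⟩ := hx
        obtain ⟨q, hq, hy⟩ := hy
        obtain ⟨s, hs, hps, hqs⟩ := hpair p hp q hq
        exact (hc _ hs).out r hr (fun h => hrG ((hmem r).2 ⟨s, hs, h⟩)) x (hps.1 hx) hxr y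
          (hqs.1 hy) hyr) ({v₀}, ⊥) (by
      refine ⟨rfl, ?_, ?_, ?_, ?_⟩
      · rintro x rfl y rfl z hz
        rw [hR.tree.self] at hz
        exact (hR.tree.eq_of_zero _ _ (by omega)).symm
      · rintro g hg x rfl
        rw [Subgroup.mem_bot.1 hg, one_smul]; rfl
      · exact fun g hg h => absurd (Subgroup.mem_bot.1 hg) h
      · rintro r _ _ x rfl _ y rfl _
        simp [hR.tree.self])
  have hmax : ∀ W' G', IsWindmill d τ Δ R v₀ W' G' → W ⊆ W' → G ≤ G' → W' ⊆ W ∧ G' ≤ G :=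
    fun W' G' h1 h2 h3 => @hmax (W', G') h1 ⟨h2, h3⟩
  -- By maximality `spread` adds nothing, so no unused axis meets `W`. Then `thicken` adds nothing
  -- either, so `W` is the whole tree and every relator is in `G`.
  have hfront : ∀ r ∈ R, r ∉ G → ∀ x ∈ W, x ∉ Axis d τ r := by
    intro r hr hrG x hx hxr
    have h := hmax _ _ (isWindmill_spread hR hW) (fun y hy => core_subset_spread (Or.inl hy))
      (fun g hg => Subgroup.subset_closure (Or.inl hg))
    exact hrG (h.2 (Subgroup.subset_closure (Or.inr ⟨hr, hrG, x, hx, hxr⟩)))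
  have hthick : thicken d W ⊆ W :=
    (hmax _ _ (isWindmill_thicken hR hW hfront)
      (fun y hy => ⟨y, hy, by simp [hR.tree.self]⟩) le_rfl).1
  have huniv : ∀ n x, d x v₀ = n → x ∈ W := by
    intro n
    induction n with
    | zero => intro x hx; rw [hR.tree.eq_of_zero _ _ hx]; exact hW.base
    | succ n ih =>
      intro x hx
      obtain ⟨y, h1, h2⟩ := hR.tree.step x v₀ (by rintro rfl; simp [hR.tree.self] at hx)
      exact hthick ⟨y, ih y (by omega), h1.le⟩
  have hRG : ∀ r ∈ R, r ∈ G := by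
    intro r hr
    by_contra h
    obtain ⟨x, hx⟩ := hR.nonempty r hr
    exact hfront r hr h x (huniv _ x rfl) hx
  refine hW.long g ?_ hg1
  have hsub : Subgroup.normalClosure R ≤ G := by
    refine (Subgroup.closure_le G).2 fun x hx => ?_
    obtain ⟨r, hr, hrx⟩ := Group.mem_conjugatesOfSet_iff.1 hx
    obtain ⟨c, rfl⟩ := isConj_iff.1 hrx
    exact hRG _ (hR.conj r hr c)
  exact hsub hg

end Windmill
-- Graphs in which every edge separates
section Graph

variable {V : Type*} {Γ : SimpleGraph V}

/-- A walk leaving `S` must use the edge from `u` to `v`; this makes distances across a separating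
edge additive. -/
theorem dist_add_le_length {u v : V} {S : V → Prop}
    (hS : ∀ x y, Γ.Adj x y → S x → ¬ S y → x = u ∧ y = v) {x z : V}
    (p : Γ.Walk x z) (hx : S x) (hz : ¬ S z) : Γ.dist x u + 1 + Γ.dist v z ≤ p.length := by
  induction p with
  | nil => exact absurd hx hz
  | @cons x y z h p ih =>
    rw [SimpleGraph.Walk.length_cons]
    by_cases hy : S y
    · have h1 := ih hy hz
      have h2 := (SimpleGraph.Reachable.dist_triangle_left h.reachable u)
      rw [SimpleGraph.dist_eq_one_iff_adj.2 h] at h2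
      omega
    · obtain ⟨rfl, rfl⟩ := hS x y h hx hy
      have := SimpleGraph.dist_le p
      rw [SimpleGraph.dist_self]
      omega

/-- A connected graph each edge of which separates the graph is a tree. -/
theorem treeMetric_dist (hc : Γ.Connected)
    (hside : ∀ u v, Γ.Adj u v → ∃ S : V → Prop, S u ∧ ¬ S v ∧
      ∀ x y, Γ.Adj x y → S x → ¬ S y → x = u ∧ y = v) : TreeMetric Γ.dist := by
  have cross : ∀ u v, Γ.Adj u v → ∃ S : V → Prop,
      (∀ x z, S x → ¬ S z → Γ.dist x z = Γ.dist x u + 1 + Γ.dist v z) ∧ S u ∧ ¬ S v := by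
    intro u v huv
    obtain ⟨S, h1, h2, h3⟩ := hside u v huv
    refine ⟨S, fun x z hx hz => le_antisymm ?_ ?_, h1, h2⟩
    · have h4 := hc.dist_triangle (u := x) (v := u) (w := z)
      have h5 := hc.dist_triangle (u := u) (v := v) (w := z)
      rw [SimpleGraph.dist_eq_one_iff_adj.2 huv] at h5
      omega
    · obtain ⟨p, hp⟩ := hc.exists_walk_length_eq_dist x z
      rw [← hp]
      exact dist_add_le_length h3 p hx hz
  have step : ∀ x y, x ≠ y → ∃ z, Γ.dist x z = 1 ∧ Γ.dist z y + 1 = Γ.dist x y := by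
    intro x y hxy
    obtain ⟨p, hp⟩ := hc.exists_walk_length_eq_dist x y
    cases p with
    | nil => exact absurd rfl hxy
    | @cons _ z _ h p =>
      refine ⟨z, SimpleGraph.dist_eq_one_iff_adj.2 h, ?_⟩
      rw [SimpleGraph.Walk.length_cons] at hp
      have h1 := SimpleGraph.dist_le p
      have h2 := hc.dist_triangle (u := x) (v := z) (w := y)
      rw [SimpleGraph.dist_eq_one_iff_adj.2 h] at h2
      omega
  refine ⟨fun x y h => (hc.dist_eq_zero_iff).1 h, fun x => SimpleGraph.dist_self,
    fun x y => SimpleGraph.dist_comm, ?_, step, ?_⟩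
  · intro x y z w
    obtain ⟨n, hn⟩ : ∃ n, Γ.dist y x = n := ⟨_, rfl⟩
    induction n generalizing y with
    | zero =>
      obtain rfl := hc.dist_eq_zero_iff.1 hn
      have := hc.dist_triangle (u := z) (v := y) (w := w)
      rw [SimpleGraph.dist_self, SimpleGraph.dist_comm (u := z) (v := y)] at *
      omega
    | succ n ih =>
      -- Replace `y` by its neighbour `y'` towards `x`. Points on the side of `y'` come nearer by 1;
      -- to the others the geodesic from `x` crosses the edge.
      obtain ⟨y', h1, h2⟩ := step y x (by rintro rfl; simp at hn)
      have hih := ih y' (by omega)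
      obtain ⟨S, h3, h4, h5⟩ := cross y' y (SimpleGraph.dist_eq_one_iff_adj.1 h1).symm
      have hx : S x := by
        by_contra hx
        have := h3 y' x h4 hx
        rw [SimpleGraph.dist_self] at this
        omega
      have key : ∀ z, (Γ.dist y' z + 1 = Γ.dist y z) ∨
          (Γ.dist x z = Γ.dist x y' + 1 + Γ.dist y z ∧ Γ.dist y' z = 1 + Γ.dist y z) := by
        intro z
        by_cases hz : S z
        · left
          have := h3 z y hz h5
          rw [SimpleGraph.dist_self, SimpleGraph.dist_comm (u := z),
            SimpleGraph.dist_comm (u := z)] at this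
          omega
        · right
          have h6 := h3 y' z h4 hz
          rw [SimpleGraph.dist_self] at h6
          exact ⟨h3 x z hx hz, by omega⟩
      have hz := key z
      have hw := key w
      have e1 := SimpleGraph.dist_comm (G := Γ) (u := x) (v := y)
      have e2 := SimpleGraph.dist_comm (G := Γ) (u := x) (v := y')
      have t := hc.dist_triangle (u := z) (v := y) (w := w)
      have e3 := SimpleGraph.dist_comm (G := Γ) (u := z) (v := y)
      omega
  · intro x y z h
    obtain ⟨S, h3, h4, h5⟩ := cross y z (SimpleGraph.dist_eq_one_iff_adj.1 h)
    by_cases hx : S x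
    · have := h3 x z hx h5
      rw [SimpleGraph.dist_self] at this
      omega
    · have := h3 y x h4 hx
      rw [SimpleGraph.dist_self, SimpleGraph.dist_comm (u := y),
        SimpleGraph.dist_comm (u := z)] at this
      omega

end Graph

/-! ### The Bass–Serre tree of a splitting -/

section Splitting

variable {M : Type*} [Group M] (S : Bool → Subgroup M)

/-- `M` is generated by two subgroups, and the elements outside of their intersection are divided
into two classes, according to the first letter of a reduced expression. -/
structure IsSplitting (P : Bool → Set M) : Prop where
  gen : Subgroup.closure ((S true : Set M) ∪ S false) = ⊤
  disj : ∀ t, ∀ g ∈ P t, g ∉ P (!t)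
  not_mem : ∀ t, ∀ g ∈ P t, g ∈ S t → g ∉ S (!t)
  cover : ∀ t g, (g ∈ S t ∧ g ∈ S (!t)) ∨ g ∈ P t ∨ g ∈ P (!t)
  right : ∀ t, ∀ g ∈ P t, ∀ s ∈ S (!t), g * s ∈ P t

/-- The vertices of the Bass–Serre tree. -/
abbrev TreeVertex : Type _ := Σ t : Bool, M ⧸ S t

/-- The two base vertices. -/
def vtx (t : Bool) : TreeVertex S := ⟨t, ((1 : M) : M ⧸ S t)⟩

/-- The Bass–Serre tree. -/
def treeGraph : SimpleGraph (TreeVertex S) where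
  Adj x y := ∃ (g : M) (t : Bool), x = g • vtx S t ∧ y = g • vtx S (!t)
  symm := ⟨by rintro _ _ ⟨g, t, rfl, rfl⟩; exact ⟨g, !t, rfl, by rw [Bool.not_not]⟩⟩
  loopless := ⟨by
    rintro x ⟨g, t, h1, h2⟩
    have : (g • vtx S t).1 = (g • vtx S (!t)).1 := by rw [← h1, ← h2]
    simp [vtx] at this⟩

variable {S}

theorem smul_vtx_eq_iff {s t : Bool} {g g' : M} :
    g • vtx S s = g' • vtx S t ↔ s = t ∧ g⁻¹ * g' ∈ S s := by
  constructor
  · intro h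
    have h1 : s = t := congrArg Sigma.fst h
    subst h1
    refine ⟨rfl, ?_⟩
    have h2 := eq_of_heq (Sigma.mk.inj h).2
    have h3 : ((g * 1 : M) : M ⧸ S s) = ((g' * 1 : M) : M ⧸ S s) := h2
    simpa [QuotientGroup.eq] using h3
  · rintro ⟨rfl, h⟩
    have h3 : ((g * 1 : M) : M ⧸ S s) = ((g' * 1 : M) : M ⧸ S s) := by
      rw [QuotientGroup.eq]; simpa using h
    exact congrArg (Sigma.mk s) h3

theorem exists_smul_vtx (x : TreeVertex S) : ∃ g : M, x = g • vtx S x.1 := by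
  obtain ⟨t, q⟩ := x
  induction q using QuotientGroup.induction_on with
  | H g =>
    refine ⟨g, congrArg (Sigma.mk t) ?_⟩
    change (g : M ⧸ S t) = ((g * 1 : M) : M ⧸ S t)
    rw [mul_one]

theorem treeGraph_adj_smul (g : M) {x y : TreeVertex S} (h : (treeGraph S).Adj x y) :
    (treeGraph S).Adj (g • x) (g • y) := by
  obtain ⟨a, t, rfl, rfl⟩ := h
  exact ⟨g * a, t, by rw [mul_smul], by rw [mul_smul]⟩

/-- The action on the tree, by graph homomorphisms. -/
def treeHom (g : M) : treeGraph S →g treeGraph S where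
  toFun x := g • x
  map_rel' h := treeGraph_adj_smul g h

theorem treeGraph_dist_smul (hc : (treeGraph S).Connected) (g : M) (x y : TreeVertex S) :
    (treeGraph S).dist (g • x) (g • y) = (treeGraph S).dist x y := by
  have key : ∀ (g : M) (x y : TreeVertex S),
      (treeGraph S).dist (g • x) (g • y) ≤ (treeGraph S).dist x y := by
    intro g x y
    obtain ⟨p, hp⟩ := hc.exists_walk_length_eq_dist x y
    rw [← hp, ← SimpleGraph.Walk.length_map (treeHom g) p]
    exact SimpleGraph.dist_le _
  refine le_antisymm (key g x y) ?_
  simpa using key g⁻¹ (g • x) (g • y)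

variable {P : Bool → Set M} (hP : IsSplitting S P)
include hP

/-- Generators from `S true` fix the base vertex, those from `S false` fix a neighbour of it. -/
theorem treeGraph_connected : (treeGraph S).Connected := by
  have key : ∀ g : M, (treeGraph S).Reachable (vtx S true) (g • vtx S true) := by
    intro g
    have hg : g ∈ Subgroup.closure ((S true : Set M) ∪ S false) := by rw [hP.gen]; trivial
    induction hg using Subgroup.closure_induction with
    | mem g hg =>
      have e : ∀ t, g ∈ S t → vtx S t = g • vtx S t := fun t hg => by
        conv_lhs => rw [← one_smul M (vtx S t)]
        exact smul_vtx_eq_iff.2 ⟨rfl, by simpa using hg⟩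
      rcases hg with hg | hg
      · rw [← e true hg]
      · have h1 : (treeGraph S).Adj (vtx S true) (vtx S false) := ⟨1, true, by simp, by simp⟩
        have h2 := treeGraph_adj_smul g h1
        rw [← e false hg] at h2
        exact h1.reachable.trans h2.symm.reachable
    | one => rw [one_smul]
    | mul a b _ _ iha ihb =>
      rw [mul_smul]; exact iha.trans (ihb.map (treeHom a))
    | inv a _ iha =>
      have := iha.map (treeHom a⁻¹)
      simp only [treeHom, RelHom.coeFn_mk, inv_smul_smul] at this
      exact this.symm
  have key' : ∀ x : TreeVertex S, (treeGraph S).Reachable (vtx S true) x := by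
    intro x
    obtain ⟨g, hg⟩ := exists_smul_vtx x
    cases hx : x.1 with
    | true => rw [hg, hx]; exact key g
    | false =>
      rw [hg, hx]
      exact (key g).trans (SimpleGraph.Adj.reachable ⟨g, true, rfl, rfl⟩)
  exact (SimpleGraph.connected_iff _).2
    ⟨fun x y => (key' x).symm.trans (key' y), ⟨vtx S true⟩⟩

theorem treeGraph_side (u v : TreeVertex S) (huv : (treeGraph S).Adj u v) :
    ∃ D : TreeVertex S → Prop, D u ∧ ¬ D v ∧
      ∀ x y, (treeGraph S).Adj x y → D x → ¬ D y → x = u ∧ y = v := by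
  obtain ⟨a, t, rfl, rfl⟩ := huv
  have hone : ∀ t, (1 : M) ∉ P t := fun t h =>
    hP.not_mem t 1 h (S t).one_mem (S (!t)).one_mem
  have hP' : ∀ t g, g ∈ P (!t) → ∀ s ∈ S t, g * s ∈ P (!t) := fun t g hg s hs =>
    hP.right (!t) g hg s (by rwa [Bool.not_not])
  suffices H : ∃ D : TreeVertex S → Prop, D (vtx S t) ∧ ¬ D (vtx S (!t)) ∧
      ∀ x y, (treeGraph S).Adj x y → D x → ¬ D y → x = vtx S t ∧ y = vtx S (!t) by
    obtain ⟨D, h1, h2, h3⟩ := H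
    refine ⟨fun x => D (a⁻¹ • x), by simpa using h1, by simpa using h2, fun x y h hx hy => ?_⟩
    obtain ⟨h4, h5⟩ := h3 _ _ (treeGraph_adj_smul a⁻¹ h) hx hy
    exact ⟨by rw [← h4, smul_inv_smul], by rw [← h5, smul_inv_smul]⟩
  -- The half-tree at `vtx S t`: this vertex and the cosets of elements with first letter of type
  -- `t`. By `right` the choice of representative does not matter, and by `cover` an edge leaving it
  -- comes from an element of the edge group.
  refine ⟨fun x => ∃ g : M, (x = g • vtx S t ∧ g ∉ P (!t)) ∨ (x = g • vtx S (!t) ∧ g ∈ P t),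
    ⟨1, Or.inl ⟨(one_smul _ _).symm, hone _⟩⟩, ?_, ?_⟩
  · rintro ⟨g, ⟨h, -⟩ | ⟨h, hg⟩⟩
    · rw [← one_smul M (vtx S (!t))] at h
      have := (smul_vtx_eq_iff.1 h).1
      simp at this
    · conv_lhs at h => rw [← one_smul M (vtx S (!t))]
      have h1 := (smul_vtx_eq_iff.1 h).2
      have h2 := hP.right t g hg g⁻¹ (by simpa using inv_mem h1)
      rw [mul_inv_cancel] at h2
      exact hone t h2
  · rintro _ _ ⟨g, s, rfl, rfl⟩ hx hy
    push Not at hy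
    rcases Bool.eq_or_eq_not s t with rfl | rfl
    · have h1 := (hy g).2 rfl
      obtain ⟨g', ⟨h2, h3⟩ | ⟨h2, h3⟩⟩ := hx
      · have h4 := (smul_vtx_eq_iff.1 h2).2
        have h5 : g ∉ P (!s) := by
          intro h
          have := hP' s g h _ h4
          rw [mul_inv_cancel_left] at this
          exact h3 this
        rcases hP.cover s g with h | h | h
        · refine ⟨?_, ?_⟩
          · conv_rhs => rw [← one_smul M (vtx S s)]
            exact smul_vtx_eq_iff.2 ⟨rfl, by simpa using h.1⟩
          · conv_rhs => rw [← one_smul M (vtx S (!s))]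
            exact smul_vtx_eq_iff.2 ⟨rfl, by simpa using h.2⟩
        · exact absurd h h1
        · exact absurd h h5
      · have := (smul_vtx_eq_iff.1 h2).1
        simp at this
    · exfalso
      rw [Bool.not_not] at hy
      have h1 := (hy g).1 rfl
      obtain ⟨g', ⟨h2, h3⟩ | ⟨h2, h3⟩⟩ := hx
      · have := (smul_vtx_eq_iff.1 h2).1
        simp at this
      · have h4 := hP.right t g' h3 _ (by simpa using inv_mem (smul_vtx_eq_iff.1 h2).2)
        rw [show g' * (g'⁻¹ * g) = g by group] at h4
        exact hP.disj t g h4 h1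

end Splitting

section BassSerre

variable {M V : Type*} [Group M] [MulAction M V]

/-- An action of `M` on a tree with an edge as fundamental domain, with vertex stabilizers
`S true` and `S false`. -/
structure BassSerre (S : Bool → Subgroup M) (d : V → V → ℕ) (v : Bool → V) : Prop where
  tree : TreeMetric d
  isom : ∀ (g : M) x y, d (g • x) (g • y) = d x y
  stab : ∀ t (g : M), g • v t = v t ↔ g ∈ S t
  edge : ∀ t, d (v t) (v (!t)) = 1
  cover : ∀ x, ∃ (g : M) (t : Bool), x = g • v t
  nbr : ∀ t x, d (v t) x = 1 → ∃ g ∈ S t, x = g • v (!t)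
  even : ∀ (g : M) x, Even (d x (g • x))

theorem bassSerre_treeGraph {S : Bool → Subgroup M} {P : Bool → Set M} (hP : IsSplitting S P) :
    BassSerre S (treeGraph S).dist (vtx S) where
  tree := treeMetric_dist (treeGraph_connected hP) (treeGraph_side hP)
  isom := treeGraph_dist_smul (treeGraph_connected hP)
  stab t g := by
    conv_lhs => rhs; rw [← one_smul M (vtx S t)]
    rw [smul_vtx_eq_iff]; simp
  edge t := SimpleGraph.dist_eq_one_iff_adj.2 ⟨1, t, by simp, by simp⟩
  cover x := ⟨_, x.1, (exists_smul_vtx x).choose_spec⟩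
  nbr t x h := by
    obtain ⟨g, s, h1, rfl⟩ := SimpleGraph.dist_eq_one_iff_adj.1 h
    rw [← one_smul M (vtx S t)] at h1
    obtain ⟨rfl, h2⟩ := smul_vtx_eq_iff.1 h1
    exact ⟨g, by simpa using h2, rfl⟩
  even g x := by
    -- Vertex types alternate along walks and are preserved by the action.
    have key : ∀ {x y} (p : (treeGraph S).Walk x y), Even p.length ↔ x.1 = y.1 := by
      intro x y p
      induction p with
      | nil => simp
      | @cons x y z h p ih =>
        rw [SimpleGraph.Walk.length_cons, Nat.even_add_one, ih]
        obtain ⟨g, t, rfl, rfl⟩ := h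
        change ¬ (!t) = z.1 ↔ t = z.1
        cases t <;> cases z.1 <;> simp
    obtain ⟨p, hp⟩ := (treeGraph_connected hP).exists_walk_length_eq_dist x (g • x)
    rw [← hp, key]
    rfl

end BassSerre

/-! ### Reduced expressions in an amalgam -/

section Pushout

open Monoid

variable {H : Type*} [Group H] {F : Bool → Type*} [∀ t, Group (F t)] (f : ∀ t, H →* F t)

/-- An alternating word without letters in the base group. -/
def Alternating (w : List (Σ t, F t)) : Prop :=
  (w.IsChain fun x y => x.1 ≠ y.1) ∧ ∀ x ∈ w, x.2 ∉ (f x.1).range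

/-- The value of a word in the amalgam. -/
def wordProd (w : List (Σ t, F t)) : PushoutI f :=
  (w.map fun x => PushoutI.of x.1 x.2).prod

variable {f}

theorem Alternating.eq_nil (hf : ∀ t, Function.Injective (f t)) {w : List (Σ t, F t)}
    (hw : Alternating f w) (h : wordProd f w ∈ (PushoutI.base f).range) : w = [] := by
  have h1 : ∀ l ∈ w, Sigma.snd l ≠ 1 := fun l hl h => hw.2 l hl (h ▸ one_mem _)
  have h2 := PushoutI.Reduced.eq_empty_of_mem_range hf (w := ⟨w, h1, hw.1⟩) hw.2 (by
    have : PushoutI.ofCoprodI (CoprodI.Word.prod ⟨w, h1, hw.1⟩) = wordProd f w := by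
      simp [CoprodI.Word.prod, wordProd, map_list_prod, List.map_map, Function.comp_def]
    rwa [this])
  exact congrArg CoprodI.Word.toList h2

/-- Elements with a reduced expression starting with a letter from the factor `t`. -/
def startsWith (f : ∀ t, H →* F t) (t : Bool) : Set (PushoutI f) :=
  {g | ∃ w h, Alternating f w ∧ w.head?.map Sigma.fst = some t ∧
    g = wordProd f w * PushoutI.base f h}

/-- A letter of type `t` multiplied on the right cannot destroy a first letter of another type; this
is what `IsSplitting.right` needs. -/
theorem Alternating.append_letter {w : List (Σ t, F t)} (hw : Alternating f w) (h : H) {t : Bool}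
    (x : F t) : ∃ w' h', Alternating f w' ∧
      wordProd f w * PushoutI.base f h * PushoutI.of t x = wordProd f w' * PushoutI.base f h' ∧
      ∀ s, s ≠ t → w.head?.map Sigma.fst = some s → w'.head?.map Sigma.fst = some s := by
  have e : PushoutI.base f h * PushoutI.of t x = PushoutI.of t (f t h * x) := by
    rw [map_mul, PushoutI.of_apply_eq_base]
  by_cases hx : f t h * x ∈ (f t).range
  · obtain ⟨k, hk⟩ := hx
    refine ⟨w, k, hw, ?_, fun s _ h => h⟩
    rw [mul_assoc, e, ← hk, PushoutI.of_apply_eq_base]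
  rcases List.eq_nil_or_concat' w with rfl | ⟨w₀, ⟨s, y⟩, rfl⟩
  · refine ⟨[⟨t, f t h * x⟩], 1, ⟨by simp, by simpa using hx⟩, ?_, by simp⟩
    simp [wordProd, e]
  have hw0 : Alternating f w₀ :=
    ⟨(List.isChain_append.1 hw.1).1, fun z hz => hw.2 z (by simp [hz])⟩
  by_cases hs : s = t
  · subst hs
    have hlast : ∀ z ∈ w₀.getLast?, z.1 ≠ s := fun z hz =>
      (List.isChain_append.1 hw.1).2.2 z hz ⟨s, y⟩ (by simp)
    have e' : wordProd f (w₀ ++ [⟨s, y⟩]) * PushoutI.base f h * PushoutI.of s x =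
        wordProd f w₀ * PushoutI.of s (y * (f s h * x)) := by
      rw [mul_assoc, e, map_mul _ y]; simp [wordProd, mul_assoc]
    by_cases hy : y * (f s h * x) ∈ (f s).range
    · obtain ⟨k, hk⟩ := hy
      refine ⟨w₀, k, hw0, by rw [e', ← hk, PushoutI.of_apply_eq_base], fun r hr h => ?_⟩
      cases w₀ with
      | nil => simp at h; exact absurd h.symm hr
      | cons a l => simpa using h
    · refine ⟨w₀ ++ [⟨s, y * (f s h * x)⟩], 1, ⟨?_, ?_⟩, ?_, fun r hr h => ?_⟩
      · refine List.isChain_append.2 ⟨hw0.1, by simp, ?_⟩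
        intro z hz z' hz'
        simp at hz'; subst hz'; exact hlast z hz
      · intro z hz
        rcases List.mem_append.1 hz with hz | hz
        · exact hw0.2 z hz
        · simp at hz; subst hz; exact hy
      · rw [e']; simp [wordProd]
      · cases w₀ with
        | nil => simpa using h
        | cons a l => simpa using h
  · refine ⟨(w₀ ++ [⟨s, y⟩]) ++ [⟨t, f t h * x⟩], 1, ⟨?_, ?_⟩, ?_, fun r hr h => ?_⟩
    · refine List.isChain_append.2 ⟨hw.1, by simp, ?_⟩
      intro z hz z' hz'
      simp at hz hz'; subst hz'; subst hz; exact hs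
    · intro z hz
      rcases List.mem_append.1 hz with hz | hz
      · exact hw.2 z hz
      · simp at hz; subst hz; exact hx
    · rw [mul_assoc, e]; simp [wordProd, mul_assoc]
    · cases w₀ with
      | nil => simpa using h
      | cons a l => simpa using h

theorem not_mem_base_of_startsWith (hf : ∀ t, Function.Injective (f t)) {t : Bool}
    {g : PushoutI f} (hg : g ∈ startsWith f t) : g ∉ (PushoutI.base f).range := by
  rintro ⟨k, rfl⟩
  obtain ⟨w, h, hw, h1, h2⟩ := hg
  have := hw.eq_nil hf ⟨k * h⁻¹, by rw [map_mul, map_inv, h2, mul_inv_cancel_right]⟩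
  subst this
  simp at h1

/-- With expressions of both types, the inverse of one followed by the other would be a nonempty
reduced word with value in the base group. -/
theorem startsWith_disjoint (hf : ∀ t, Function.Injective (f t)) {s t : Bool} (hst : s ≠ t)
    {g : PushoutI f} (hg : g ∈ startsWith f s) : g ∉ startsWith f t := by
  rintro ⟨w', h', hw', h1', h2'⟩
  obtain ⟨w, h, hw, h1, h2⟩ := hg
  let r : List (Σ t, F t) := (w.map fun x => (⟨x.1, x.2⁻¹⟩ : Σ t, F t)).reverse
  have hr : wordProd f r = (wordProd f w)⁻¹ := by
    simp only [r, wordProd, List.prod_inv_reverse, List.map_reverse, List.map_map]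
    congr 2
  have halt : Alternating f (r ++ w') := by
    refine ⟨List.isChain_append.2 ⟨?_, hw'.1, ?_⟩, fun x hx => ?_⟩
    · rw [List.isChain_reverse, List.isChain_map]
      exact hw.1.imp fun a b h => h.symm
    · intro x hx y hy
      rw [List.getLast?_reverse, List.head?_map] at hx
      cases w with
      | nil => simp at h1
      | cons a l =>
        cases w' with
        | nil => simp at h1'
        | cons b l' =>
          simp only [List.head?_cons, Option.map_some, Option.some.injEq, Option.mem_def] at *
          rw [← hx, ← hy, h1, h1']; exact hst
    · rcases List.mem_append.1 hx with hx | hx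
      · simp only [r, List.mem_reverse, List.mem_map] at hx
        obtain ⟨y, hy, rfl⟩ := hx
        exact fun h => hw.2 y hy (by simpa using inv_mem h)
      · exact hw'.2 x hx
  have := halt.eq_nil hf ⟨h * h'⁻¹, by
    have : wordProd f (r ++ w') = wordProd f r * wordProd f w' := by simp [wordProd]
    rw [this, hr, map_mul, map_inv, inv_mul_eq_iff_eq_mul.2]
    rw [← mul_assoc, ← h2, h2', mul_inv_cancel_right]⟩
  rw [List.append_eq_nil_iff] at this
  rw [this.2] at h1'
  simp at h1'

theorem isSplitting_pushoutI (hf : ∀ t, Function.Injective (f t)) :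
    IsSplitting (fun t => (PushoutI.of (φ := f) t).range) (startsWith f) := by
  have hinf : ∀ t (g : PushoutI f), g ∈ (PushoutI.of (φ := f) t).range ∧
      g ∈ (PushoutI.of (φ := f) (!t)).range ↔ g ∈ (PushoutI.base f).range := fun t g => by
    rw [← PushoutI.inf_of_range_eq_base_range hf (i := t) (j := !t) (by simp), Subgroup.mem_inf]
  have hnorm : ∀ g : PushoutI f, ∃ w h, Alternating f w ∧ g = wordProd f w * PushoutI.base f h := by
    have key : ∀ g : PushoutI f, ∀ w, Alternating f w → ∀ h, ∃ w' h', Alternating f w' ∧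
        wordProd f w * PushoutI.base f h * g = wordProd f w' * PushoutI.base f h' := by
      intro g
      induction g using PushoutI.induction_on with
      | of t x =>
        intro w hw h
        obtain ⟨w', h', h1, h2, -⟩ := hw.append_letter h x
        exact ⟨w', h', h1, h2⟩
      | base k => exact fun w hw h => ⟨w, h * k, hw, by rw [map_mul, mul_assoc]⟩
      | mul x y ihx ihy =>
        intro w hw h
        obtain ⟨w', h', h1, h2⟩ := ihx w hw h
        obtain ⟨w'', h'', h3, h4⟩ := ihy w' h1 h'
        exact ⟨w'', h'', h3, by rw [← mul_assoc, h2, h4]⟩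
    intro g
    obtain ⟨w', h', h1, h2⟩ := key g [] ⟨by simp, by simp⟩ 1
    exact ⟨w', h', h1, by simpa [wordProd] using h2⟩
  refine ⟨?_, fun t g hg => startsWith_disjoint hf (by simp) hg, ?_, ?_, ?_⟩
  · refine (Subgroup.eq_top_iff' _).2 fun g => ?_
    induction g using PushoutI.induction_on with
    | of t x =>
      refine Subgroup.subset_closure ?_
      cases t
      · exact Or.inr ⟨x, rfl⟩
      · exact Or.inl ⟨x, rfl⟩
    | base k =>
      rw [← PushoutI.of_apply_eq_base f true]
      exact Subgroup.subset_closure (Or.inl ⟨_, rfl⟩)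
    | mul x y ihx ihy => exact mul_mem ihx ihy
  · intro t g hg h1 h2
    exact not_mem_base_of_startsWith hf hg ((hinf t g).1 ⟨h1, h2⟩)
  · intro t g
    obtain ⟨w, h, hw, rfl⟩ := hnorm g
    rw [hinf]
    cases w with
    | nil => left; exact ⟨h, by simp [wordProd]⟩
    | cons a l =>
      right
      rcases Bool.eq_or_eq_not a.1 t with e | e
      · exact Or.inl ⟨_, h, hw, by simp [e], rfl⟩
      · exact Or.inr ⟨_, h, hw, by simp [e], rfl⟩
  · rintro t g ⟨w, h, hw, h1, rfl⟩ _ ⟨x, rfl⟩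
    obtain ⟨w', h', h2, h3, h4⟩ := hw.append_letter h x
    exact ⟨w', h', h2, h4 t (by simp) h1, h3⟩

end Pushout
-- Lines in the tree and bi-infinite words
section Lines

variable {M V : Type*} [Group M] [MulAction M V] {d : V → V → ℕ}

/-- Only one neighbour of `y` leads towards `x`; every other one leads away. -/
theorem TreeMetric.dist_away (hd : TreeMetric d) {x y y' z : V} (h1 : d y y' = 1) (h2 : d y z = 1)
    (hne : y' ≠ z) (h : d x y = d x y' + 1) : d x z = d x y + 1 := by
  have h0 : d y' z ≠ 0 := fun h => hne (hd.eq_of_zero _ _ h)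
  have h3 := hd.ne y' y z h2
  have h4 := hd.tri x y z
  have h5 := hd.four x y y' z
  have h6 := hd.symm y' y
  omega

/-- In a tree, a path without backtracking is geodesic. -/
theorem TreeMetric.dist_line (hd : TreeMetric d) {α : ℤ → V} (h1 : ∀ t, d (α t) (α (t + 1)) = 1)
    (h2 : ∀ t, α t ≠ α (t + 2)) (s t : ℤ) : (d (α s) (α t) : ℤ) = |s - t| := by
  have key : ∀ (s : ℤ) (n : ℕ), d (α s) (α (s + n)) = n ∧ d (α s) (α (s + (n + 1 : ℕ))) = n + 1 := by
    intro s n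
    induction n with
    | zero => simp [hd.self, h1]
    | succ n ih =>
      refine ⟨ih.2, ?_⟩
      have e1 : s + ((n + 1 + 1 : ℕ) : ℤ) = (s + n) + 2 := by push_cast; ring
      have e2 : s + ((n + 1 : ℕ) : ℤ) = (s + n) + 1 := by push_cast; ring
      rw [e2] at ih
      have h3 := h1 (s + n)
      have h4 := h1 (s + n + 1)
      rw [show s + (n : ℤ) + 1 + 1 = s + n + 2 by ring] at h4
      rw [e1, hd.dist_away (y := α (s + n + 1)) (y' := α (s + n)) (by rw [hd.symm]; exact h3) h4
        (h2 _) (by rw [ih.1, ih.2]), ih.2]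
  rcases le_total s t with h | h
  · obtain ⟨n, rfl⟩ := Int.le.dest h
    rw [(key s n).1]; rw [abs_sub_comm]; simp
  · obtain ⟨n, rfl⟩ := Int.le.dest h
    rw [hd.symm, (key t n).1]; simp

theorem TreeMetric.eq_of_geodesic (hd : TreeMetric d) {x y z w : V} (hz : d x z + d z y = d x y)
    (hw : d x w + d w y = d x y) (h : d x z = d x w) : z = w := by
  apply hd.eq_of_zero
  have h1 := hd.four x y z w
  have h2 := hd.symm y w
  have h3 := hd.symm y z
  omega

theorem TreeMetric.range_line_convex (hd : TreeMetric d) {α : ℤ → V}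
    (hα : ∀ s t, (d (α s) (α t) : ℤ) = |s - t|) : GeodConvex d (Set.range α) := by
  rintro _ ⟨s, rfl⟩ _ ⟨t, rfl⟩ z hz
  have h0 := hα s t
  rcases le_total s t with h | h
  · refine ⟨s + d (α s) z, (hd.eq_of_geodesic (x := α s) (y := α t) hz ?_ ?_).symm⟩
    · have h1 := hα s (s + d (α s) z)
      have h2 := hα (s + d (α s) z) t
      rw [abs_of_nonpos (by omega)] at h0 h1 h2
      omega
    · have h1 := hα s (s + d (α s) z)
      rw [abs_of_nonpos (by omega)] at h1
      omega
  · refine ⟨s - d (α s) z, (hd.eq_of_geodesic (x := α s) (y := α t) hz ?_ ?_).symm⟩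
    · have h1 := hα s (s - d (α s) z)
      have h2 := hα (s - d (α s) z) t
      rw [abs_of_nonneg (by omega)] at h0 h1 h2
      omega
    · have h1 := hα s (s - d (α s) z)
      rw [abs_of_nonneg (by omega)] at h1
      omega

/-- The axis of an element translating a line. -/
theorem axis_eq_range (hd : TreeMetric d) (isom : ∀ (g : M) x y, d (g • x) (g • y) = d x y)
    {α : ℤ → V} (hα : ∀ s t, (d (α s) (α t) : ℤ) = |s - t|) {r : M} {τ : ℕ} (hτ : 0 < τ)
    (hr : ∀ t, r • α t = α (t + τ)) : Axis d τ r = Set.range α := by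
  ext x
  constructor
  · intro hx
    obtain ⟨_, ⟨u, rfl⟩, hp⟩ := hd.exists_gate (hd.range_line_convex hα) (Set.range_nonempty α) x
    have hrp : IsGate d (Set.range α) (r • x) (r • α u) := by
      refine ⟨hr u ▸ Set.mem_range_self _, ?_⟩
      rintro _ ⟨t, rfl⟩
      have h1 := hp (α (t - τ)) (Set.mem_range_self _)
      have h2 := hr (t - τ)
      rw [sub_add_cancel] at h2
      rwa [← h2, isom, isom, isom]
    have h1 := hα u (u + τ)
    rw [← hr, abs_of_nonpos (by omega)] at h1
    -- The gates of `x` and `r • x` are `τ` apart, so `x` is displaced by `τ` plus twice its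
    -- distance from the line.
    have h2 := hd.gate_pair ⟨Set.mem_range_self u, hp⟩ hrp (by
      intro h
      rw [← h, hd.self] at h1
      omega)
    have hx' : d x (r • x) = τ := hx
    have h3 := isom r (α u) x
    have h4 : d x (α u) = 0 := by omega
    exact ⟨u, (hd.eq_of_zero _ _ h4).symm⟩
  · rintro ⟨t, rfl⟩
    have h1 := hα t (t + τ)
    rw [abs_of_nonpos (by omega)] at h1
    change d (α t) (r • α t) = τ
    rw [hr]; omega

theorem exists_partialProducts (f : ℤ → M) :
    ∃ p : ℤ → M, p 0 = 1 ∧ ∀ m, p (m + 1) = p m * f m := by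
  let pos : ℕ → M := fun n => Nat.rec 1 (fun n x => x * f n) n
  let neg : ℕ → M := fun n => Nat.rec 1 (fun n x => x * (f (-(n : ℤ) - 1))⁻¹) n
  refine ⟨fun m => if 0 ≤ m then pos m.toNat else neg (-m).toNat, rfl, fun m => ?_⟩
  by_cases h : 0 ≤ m
  · obtain ⟨n, rfl⟩ := Int.eq_ofNat_of_zero_le h
    have e : ((n : ℤ) + 1).toNat = n + 1 := by omega
    have h1 : (0 : ℤ) ≤ (n : ℤ) + 1 := by omega
    simp only [h, h1, if_true, e, Int.toNat_natCast]
    rfl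
  · obtain ⟨n, rfl⟩ : ∃ n : ℕ, m = -(n : ℤ) - 1 := ⟨(-m - 1).toNat, by omega⟩
    have e : (-(-(n : ℤ) - 1)).toNat = n + 1 := by omega
    dsimp only
    rw [if_neg h, e]
    have e2 : neg (n + 1) = neg n * (f (-(n : ℤ) - 1))⁻¹ := rfl
    rw [e2, inv_mul_cancel_right]
    by_cases hn : n = 0
    · subst hn; rfl
    · have h1 : ¬ (0 : ℤ) ≤ -(n : ℤ) - 1 + 1 := by omega
      have e3 : (-(-(n : ℤ) - 1 + 1)).toNat = n := by omega
      rw [if_neg h1, e3]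

/-- Periodicity of the factors becomes left multiplication on partial products; hence a relator
translates its line. -/
theorem partialProducts_add {f p : ℤ → M} (h0 : p 0 = 1) (hp : ∀ m, p (m + 1) = p m * f m)
    {c : ℤ} (hf : ∀ m, f (m + c) = f m) (m : ℤ) : p (m + c) = p c * p m := by
  induction m using Int.induction_on with
  | zero => simp [h0]
  | succ i ih =>
    rw [show (i : ℤ) + 1 + c = i + c + 1 by ring, hp, hp, ih, hf, mul_assoc]
  | pred i ih =>
    have h1 := hp (-(i : ℤ) - 1 + c)
    have h2 := hp (-(i : ℤ) - 1)
    rw [hf, show -(i : ℤ) - 1 + c + 1 = -i + c by ring, ih] at h1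
    rw [show -(i : ℤ) - 1 + 1 = -i by ring] at h2
    rw [h2, ← mul_assoc] at h1
    exact (mul_right_cancel h1).symm

theorem partialProducts_add_zmul {f p : ℤ → M} (h0 : p 0 = 1)
    (hp : ∀ m, p (m + 1) = p m * f m) {c : ℤ} (hf : ∀ m, f (m + c) = f m) (m k : ℤ) :
    p (m + c * k) = p c ^ k * p m := by
  induction k using Int.induction_on with
  | zero => simp
  | succ i ih =>
    rw [show m + c * ((i : ℤ) + 1) = m + c * i + c by ring, partialProducts_add h0 hp hf, ih,
      ← mul_assoc, add_comm, zpow_add, zpow_one]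
  | pred i ih =>
    have h1 := partialProducts_add h0 hp hf (m + c * (-(i : ℤ) - 1))
    rw [show m + c * (-(i : ℤ) - 1) + c = m + c * -i by ring, ih] at h1
    rw [sub_eq_neg_add, zpow_add, zpow_neg_one, mul_assoc, h1, inv_mul_cancel_left]
    ring_nf

variable (S : Bool → Subgroup M)

/-- A bi-infinite reduced word `⋯ l₀ a l₁ a l₂ a ⋯` with partial products `p`. -/
structure WordLine (p l : ℤ → M) (a : M) : Prop where
  l_mem : ∀ m, l m ∈ S false
  l_not : ∀ m, l m ∉ S true
  a_mem : a ∈ S true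
  a_not : a ∉ S false
  succ : ∀ m, p (m + 1) = p m * l m * a

/-- The line in the tree which belongs to a bi-infinite word. -/
def lineOf (v : Bool → V) (p : ℤ → M) (t : ℤ) : V := p (t / 2) • v (decide (t % 2 = 0))

variable {S} {v : Bool → V}

theorem lineOf_even (p : ℤ → M) (m : ℤ) : lineOf v p (2 * m) = p m • v true := by
  have h1 : 2 * m / 2 = m := by omega
  have h2 : 2 * m % 2 = 0 := by omega
  simp [lineOf, h1, h2]

theorem lineOf_odd (p : ℤ → M) (m : ℤ) : lineOf v p (2 * m + 1) = p m • v false := by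
  have h1 : (2 * m + 1) / 2 = m := by omega
  have h2 : (2 * m + 1) % 2 = 1 := by omega
  simp [lineOf, h1, h2]

/-- Reading backwards inverts the letters. The factor `a⁻¹` moves the cut from behind a letter `a`
to before it, so that a letter `l` comes next again. -/
theorem WordLine.reverse {p l : ℤ → M} {a : M} (h : WordLine S p l a) :
    WordLine S (fun m => p (-m) * a⁻¹) (fun m => (l (-m - 1))⁻¹) a⁻¹ where
  l_mem m := inv_mem (h.l_mem _)
  l_not m := fun h' => h.l_not (-m - 1) (by simpa using h')
  a_mem := inv_mem h.a_mem
  a_not := fun h' => h.a_not (by simpa using h')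
  succ m := by
    have := h.succ (-m - 1)
    rw [show -m - 1 + 1 = -m by ring] at this
    rw [this, show -(m + 1) = -m - 1 by ring]
    group

variable (hB : BassSerre S d v)
include hB

theorem BassSerre.lineOf_reverse {p l : ℤ → M} {a : M} (h : WordLine S p l a) (t : ℤ) :
    lineOf v (fun m => p (-m) * a⁻¹) t = lineOf v p (-t) := by
  rcases Int.even_or_odd' t with ⟨m, rfl | rfl⟩
  · rw [lineOf_even, show -(2 * m) = 2 * -m by ring, lineOf_even, mul_smul,
      (hB.stab true a⁻¹).2 (inv_mem h.a_mem)]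
  · have := h.succ (-m - 1)
    rw [show -m - 1 + 1 = -m by ring] at this
    rw [lineOf_odd, show -(2 * m + 1) = 2 * (-m - 1) + 1 by ring, lineOf_odd, this,
      mul_inv_cancel_right, mul_smul, (hB.stab false _).2 (h.l_mem _)]

theorem BassSerre.smul_eq_smul_iff (t : Bool) (g g' : M) :
    g • v t = g' • v t ↔ g⁻¹ * g' ∈ S t := by
  rw [← hB.stab, mul_smul, inv_smul_eq_iff, eq_comm]

theorem BassSerre.smul_ne (t : Bool) (g g' : M) : g • v t ≠ g' • v (!t) := by
  intro h
  have h1 := hB.even (g⁻¹ * g') (v (!t))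
  rw [mul_smul, ← h, inv_smul_smul, hB.tree.symm, hB.edge] at h1
  simp at h1

/-- There is no backtracking, since every `l m` is outside `S true` and `a` is outside `S false`. -/
theorem BassSerre.dist_lineOf {p l : ℤ → M} {a : M} (h : WordLine S p l a) (s t : ℤ) :
    (d (lineOf v p s) (lineOf v p t) : ℤ) = |s - t| := by
  have hsucc : ∀ m, p (m + 1) • v true = (p m * l m) • v true := fun m => by
    rw [h.succ, mul_smul, (hB.stab true a).2 h.a_mem]
  apply hB.tree.dist_line
  · intro t
    rcases Int.even_or_odd' t with ⟨m, rfl | rfl⟩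
    · rw [lineOf_even, lineOf_odd, hB.isom]; exact hB.edge true
    · rw [lineOf_odd, show 2 * m + 1 + 1 = 2 * (m + 1) by ring, lineOf_even, hsucc, mul_smul,
        hB.isom, ← (hB.stab false _).2 (h.l_mem m), hB.isom, ← (hB.stab false _).2 (h.l_mem m)]
      have := hB.edge false
      simp only [(hB.stab false _).2 (h.l_mem m)]
      exact this
  · intro t
    rcases Int.even_or_odd' t with ⟨m, rfl | rfl⟩
    · rw [lineOf_even, show 2 * m + 2 = 2 * (m + 1) by ring, lineOf_even, hsucc, Ne,
        hB.smul_eq_smul_iff, inv_mul_cancel_left]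
      exact h.l_not m
    · rw [lineOf_odd, show 2 * m + 1 + 2 = 2 * (m + 1) + 1 by ring, lineOf_odd, h.succ, Ne,
        hB.smul_eq_smul_iff, mul_assoc, inv_mul_cancel_left]
      intro h'
      exact h.a_not ((Subgroup.mul_mem_cancel_left _ (h.l_mem m)).1 h')

/-- Two lines with a long common segment: the words agree along it, up to the edge stabilizer. -/
theorem BassSerre.exists_shift {p l q l' : ℤ → M} {a a' : M} (hp : WordLine S p l a)
    (hq : WordLine S q l' a') (g : M) {x y : V} {N : ℕ}
    (hx : x ∈ Set.range (lineOf v p)) (hy : y ∈ Set.range (lineOf v p))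
    (hx' : x ∈ (g • ·) '' Set.range (lineOf v q)) (hy' : y ∈ (g • ·) '' Set.range (lineOf v q))
    (hN : 2 * N + 2 ≤ d x y) :
    ∃ m m' : ℤ, (∀ u : ℕ, u ≤ N → ∀ t, (p (m + u))⁻¹ * g * q (m' + u) ∈ S t) ∨
      (∀ u : ℕ, u ≤ N → ∀ t, (p (m + u))⁻¹ * g * (q (-(m' + u)) * a'⁻¹) ∈ S t) := by
  obtain ⟨s, rfl⟩ := hx
  obtain ⟨s', rfl⟩ := hy
  obtain ⟨_, ⟨t, rfl⟩, ht⟩ := hx'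
  obtain ⟨_, ⟨t', rfl⟩, ht'⟩ := hy'
  wlog hs : s ≤ s' generalizing s s' t t'
  · exact this s' s (by rwa [hB.tree.symm]) t' ht' t ht (le_of_not_ge hs)
  set D := d (lineOf v p s) (lineOf v p s') with hD
  have hss : (D : ℤ) = s' - s := by
    rw [hD, hB.dist_lineOf hp, abs_of_nonpos (by omega)]; ring
  have htt : (D : ℤ) = |t - t'| := by
    rw [hD, ← ht, ← ht', ← hB.dist_lineOf hq]; simp only [hB.isom]
  -- a line through both points, oriented from `x` to `y`, coincides with the first one
  have main : ∀ (q l' : ℤ → M) (a' : M), WordLine S q l' a' → ∀ t : ℤ,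
      g • lineOf v q t = lineOf v p s → g • lineOf v q (t + D) = lineOf v p s' →
      ∃ m m' : ℤ, ∀ u : ℕ, u ≤ N → ∀ t, (p (m + u))⁻¹ * g * q (m' + u) ∈ S t := by
    intro q l' a' hq t h1 h2
    have hpt : ∀ n : ℕ, n ≤ D → lineOf v p (s + n) = g • lineOf v q (t + n) := by
      intro n hn
      have e1 := hB.dist_lineOf hp s (s + n)
      have e2 := hB.dist_lineOf hp (s + n) s'
      have e3 := hB.dist_lineOf hq t (t + n)
      have e4 := hB.dist_lineOf hq (t + n) (t + D)
      rw [abs_of_nonpos (by omega)] at e1 e2 e3 e4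
      rw [← hB.isom g] at e3 e4
      rw [h1] at e3
      rw [h2] at e4
      exact hB.tree.eq_of_geodesic (x := lineOf v p s) (y := lineOf v p s') (by omega) (by omega)
        (by omega)
    have hpar : s % 2 = t % 2 := by
      have h0 := hpt 0 (Nat.zero_le _)
      rw [Nat.cast_zero, add_zero, add_zero] at h0
      by_contra hne
      rcases Int.even_or_odd' s with ⟨m, rfl | rfl⟩ <;> rcases Int.even_or_odd' t with ⟨m', rfl | rfl⟩
      · omega
      · rw [lineOf_even, lineOf_odd, ← mul_smul] at h0
        exact hB.smul_ne true _ _ h0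
      · rw [lineOf_even, lineOf_odd, ← mul_smul] at h0
        exact hB.smul_ne false _ _ h0
      · omega
    -- The segment may start at an odd position. Rounding up costs at most one step `e`, and index
    -- `u` uses the vertices `2 * u` and `2 * u + 1` steps further on; hence the bound `2 * N + 2`.
    refine ⟨(s + 1) / 2, (t + 1) / 2, fun u hu => ?_⟩
    obtain ⟨e, he⟩ : ∃ e : ℕ, s + e = 2 * ((s + 1) / 2) ∧ t + e = 2 * ((t + 1) / 2) ∧ e ≤ 1 :=
      ⟨(2 * ((s + 1) / 2) - s).toNat, by omega⟩
    have k1 := hpt (e + 2 * u) (by omega)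
    have k2 := hpt (e + 2 * u + 1) (by omega)
    rw [show s + ((e + 2 * u : ℕ) : ℤ) = 2 * ((s + 1) / 2 + u) by push_cast; omega,
      show t + ((e + 2 * u : ℕ) : ℤ) = 2 * ((t + 1) / 2 + u) by push_cast; omega,
      lineOf_even, lineOf_even, ← mul_smul, hB.smul_eq_smul_iff, ← mul_assoc] at k1
    rw [show s + ((e + 2 * u + 1 : ℕ) : ℤ) = 2 * ((s + 1) / 2 + u) + 1 by push_cast; omega,
      show t + ((e + 2 * u + 1 : ℕ) : ℤ) = 2 * ((t + 1) / 2 + u) + 1 by push_cast; omega,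
      lineOf_odd, lineOf_odd, ← mul_smul, hB.smul_eq_smul_iff, ← mul_assoc] at k2
    rintro (_ | _)
    · exact k2
    · exact k1
  rcases le_total t t' with h | h
  · rw [abs_of_nonpos (by omega)] at htt
    obtain ⟨m, m', hm⟩ := main q l' a' hq t ht (by rw [show t + (D : ℤ) = t' by omega]; exact ht')
    exact ⟨m, m', Or.inl hm⟩
  · rw [abs_of_nonneg (by omega)] at htt
    obtain ⟨m, m', hm⟩ := main _ _ _ hq.reverse (-t) (by rw [hB.lineOf_reverse hq, neg_neg]; exact ht)
      (by rw [hB.lineOf_reverse hq, show -(-t + (D : ℤ)) = t' by omega]; exact ht')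
    exact ⟨m, m', Or.inr hm⟩

end Lines
-- Combinatorics of the pattern of the word ϱ
section Pattern

/-- The positions of the second letter in the periodic word `⋯ x y x² y ⋯ x⁸⁰ y x y x² y ⋯`. -/
def blockEnd (n : ℤ) : ℤ := 3320 * (n / 80) + n % 80 * (n % 80 + 3) / 2 - 1

/-- The gaps 2, 3, …, 81 repeat cyclically and are distinct, so a single gap determines the block
modulo 80. -/
theorem blockEnd_succ (n : ℤ) : blockEnd (n + 1) = blockEnd n + n % 80 + 2 := by
  unfold blockEnd
  by_cases h : n % 80 = 79
  · have h1 : (n + 1) % 80 = 0 := by omega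
    have h2 : (n + 1) / 80 = n / 80 + 1 := by omega
    rw [h, h1, h2]; omega
  · have h1 : (n + 1) % 80 = n % 80 + 1 := by omega
    have h2 : (n + 1) / 80 = n / 80 := by omega
    rw [h1, h2, show (n % 80 + 1) * (n % 80 + 1 + 3) = n % 80 * (n % 80 + 3) + 2 * (n % 80 + 2) by
      ring]
    generalize n % 80 * (n % 80 + 3) = A
    omega

theorem blockEnd_strictMono : StrictMono blockEnd :=
  strictMono_int_of_lt_succ fun n => by rw [blockEnd_succ]; omega

theorem blockEnd_add_mul (n k : ℤ) : blockEnd (n + 80 * k) = blockEnd n + 3320 * k := by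
  unfold blockEnd
  have h1 : (n + 80 * k) % 80 = n % 80 := by omega
  have h2 : (n + 80 * k) / 80 = n / 80 + k := by omega
  rw [h1, h2]; ring

theorem dvd_blockEnd_sub {n k : ℤ} (h : n % 80 = k % 80) : 3320 ∣ blockEnd n - blockEnd k := by
  obtain ⟨c, rfl⟩ : ∃ c, n = k + 80 * c := ⟨(n - k) / 80, by omega⟩
  exact ⟨c, by rw [blockEnd_add_mul]; ring⟩

theorem range_blockEnd_add (m k : ℤ) :
    m + 3320 * k ∈ Set.range blockEnd ↔ m ∈ Set.range blockEnd := by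
  have key : ∀ m k, m ∈ Set.range blockEnd → m + 3320 * k ∈ Set.range blockEnd := by
    rintro _ k ⟨n, rfl⟩
    exact ⟨n + 80 * k, blockEnd_add_mul n k⟩
  refine ⟨fun h => ?_, key m k⟩
  have := key _ (-k) h
  rwa [show m + 3320 * k + 3320 * -k = m by ring] at this

theorem exists_blockEnd_near (m : ℤ) : ∃ n, m ≤ blockEnd n ∧ blockEnd n < m + 81 := by
  have h0 : ∀ k, blockEnd (80 * k) = 3320 * k - 1 := fun k => by
    have h1 := blockEnd_add_mul 0 k
    have h2 : blockEnd 0 = -1 := by decide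
    rw [zero_add, h2] at h1
    omega
  obtain ⟨n, hn, hmax⟩ := Int.exists_greatest_of_bdd (P := fun n => blockEnd n < m)
    ⟨80 * (m / 3320 + 1), fun z hz => by
      by_contra hlt
      have h1 := blockEnd_strictMono (not_le.1 hlt)
      rw [h0] at h1
      omega⟩ ⟨80 * (m / 3320), by rw [h0]; omega⟩
  refine ⟨n + 1, ?_, ?_⟩
  · by_contra h
    have := hmax (n + 1) (not_le.1 h)
    omega
  · rw [blockEnd_succ]; omega

theorem eq_succ_of_no_blockEnd_between {i j : ℤ} (hij : blockEnd i < blockEnd j)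
    (h : ∀ x ∈ Set.range blockEnd, blockEnd i < x → ¬ x < blockEnd j) : j = i + 1 := by
  have h1 := blockEnd_strictMono.lt_iff_lt.1 hij
  by_contra hne
  exact h _ ⟨i + 1, rfl⟩ (blockEnd_strictMono (by omega)) (blockEnd_strictMono (by omega))

/-- The window contains two neighbouring block ends; their gap determines the block modulo 80, hence
the position modulo 3320. -/
theorem dvd_sub_of_pattern {m m' : ℤ}
    (h : ∀ u : ℕ, u < 300 → (m + u ∈ Set.range blockEnd ↔ m' + u ∈ Set.range blockEnd)) :
    3320 ∣ m' - m := by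
  have h' : ∀ x, m ≤ x → x < m + 300 →
      (x ∈ Set.range blockEnd ↔ x + (m' - m) ∈ Set.range blockEnd) := by
    intro x h1 h2
    have := h (x - m).toNat (by omega)
    rwa [show m + ((x - m).toNat : ℤ) = x by omega,
      show m' + ((x - m).toNat : ℤ) = x + (m' - m) by omega] at this
  obtain ⟨n, hn1, hn2⟩ := exists_blockEnd_near m
  have hs := blockEnd_succ n
  obtain ⟨i, hi⟩ := (h' (blockEnd n) hn1 (by omega)).1 ⟨n, rfl⟩
  obtain ⟨j, hj⟩ := (h' (blockEnd (n + 1)) (by omega) (by omega)).1 ⟨n + 1, rfl⟩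
  obtain rfl : j = i + 1 := by
    refine eq_succ_of_no_blockEnd_between (by omega) fun x hx h1 h2 => ?_
    have h3 := (h' (x - (m' - m)) (by omega) (by omega)).2 (by rwa [sub_add_cancel])
    obtain ⟨k, hk⟩ := h3
    have h4 := blockEnd_strictMono.lt_iff_lt.1 (show blockEnd n < blockEnd k by omega)
    have h5 := blockEnd_strictMono.lt_iff_lt.1 (show blockEnd k < blockEnd (n + 1) by omega)
    omega
  have hs' := blockEnd_succ i
  have := dvd_blockEnd_sub (n := i) (k := n) (by omega)
  rwa [hi, add_sub_cancel_left] at this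

/-- Gaps grow by 1, cyclically, from block to block; read backwards they shrink by 1. Three block
ends, so two gaps, in the window give a contradiction. -/
theorem not_reverse_pattern {m m' : ℤ}
    (h : ∀ u : ℕ, u < 300 → (m + u ∈ Set.range blockEnd ↔ -(m' + u) - 1 ∈ Set.range blockEnd)) :
    False := by
  have h' : ∀ x, m ≤ x → x < m + 300 →
      (x ∈ Set.range blockEnd ↔ m - m' - 1 - x ∈ Set.range blockEnd) := by
    intro x h1 h2
    have := h (x - m).toNat (by omega)
    rwa [show m + ((x - m).toNat : ℤ) = x by omega,
      show -(m' + ((x - m).toNat : ℤ)) - 1 = m - m' - 1 - x by omega] at this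
  obtain ⟨n, hn1, hn2⟩ := exists_blockEnd_near m
  have key : ∀ n i j, m ≤ blockEnd n → blockEnd (n + 1) < m + 300 →
      blockEnd i = m - m' - 1 - blockEnd n → blockEnd j = m - m' - 1 - blockEnd (n + 1) →
      i = j + 1 := by
    intro n i j h1 h2 h3 h4
    have hs := blockEnd_succ n
    refine eq_succ_of_no_blockEnd_between (by omega) fun x hx h5 h6 => ?_
    obtain ⟨k, hk⟩ := (h' (m - m' - 1 - x) (by omega) (by omega)).2 (by rwa [sub_sub_cancel])
    have h4 := blockEnd_strictMono.lt_iff_lt.1 (show blockEnd n < blockEnd k by omega)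
    have h5 := blockEnd_strictMono.lt_iff_lt.1 (show blockEnd k < blockEnd (n + 1) by omega)
    omega
  have hs := blockEnd_succ n
  have hs2 := blockEnd_succ (n + 1)
  obtain ⟨i, hi⟩ := (h' (blockEnd n) hn1 (by omega)).1 ⟨n, rfl⟩
  obtain ⟨j, hj⟩ := (h' (blockEnd (n + 1)) (by omega) (by omega)).1 ⟨n + 1, rfl⟩
  obtain ⟨k, hk⟩ := (h' (blockEnd (n + 1 + 1)) (by omega) (by omega)).1 ⟨n + 1 + 1, rfl⟩
  have e1 := key n i j hn1 (by omega) hi hj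
  have e2 := key (n + 1) j k (by omega) (by omega) hj hk
  have h1 := blockEnd_succ j
  have h2 := blockEnd_succ k
  rw [← e1] at h1
  rw [← e2] at h2
  omega

/-- The gap 2 occurs only after positions congruent to -1 modulo 3320; all other gaps are at least
3. -/
theorem not_blockEnd_add {m : ℤ} (h : m ∈ Set.range blockEnd) :
    m + 1 ∉ Set.range blockEnd ∧ (m % 3320 < 3300 → m + 2 ∉ Set.range blockEnd) := by
  obtain ⟨n, rfl⟩ := h
  have h0 := blockEnd_succ n
  have hgap : ∀ x ∈ Set.range blockEnd, blockEnd n < x → blockEnd (n + 1) ≤ x := by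
    rintro _ ⟨k, rfl⟩ hk
    have := blockEnd_strictMono.lt_iff_lt.1 hk
    exact blockEnd_strictMono.monotone (by omega)
  refine ⟨fun h => ?_, fun hm h => ?_⟩
  · have := hgap _ h (by omega)
    omega
  · have h1 := hgap _ h (by omega)
    have h2 : n % 80 = (0 : ℤ) % 80 := by omega
    have h3 := dvd_blockEnd_sub h2
    have h4 : blockEnd 0 = -1 := by decide
    omega

/-- A position far from the seams of the pattern. -/
def Inner (x : ℤ) : Prop := 10 < x % 3320 ∧ x % 3320 < 3290

/-- The positions that are not inner form runs of 41 integers, less than 50, so at most one of the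
three shifts is bad. Two patterns then still leave a common good shift. -/
theorem inner_add (x : ℤ) : (Inner (x + 0) ∧ Inner (x + 50)) ∨ (Inner (x + 0) ∧ Inner (x + 100)) ∨
    (Inner (x + 50) ∧ Inner (x + 100)) := by
  unfold Inner; omega

theorem inner_sub (x : ℤ) : (Inner (x - 0) ∧ Inner (x - 50)) ∨ (Inner (x - 0) ∧ Inner (x - 100)) ∨
    (Inner (x - 50) ∧ Inner (x - 100)) := by
  unfold Inner; omega

theorem Inner.not_dvd {x : ℤ} (h : Inner x) {e : ℤ} (h1 : -5 ≤ e) (h2 : e ≤ 5) :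
    ¬ 3320 ∣ x + e := by
  unfold Inner at h; omega

theorem Inner.not_blockEnd {x : ℤ} (h : Inner x) {e e' : ℤ} (h1 : -5 ≤ e) (h2 : e < e')
    (h3 : e' ≤ e + 2) (h4 : e' ≤ 5) (he : x + e ∈ Set.range blockEnd) :
    x + e' ∉ Set.range blockEnd := by
  have h5 := not_blockEnd_add he
  obtain rfl | rfl : e' = e + 1 ∨ e' = e + 2 := by omega
  · rw [← add_assoc]; exact h5.1
  · rw [← add_assoc]; exact h5.2 (by unfold Inner at h; omega)

/-- Two occurrences of the pattern have a common position, not too far away, where both have the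
first letter. -/
theorem exists_free_position (m : ℤ) {σ : ℕ → ℤ}
    (hσ : (∃ m', ∀ u : ℕ, σ u = m' + u) ∨ ∃ m', ∀ u : ℕ, σ u = -(m' + u) - 1) :
    ∃ u : ℕ, u < 200 ∧ m + ((u + 1 : ℕ) : ℤ) ∉ Set.range blockEnd ∧
      ¬ 3320 ∣ m + ((u + 1 : ℕ) : ℤ) ∧ σ (u + 1) ∉ Set.range blockEnd ∧ ¬ 3320 ∣ σ (u + 1) := by
  obtain ⟨ε, hε, s, hs⟩ : ∃ ε : ℤ, (ε = 1 ∨ ε = -1) ∧ ∃ s, ∀ u : ℕ, σ u = s + ε * u := by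
    rcases hσ with ⟨m', h⟩ | ⟨m', h⟩
    · exact ⟨1, Or.inl rfl, m', fun u => by rw [h]; ring⟩
    · exact ⟨-1, Or.inr rfl, -m' - 1, fun u => by rw [h]; ring⟩
  obtain ⟨u₀, hu, h1, h2⟩ : ∃ u₀ : ℕ, u₀ < 150 ∧ Inner (m + u₀) ∧ Inner (σ u₀) := by
    have a := inner_add m
    have b : (Inner (σ 0) ∧ Inner (σ 50)) ∨ (Inner (σ 0) ∧ Inner (σ 100)) ∨
        (Inner (σ 50) ∧ Inner (σ 100)) := by
      simp only [hs]
      rcases hε with rfl | rfl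
      · simpa using inner_add s
      · simpa [← sub_eq_add_neg] using inner_sub s
    by_contra hcon
    push Not at hcon
    have a1 := hcon 0 (by norm_num)
    have a2 := hcon 50 (by norm_num)
    have a3 := hcon 100 (by norm_num)
    push_cast at a1 a2 a3
    tauto
  have e1 : ∀ e : ℕ, m + ((u₀ + e : ℕ) : ℤ) = m + u₀ + e := fun e => by push_cast; ring
  have e2 : ∀ e : ℕ, σ (u₀ + e) = σ u₀ + ε * e := fun e => by rw [hs, hs]; push_cast; ring
  have d1 : ∀ e : ℕ, e ≤ 3 → ¬ 3320 ∣ m + ((u₀ + e : ℕ) : ℤ) := fun e he => by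
    rw [e1]; exact h1.not_dvd (by omega) (by omega)
  have d2 : ∀ e : ℕ, e ≤ 3 → ¬ 3320 ∣ σ (u₀ + e) := fun e he => by
    rw [e2]; exact h2.not_dvd (by rcases hε with rfl | rfl <;> omega)
      (by rcases hε with rfl | rfl <;> omega)
  have g1 : ∀ e e' : ℕ, e < e' → e' ≤ e + 2 → e' ≤ 3 → m + ((u₀ + e : ℕ) : ℤ) ∈ Set.range blockEnd →
      m + ((u₀ + e' : ℕ) : ℤ) ∉ Set.range blockEnd := by
    intro e e' h3 h4 h5
    rw [e1, e1]
    exact h1.not_blockEnd (by omega) (by omega) (by omega) (by omega)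
  have g2 : ∀ e e' : ℕ, e < e' → e' ≤ e + 2 → e' ≤ 3 → σ (u₀ + e) ∈ Set.range blockEnd →
      σ (u₀ + e') ∉ Set.range blockEnd := by
    intro e e' h3 h4 h5 hy hz
    rw [e2] at hy hz
    rcases hε with rfl | rfl
    · exact h2.not_blockEnd (by omega) (by omega) (by omega) (by omega) hy hz
    · exact h2.not_blockEnd (by omega) (by omega) (by omega) (by omega) hz hy
  -- Near an inner position block ends are at least 3 apart, so each pattern occupies at most one of
  -- `u₀ + 1`, `u₀ + 2`, `u₀ + 3`, and one of the three is free in both.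
  by_contra hcon
  push Not at hcon
  have c : ∀ e : ℕ, e < 3 → m + ((u₀ + (e + 1) : ℕ) : ℤ) ∈ Set.range blockEnd ∨
      σ (u₀ + (e + 1)) ∈ Set.range blockEnd := by
    intro e he
    by_contra h
    push Not at h
    exact d2 (e + 1) (by omega) (hcon (u₀ + e) (by omega) h.1 (d1 (e + 1) (by omega)) h.2)
  have c0 := c 0 (by norm_num)
  have c1 := c 1 (by norm_num)
  have c2 := c 2 (by norm_num)
  have g1a := g1 1 2 (by norm_num) (by norm_num) (by norm_num)
  have g1b := g1 1 3 (by norm_num) (by norm_num) (by norm_num)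
  have g1c := g1 2 3 (by norm_num) (by norm_num) (by norm_num)
  have g2a := g2 1 2 (by norm_num) (by norm_num) (by norm_num)
  have g2b := g2 1 3 (by norm_num) (by norm_num) (by norm_num)
  have g2c := g2 2 3 (by norm_num) (by norm_num) (by norm_num)
  rw [show 0 + 1 = 1 from rfl] at c0
  rw [show 1 + 1 = 2 from rfl] at c1
  rw [show 2 + 1 = 3 from rfl] at c2
  rcases c0 with c0 | c0 <;> rcases c1 with c1 | c1 <;> rcases c2 with c2 | c2
  · exact g1a c0 c1
  · exact g1a c0 c1
  · exact g1b c0 c2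
  · exact g2c c1 c2
  · exact g1c c1 c2
  · exact g2b c0 c2
  · exact g2a c0 c1
  · exact g2a c0 c1

end Pattern
-- The words of the relators and the overlaps of their axes
section Relators

variable {M : Type*} [Group M]

open Classical in
/-- The letters `b`, `b'` in the order in which they occur in `ϱ(b a, b' a)`. -/
noncomputable def baseLetter (b b' : M) (m : ℤ) : M := if m ∈ Set.range blockEnd then b' else b

/-- The letters from the second factor in the periodic word `⋯ h⁻¹ ϱ(b a, b' a) h⁻¹ ϱ(b a, b' a) ⋯`. -/
noncomputable def letter (h b b' : M) (m : ℤ) : M :=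
  if 3320 ∣ m then h⁻¹ * baseLetter b b' m else baseLetter b b' m

omit [Group M] in
theorem baseLetter_add (b b' : M) (m k : ℤ) :
    baseLetter b b' (m + 3320 * k) = baseLetter b b' m := by
  by_cases hm : m ∈ Set.range blockEnd
  · rw [baseLetter, baseLetter, if_pos hm, if_pos ((range_blockEnd_add m k).2 hm)]
  · rw [baseLetter, baseLetter, if_neg hm, if_neg fun h' => hm ((range_blockEnd_add m k).1 h')]

theorem letter_add (h b b' : M) (m k : ℤ) : letter h b b' (m + 3320 * k) = letter h b b' m := by
  unfold letter
  rw [baseLetter_add]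
  exact if_congr (by omega) rfl rfl

omit [Group M] in
theorem baseLetter_of_mem {m : ℤ} (hm : m ∈ Set.range blockEnd) (b b' : M) :
    baseLetter b b' m = b' := if_pos hm

omit [Group M] in
theorem baseLetter_of_not_mem {m : ℤ} (hm : m ∉ Set.range blockEnd) (b b' : M) :
    baseLetter b b' m = b := if_neg hm

theorem letter_of_not_dvd {m : ℤ} (hm : ¬ 3320 ∣ m) (h b b' : M) :
    letter h b b' m = baseLetter b b' m := if_neg hm

/-- The value of a period of the word. -/
theorem partialProducts_period {h a b b' : M} {p : ℤ → M} (h0 : p 0 = 1)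
    (hp : ∀ m, p (m + 1) = p m * (letter h b b' m * a)) :
    p 3320 = h⁻¹ * rho (b * a) (b' * a) := by
  obtain ⟨q, hq0, hq⟩ := exists_partialProducts fun m => baseLetter b b' m * a
  -- Within a period the factor `h⁻¹` occurs only at position 0.
  have hpq : ∀ n : ℕ, n < 3320 → p (n + 1) = h⁻¹ * q (n + 1) := by
    intro n hn
    induction n with
    | zero =>
      rw [hp, hq]
      simp [letter, h0, hq0, mul_assoc]
    | succ n ih =>
      have h1 : ¬ (3320 : ℤ) ∣ ((n + 1 : ℕ) : ℤ) := by omega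
      have h2 := ih (by omega)
      rw [hp, hq, letter_of_not_dvd h1]
      push_cast
      rw [h2, mul_assoc]
  -- Block `k` starts after `blockEnd k` with `k % 80 + 1` letters `b`.
  have hrow : ∀ k : ℤ, ∀ j : ℕ, (j : ℤ) ≤ k % 80 + 1 →
      q (blockEnd k + 1 + j) = q (blockEnd k + 1) * (b * a) ^ j := by
    intro k j
    induction j with
    | zero => simp
    | succ j ih =>
      intro hj
      have h1 : blockEnd k + 1 + j ∉ Set.range blockEnd := by
        rintro ⟨i, hi⟩
        have h2 := blockEnd_succ k
        have h3 := blockEnd_strictMono.lt_iff_lt.1 (show blockEnd k < blockEnd i by omega)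
        have h4 := blockEnd_strictMono.lt_iff_lt.1
          (show blockEnd i < blockEnd (k + 1) by push_cast at hj; omega)
        omega
      push_cast
      rw [← add_assoc, hq, ih (by push_cast at hj; omega), baseLetter_of_not_mem h1, pow_succ,
        mul_assoc]
  have hblock : ∀ n : ℕ, n ≤ 80 → q (blockEnd n + 1) =
      ((List.range n).map fun k => (b * a) ^ (k + 1) * (b' * a)).prod := by
    intro n
    induction n with
    | zero =>
      intro _
      have : blockEnd ((0 : ℕ) : ℤ) + 1 = 0 := by decide
      rw [this, hq0]; simp
    | succ n ih =>
      intro hn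
      rw [List.range_succ, List.map_append, List.prod_append, ← ih (by omega)]
      have h1 : ((n : ℤ)) % 80 = n := by omega
      have h2 := hrow n (n + 1) (by push_cast; omega)
      have h3 := blockEnd_succ n
      rw [h1] at h3
      push_cast at h2 ⊢
      rw [show blockEnd ((n : ℤ) + 1) + 1 = blockEnd n + 1 + ((n : ℤ) + 1) + 1 by omega, hq, h2,
        baseLetter_of_mem ⟨n + 1, by omega⟩]
      simp [mul_assoc]
  have h1 := hpq 3319 (by norm_num)
  have h2 := hblock 80 le_rfl
  have h3 : blockEnd ((80 : ℕ) : ℤ) + 1 = 3320 := by decide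
  rw [h3] at h2
  norm_num only at h1
  rw [h1, h2]
  rfl

variable (S : Bool → Subgroup M) {I : Type*}

/-- Compatibility of two indices, inside of the amalgam. -/
def CompatibleIn (a b b' : I → M) (i k : I) : Prop :=
  GoodFellows (S true ⊓ S false) (a i) (a k) ∨
  (b i = b k ∧ b' i = b' k ∧ a i ≠ a k) ∨
  GoodFellows (S true ⊓ S false) (b i) (b k) ∨
  ∃ K' : Subgroup M, a i ∈ K' ∧ a k ∈ K' ∧
    GoodFellows (K' ⊓ (S true ⊓ S false)) (b i) (b k) ∧
    ∀ x ∈ K', x ∈ S true → x ∉ S false → ∀ y ∈ S true ⊓ S false, y ∉ K' →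
      ∀ z ∈ K', z ∈ S true → z ∉ S false → x * y * z ∉ S false

/-- The hypotheses of the amalgamation lemma, inside of the amalgam. -/
structure RelatorData (h a b b' : I → M) : Prop where
  mal : ∀ x ∈ S true, x ∈ S false → ∀ l ∈ S false, l ∉ S true → l⁻¹ * x * l ∈ S true → x = 1
  h_mem : ∀ i t, h i ∈ S t
  a_mem : ∀ i, a i ∈ S true
  a_not : ∀ i, a i ∉ S false
  b_mem : ∀ i, b i ∈ S false
  b_not : ∀ i, b i ∉ S true
  b'_mem : ∀ i, b' i ∈ S false
  b'_not : ∀ i, b' i ∉ S true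
  good : ∀ i, GoodFellows (S true ⊓ S false) (b i) (b' i)
  compat : ∀ i k, i ≠ k → CompatibleIn S a b b' i k

variable {S}

/-- The shape in which letters are compared along a common segment; the inverse occurs when the
segment is traversed in opposite directions. -/
theorem GoodFellows.false_of_eq {H : Subgroup M} {x y y' : M} (hg : GoodFellows H x y)
    (hy : y' = y ∨ y' = y⁻¹) {s t : M} (hs : s ∈ H) (ht : t ∈ H) (h : x * t = s * y') : False := by
  have h1 := hg s hs t⁻¹ (inv_mem ht)
  rcases hy with rfl | rfl
  · exact h1.1 (eq_mul_inv_of_mul_eq h)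
  · exact h1.2 (eq_mul_inv_of_mul_eq h)

theorem GoodFellows.symm {H : Subgroup M} {x y : M} (hg : GoodFellows H x y) :
    GoodFellows H y x := by
  intro s hs t ht
  refine ⟨fun h => (hg s⁻¹ (inv_mem hs) t⁻¹ (inv_mem ht)).1 ?_, fun h =>
    (hg t ht s hs).2 ?_⟩
  · rw [h]; group
  · rw [h]; group

/-- Comparison of the letters of two words along a common segment. -/
theorem edge_relation {p l q l' : ℤ → M} {a a' g : M} (hp : WordLine S p l a)
    (hq : WordLine S q l' a') {m m' : ℤ}
    (h0 : ∀ t, (p m)⁻¹ * g * q m' ∈ S t) (h1 : ∀ t, (p (m + 1))⁻¹ * g * q (m' + 1) ∈ S t) :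
    a * ((p (m + 1))⁻¹ * g * q (m' + 1)) * a'⁻¹ ∈ S true ⊓ S false ∧
      l m * (a * ((p (m + 1))⁻¹ * g * q (m' + 1)) * a'⁻¹) = (p m)⁻¹ * g * q m' * l' m' := by
  have e : a * ((p (m + 1))⁻¹ * g * q (m' + 1)) * a'⁻¹ =
      (l m)⁻¹ * ((p m)⁻¹ * g * q m') * l' m' := by
    rw [hp.succ, hq.succ]; group
  refine ⟨Subgroup.mem_inf.2 ⟨?_, ?_⟩, ?_⟩
  · exact mul_mem (mul_mem hp.a_mem (h1 true)) (inv_mem hq.a_mem)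
  · have : (l m)⁻¹ * ((p m)⁻¹ * g * q m') * l' m' ∈ S false :=
      mul_mem (mul_mem (inv_mem (hp.l_mem m)) (h0 false)) (hq.l_mem m')
    rwa [← e] at this
  · rw [e]; group

namespace RelatorData

variable {h a b b' : I → M} (hD : RelatorData S h a b b')
include hD

theorem baseLetter_mem (i : I) (m : ℤ) : baseLetter (b i) (b' i) m ∈ S false := by
  unfold baseLetter; split_ifs
  exacts [hD.b'_mem i, hD.b_mem i]

theorem baseLetter_not (i : I) (m : ℤ) : baseLetter (b i) (b' i) m ∉ S true := by
  unfold baseLetter; split_ifs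
  exacts [hD.b'_not i, hD.b_not i]

theorem exists_letter_eq (i : I) (m : ℤ) :
    ∃ c ∈ S true ⊓ S false, letter (h i) (b i) (b' i) m = c * baseLetter (b i) (b' i) m := by
  unfold letter; split_ifs
  · exact ⟨_, inv_mem ⟨hD.h_mem i true, hD.h_mem i false⟩, rfl⟩
  · exact ⟨1, one_mem _, (one_mul _).symm⟩

theorem wordLine {i : I} {p : ℤ → M}
    (hp : ∀ m, p (m + 1) = p m * (letter (h i) (b i) (b' i) m * a i)) :
    WordLine S p (letter (h i) (b i) (b' i)) (a i) where
  l_mem m := by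
    obtain ⟨c, hc, e⟩ := hD.exists_letter_eq i m
    rw [e]; exact mul_mem hc.2 (hD.baseLetter_mem i m)
  l_not m := by
    obtain ⟨c, hc, e⟩ := hD.exists_letter_eq i m
    rw [e, Subgroup.mul_mem_cancel_left _ hc.1]; exact hD.baseLetter_not i m
  a_mem := hD.a_mem i
  a_not := hD.a_not i
  succ m := by rw [hp, mul_assoc]

/-- If the letters of two words agree up to `H` along a long segment, then the words have the same
letters `b`, `b'`, and the segments have the same place in the pattern. -/
theorem segment_aux {i j : I} {p q l' : ℤ → M} {a' g : M}
    (hp : WordLine S p (letter (h i) (b i) (b' i)) (a i)) (hq : WordLine S q l' a')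
    (ha' : a' = a j ∨ a' = (a j)⁻¹) {m m' : ℤ} {σ : ℕ → ℤ}
    (hσ : (∃ m', ∀ u : ℕ, σ u = m' + u) ∨ ∃ m', ∀ u : ℕ, σ u = -(m' + u) - 1)
    (hl : (∀ u : ℕ, l' (m' + u) = letter (h j) (b j) (b' j) (σ u)) ∨
      ∀ u : ℕ, l' (m' + u) = (letter (h j) (b j) (b' j) (σ u))⁻¹)
    (hκ : ∀ u : ℕ, u ≤ 300 → ∀ t, (p (m + u))⁻¹ * g * q (m' + u) ∈ S t) :
    b i = b j ∧ b' i = b' j ∧ (i ≠ j → a i ≠ a j) ∧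
      ∀ u : ℕ, u < 300 → (m + u ∈ Set.range blockEnd ↔ σ u ∈ Set.range blockEnd) := by
  -- Two words along a common segment bound a strip whose rungs are elements of `H`: `κ u` behind a
  -- letter `a`, and `ρ u` before it. For `ρ` this is known only from index 1 on.
  set κ : ℕ → M := fun u => (p (m + u))⁻¹ * g * q (m' + u) with hκdef
  set ρ : ℕ → M := fun u => a i * κ u * a'⁻¹ with hρdef
  have hκH : ∀ u : ℕ, u ≤ 300 → κ u ∈ S true ⊓ S false := fun u hu => ⟨hκ u hu true, hκ u hu false⟩
  have hrel : ∀ u : ℕ, u < 300 → ρ (u + 1) ∈ S true ⊓ S false ∧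
      letter (h i) (b i) (b' i) (m + u) * ρ (u + 1) = κ u * l' (m' + u) := by
    intro u hu
    have h1 := hκ (u + 1) (by omega)
    have h2 := edge_relation hp hq (hκ u (by omega)) (m := m + u) (m' := m' + u) (by
      push_cast at h1; simpa only [add_assoc] using h1)
    simp only [hρdef, hκdef]
    push_cast
    simpa only [add_assoc] using h2
  -- comparison of base letters
  have hbase : ∀ u : ℕ, u < 300 → ∃ s ∈ S true ⊓ S false, ∃ t ∈ S true ⊓ S false, ∃ y : M,
      (y = baseLetter (b j) (b' j) (σ u) ∨ y = (baseLetter (b j) (b' j) (σ u))⁻¹) ∧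
      baseLetter (b i) (b' i) (m + u) * t = s * y := by
    intro u hu
    obtain ⟨h1, h2⟩ := hrel u hu
    obtain ⟨c, hc, e⟩ := hD.exists_letter_eq i (m + u)
    obtain ⟨c', hc', e'⟩ := hD.exists_letter_eq j (σ u)
    rw [e] at h2
    rcases hl with hl | hl
    · rw [hl, e'] at h2
      refine ⟨c⁻¹ * κ u * c', mul_mem (mul_mem (inv_mem hc) (hκH u hu.le)) hc', _, h1, _,
        Or.inl rfl, ?_⟩
      calc _ = c⁻¹ * (c * baseLetter (b i) (b' i) (m + u) * ρ (u + 1)) := by group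
        _ = _ := by rw [h2]; group
    · rw [hl, e'] at h2
      refine ⟨c⁻¹ * κ u, mul_mem (inv_mem hc) (hκH u hu.le), ρ (u + 1) * c', mul_mem h1 hc', _,
        Or.inr rfl, ?_⟩
      calc _ = c⁻¹ * (c * baseLetter (b i) (b' i) (m + u) * ρ (u + 1)) * c' := by group
        _ = _ := by rw [h2]; group
  -- At position `u + 1` both words have the plain letter `b`, without a factor `h⁻¹`.
  obtain ⟨u, hu, f1, f2, f3, f4⟩ := exists_free_position m hσ
  have heq : b i = b j ∧ b' i = b' j ∧ (i ≠ j → a i ≠ a j) := by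
    by_cases hij : i = j
    · subst hij; exact ⟨rfl, rfl, fun h => absurd rfl h⟩
    rcases hD.compat i j hij with h1 | h1 | h1 | ⟨K', h1, h2, h3, h4⟩
    · obtain ⟨h2, -⟩ := hrel 0 (by norm_num)
      exact (h1.false_of_eq ha' h2 (hκH 1 (by norm_num)) (by simp [hρdef])).elim
    · exact ⟨h1.1, h1.2.1, fun _ => h1.2.2⟩
    · obtain ⟨s, hs, t, ht, y, hy, e⟩ := hbase (u + 1) (by omega)
      rw [baseLetter_of_not_mem f3] at hy
      rw [baseLetter_of_not_mem f1] at e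
      exact (h1.false_of_eq hy hs ht e).elim
    -- Case (d). A `κ` outside `K'` would put `ρ = a i * κ * a'⁻¹` outside `H`. So from index 1 on
    -- all `κ` and `ρ` are in `K'`, and at the free position `b i`, `b j` are not good fellows over
    -- the intersection of `K'` and `H`.
    · exfalso
      have ha'K : a' ∈ K' := by rcases ha' with rfl | rfl; exacts [h2, inv_mem h2]
      have hmem : ∀ u : ℕ, u < 300 → κ (u + 1) ∈ K' ∧ ρ (u + 1) ∈ K' := by
        intro u hu
        have hk : κ (u + 1) ∈ K' := by
          by_contra hk
          refine h4 _ h1 hp.a_mem hp.a_not _ (hκH (u + 1) (by omega)) hk _ (inv_mem ha'K)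
            (inv_mem hq.a_mem) (fun h => hq.a_not (by simpa using h)) (hrel u hu).1.2
        exact ⟨hk, mul_mem (mul_mem h1 hk) (inv_mem ha'K)⟩
      obtain ⟨h5, h6⟩ := hrel (u + 1) (by omega)
      rw [letter_of_not_dvd f2, baseLetter_of_not_mem f1] at h6
      have hy : l' (m' + ((u + 1 : ℕ) : ℤ)) = b j ∨ l' (m' + ((u + 1 : ℕ) : ℤ)) = (b j)⁻¹ := by
        rcases hl with hl | hl
        · left; rw [hl, letter_of_not_dvd f4, baseLetter_of_not_mem f3]
        · right; rw [hl, letter_of_not_dvd f4, baseLetter_of_not_mem f3]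
      exact h3.false_of_eq hy ⟨(hmem u (by omega)).1, hκH (u + 1) (by omega)⟩
        ⟨(hmem (u + 1) (by omega)).2, h5⟩ h6
  refine ⟨heq.1, heq.2.1, heq.2.2, fun u hu => ?_⟩
  obtain ⟨s, hs, t, ht, y, hy, e⟩ := hbase u hu
  have hg := hD.good i
  constructor
  · intro h1
    by_contra h2
    rw [baseLetter_of_mem h1] at e
    rw [baseLetter_of_not_mem h2, ← heq.1] at hy
    exact hg.symm.false_of_eq hy hs ht e
  · intro h2
    by_contra h1
    rw [baseLetter_of_not_mem h1] at e
    rw [baseLetter_of_mem h2, ← heq.2.1] at hy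
    exact hg.false_of_eq hy hs ht e

end RelatorData

end Relators
section Relators

variable {M : Type*} [Group M]

/-- The element `hᵢ⁻¹ ϱ(bᵢ aᵢ, bᵢ' aᵢ)`. -/
def relatorIn {I : Type*} (h a b b' : I → M) (i : I) : M :=
  (h i)⁻¹ * rho (b i * a i) (b' i * a i)

/-- The conjugates of the elements `hᵢ⁻¹ ϱ(bᵢ aᵢ, bᵢ' aᵢ)`. -/
def relatorConj {I : Type*} (h a b b' : I → M) : Set M :=
  {r | ∃ i g, r = g * relatorIn h a b b' i * g⁻¹}

namespace RelatorData

variable {S : Bool → Subgroup M} {I : Type*} {h a b b' : I → M} (hD : RelatorData S h a b b')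
variable {V : Type*} [MulAction M V] {d : V → V → ℕ} {v : Bool → V} (hB : BassSerre S d v)
include hD

omit hD in
theorem partialProducts_shift {p : ℤ → M} {i : I} (h0 : p 0 = 1)
    (hp : ∀ m, p (m + 1) = p m * (letter (h i) (b i) (b' i) m * a i)) (m k : ℤ) :
    p (m + 3320 * k) = relatorIn h a b b' i ^ k * p m := by
  rw [partialProducts_add_zmul h0 hp, partialProducts_period h0 hp]
  · rfl
  · intro m
    have := letter_add (h i) (b i) (b' i) m 1
    rw [mul_one] at this
    rw [this]

omit hD in
theorem relator_zpow_smul_lineOf {p : ℤ → M} {i : I} (h0 : p 0 = 1)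
    (hp : ∀ m, p (m + 1) = p m * (letter (h i) (b i) (b' i) m * a i)) (t k : ℤ) :
    relatorIn h a b b' i ^ k • lineOf v p t = lineOf v p (t + 6640 * k) := by
  unfold lineOf
  have h1 : (t + 6640 * k) / 2 = t / 2 + 3320 * k := by omega
  have h2 : (t + 6640 * k) % 2 = t % 2 := by omega
  rw [h1, h2, partialProducts_shift h0 hp, mul_smul]

include hB

theorem overlap {p : I → ℤ → M} (h0 : ∀ i, p i 0 = 1)
    (hp : ∀ i m, p i (m + 1) = p i m * (letter (h i) (b i) (b' i) m * a i)) {i j : I} {g : M}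
    {x y : V} (hx : x ∈ Set.range (lineOf v (p i))) (hy : y ∈ Set.range (lineOf v (p i)))
    (hx' : x ∈ (g • ·) '' Set.range (lineOf v (p j)))
    (hy' : y ∈ (g • ·) '' Set.range (lineOf v (p j))) (hxy : 605 < d x y) :
    i = j ∧ g ∈ Subgroup.zpowers (relatorIn h a b b' i) := by
  have hli := hD.wordLine (hp i)
  have hlj := hD.wordLine (hp j)
  -- The bound 605 comes from `606 = 2 * 302 + 2`.
  obtain ⟨m, m', hκ | hκ⟩ := hB.exists_shift hli hlj g (N := 302) hx hy hx' hy' (by omega)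
  · obtain ⟨e1, e2, e3, e4⟩ := hD.segment_aux hli hlj (Or.inl rfl) (σ := fun u => m' + u)
      (Or.inl ⟨m', fun u => rfl⟩) (Or.inl fun u => rfl) (fun u hu => hκ u (by omega))
    obtain ⟨k, hk⟩ := dvd_sub_of_pattern e4
    obtain rfl : m' = m + 3320 * k := by omega
    -- away from the multiples of the period, the discrepancy is trivial
    have key : ∀ u : ℕ, u ≤ 200 → ¬ 3320 ∣ m + u →
        (p i (m + u))⁻¹ * g * p j (m + 3320 * k + u) = 1 ∧
        a i * ((p i (m + u + 1))⁻¹ * g * p j (m + 3320 * k + u + 1)) * (a j)⁻¹ = 1 := by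
      intro u hu hdvd
      have h1 := hκ (u + 1) (by omega)
      push_cast at h1
      simp only [← add_assoc] at h1
      obtain ⟨h2, h3⟩ := edge_relation hli hlj (hκ u (by omega)) h1
      rw [show m + 3320 * k + (u : ℤ) = m + u + 3320 * k by ring] at h3 ⊢
      rw [letter_add] at h3
      rw [letter_of_not_dvd hdvd, letter_of_not_dvd hdvd, ← e1, ← e2] at h3
      rw [show m + 3320 * k + (u : ℤ) + 1 = m + u + 3320 * k + 1 by ring] at h2
      have h4 := hκ u (by omega)
      rw [show m + 3320 * k + (u : ℤ) = m + u + 3320 * k by ring] at h4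
      -- Equal letters `l` face each other: `l * ρ = κ * l` with `κ`, `ρ` in `H`. Malnormality in
      -- `L` gives `κ = 1`, and then `ρ = 1`.
      have h5 : (p i (m + u))⁻¹ * g * p j (m + u + 3320 * k) = 1 := by
        refine hD.mal _ (h4 true) (h4 false) _ (hD.baseLetter_mem i (m + u))
          (hD.baseLetter_not i (m + u)) ?_
        rw [mul_assoc, ← h3, inv_mul_cancel_left]; exact h2.1
      rw [h5, one_mul] at h3
      exact ⟨h5, mul_eq_left.1 h3⟩
    -- Two neighbouring positions are needed: trivial rungs on both sides of one letter `a` give `a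
    -- i = a j`.
    obtain ⟨u, hu, d1, d2⟩ : ∃ u : ℕ, u ≤ 2 ∧ ¬ 3320 ∣ m + u ∧ ¬ 3320 ∣ m + u + 1 := by
      by_cases c1 : 3320 ∣ m
      · exact ⟨1, by omega⟩
      · by_cases c2 : 3320 ∣ m + 1
        · exact ⟨2, by omega⟩
        · exact ⟨0, by simpa using ⟨c1, c2⟩⟩
    have k1 := key u (by omega) d1
    have k2 := key (u + 1) (by omega) (by push_cast; rwa [← add_assoc])
    push_cast at k2
    simp only [← add_assoc] at k2
    have hij : i = j := by
      by_contra hij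
      apply e3 hij
      have := k1.2
      rw [k2.1, mul_one, mul_inv_eq_one] at this
      exact this
    subst hij
    refine ⟨rfl, Subgroup.mem_zpowers_iff.2 ⟨-k, ?_⟩⟩
    have := k1.1
    rw [show m + 3320 * k + (u : ℤ) = m + u + 3320 * k by ring,
      partialProducts_shift (h0 i) (hp i)] at this
    rw [zpow_neg, inv_eq_iff_mul_eq_one, mul_eq_one_iff_eq_inv, eq_comm, inv_eq_iff_mul_eq_one]
    rw [mul_assoc, inv_mul_eq_one, ← mul_assoc] at this
    exact mul_eq_right.1 this.symm
  · obtain ⟨-, -, -, e4⟩ := hD.segment_aux hli hlj.reverse (Or.inr rfl)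
      (σ := fun u => -(m' + u) - 1) (Or.inr ⟨m', fun u => rfl⟩) (Or.inr fun u => rfl)
      (fun u hu => hκ u (by omega))
    exact (not_reverse_pattern e4).elim

theorem exists_lines : ∃ p : I → ℤ → M, (∀ i, p i 0 = 1) ∧
    (∀ i m, p i (m + 1) = p i m * (letter (h i) (b i) (b' i) m * a i)) ∧
    ∀ i g, Axis d 6640 (g * relatorIn h a b b' i * g⁻¹) =
      (g • ·) '' Set.range (lineOf v (p i)) := by
  choose p h0 hp using fun i => exists_partialProducts
    fun m => letter (h i) (b i) (b' i) m * a i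
  refine ⟨p, h0, hp, fun i g => ?_⟩
  have h1 := axis_eq_range hB.tree hB.isom (hB.dist_lineOf (hD.wordLine (hp i)))
    (r := relatorIn h a b b' i) (τ := 6640) (by norm_num) (fun t => by
      have := relator_zpow_smul_lineOf (v := v) (h0 i) (hp i) t 1
      simpa using this)
  ext x
  rw [← smul_inv_smul g x, mem_axis_conj hB.isom, h1]
  constructor
  · rintro ⟨t, ht⟩
    exact ⟨_, ⟨t, rfl⟩, by rw [ht]⟩
  · rintro ⟨_, ⟨t, rfl⟩, ht⟩
    exact ⟨t, smul_left_cancel g ht⟩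

/-- Two axes with a long overlap are equal, and the conjugating elements differ by a power of
the relator. -/
theorem mem_zpowers_of_overlap {i j : I} {g g' : M} {x y : V}
    (hx : x ∈ Axis d 6640 (g * relatorIn h a b b' i * g⁻¹))
    (hy : y ∈ Axis d 6640 (g * relatorIn h a b b' i * g⁻¹))
    (hx' : x ∈ Axis d 6640 (g' * relatorIn h a b b' j * g'⁻¹))
    (hy' : y ∈ Axis d 6640 (g' * relatorIn h a b b' j * g'⁻¹)) (hxy : 605 < d x y) :
    i = j ∧ g⁻¹ * g' ∈ Subgroup.zpowers (relatorIn h a b b' i) := by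
  obtain ⟨p, h0, hp, hax⟩ := hD.exists_lines hB
  rw [hax] at hx hy hx' hy'
  have key : ∀ x, x ∈ (g • ·) '' Set.range (lineOf v (p i)) →
      g⁻¹ • x ∈ Set.range (lineOf v (p i)) := by
    rintro _ ⟨z, hz, rfl⟩; simpa using hz
  have key' : ∀ x, x ∈ (g' • ·) '' Set.range (lineOf v (p j)) →
      g⁻¹ • x ∈ ((g⁻¹ * g') • ·) '' Set.range (lineOf v (p j)) := by
    rintro _ ⟨z, hz, rfl⟩; exact ⟨z, hz, by simp [mul_smul]⟩
  exact hD.overlap hB h0 hp (key x hx) (key y hy) (key' x hx') (key' y hy') (by rwa [hB.isom])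

/-- Used for (B) and (G): an element taking the axis of `r` to one that follows it for more than 605
is a power of `r`, hence in `N`. -/
theorem mem_zpowers_of_axis_overlap {r g : M} (hr : r ∈ relatorConj h a b b') {x y : V}
    (hx : x ∈ Axis d 6640 r) (hy : y ∈ Axis d 6640 r) (hx' : x ∈ Axis d 6640 (g * r * g⁻¹))
    (hy' : y ∈ Axis d 6640 (g * r * g⁻¹)) (hxy : 605 < d x y) : g ∈ Subgroup.zpowers r := by
  obtain ⟨i, c, rfl⟩ := hr
  rw [show g * (c * relatorIn h a b b' i * c⁻¹) * g⁻¹ =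
    (g * c) * relatorIn h a b b' i * (g * c)⁻¹ by group] at hx' hy'
  obtain ⟨-, h1⟩ := hD.mem_zpowers_of_overlap hB hx hy hx' hy' hxy
  obtain ⟨k, hk⟩ := Subgroup.mem_zpowers_iff.1 h1
  refine Subgroup.mem_zpowers_iff.2 ⟨k, ?_⟩
  rw [conj_zpow, hk]; group

/-- A period of 3320 letters `l` and 3320 letters `a` has length 6640 in the tree; the bound 605 is
that of `overlap`. -/
theorem smallOverlap : SmallOverlap d 6640 605 (relatorConj h a b b') where
  tree := hB.tree
  isom := hB.isom
  conj := by
    rintro _ ⟨i, c, rfl⟩ g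
    exact ⟨i, g * c, by group⟩
  nonempty := by
    obtain ⟨p, h0, hp, hax⟩ := hD.exists_lines hB
    rintro _ ⟨i, c, rfl⟩
    rw [hax]
    exact (Set.range_nonempty _).image _
  convex := by
    obtain ⟨p, h0, hp, hax⟩ := hD.exists_lines hB
    rintro _ ⟨i, c, rfl⟩ x hx y hy z hz
    rw [← smul_inv_smul c x, mem_axis_conj hB.isom] at hx
    rw [← smul_inv_smul c y, mem_axis_conj hB.isom] at hy
    rw [← smul_inv_smul c z, mem_axis_conj hB.isom]
    have h1 := hax i 1
    simp only [one_mul, inv_one, mul_one, one_smul, Set.image_id'] at h1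
    rw [h1] at hx hy ⊢
    exact hB.tree.range_line_convex (hB.dist_lineOf (hD.wordLine (hp i))) _ hx _ hy _
      (by simpa only [hB.isom] using hz)
  trans := by
    obtain ⟨p, h0, hp, hax⟩ := hD.exists_lines hB
    rintro _ ⟨i, c, rfl⟩ x hx k hk
    rw [hax] at hx
    obtain ⟨_, ⟨t, rfl⟩, rfl⟩ := hx
    have h1 := hB.dist_lineOf (hD.wordLine (hp i)) t (t + 6640 * k)
    dsimp only
    rw [conj_zpow, mul_smul, mul_smul, inv_smul_smul, hB.isom,
      relator_zpow_smul_lineOf (h0 i) (hp i)]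
    rcases lt_or_gt_of_ne hk with hk | hk
    · rw [abs_of_nonneg (by omega)] at h1
      omega
    · rw [abs_of_nonpos (by omega)] at h1
      omega
  overlap := by
    rintro _ ⟨i, c, rfl⟩ _ ⟨j, c', rfl⟩ hne x hx hx' y hy hy'
    by_contra hxy
    obtain ⟨rfl, h1⟩ := hD.mem_zpowers_of_overlap hB hx hy hx' hy' (not_le.1 hxy)
    apply hne
    obtain ⟨k, hk⟩ := Subgroup.mem_zpowers_iff.1 h1
    obtain rfl : c' = c * relatorIn h a b b' i ^ k := by rw [hk]; group
    group
  small := by norm_num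

end RelatorData

end Relators
-- Alternating words and distances
section Words

variable {M V : Type*} [Group M] [MulAction M V] {d : V → V → ℕ} {v : Bool → V}
  {S : Bool → Subgroup M}

/-- Words with letters alternately from `S s \ S (!s)` and `S (!s) \ S s`; the first two arguments
are the types of the first and the last letter. -/
inductive AltWord (S : Bool → Subgroup M) : Bool → Bool → List M → Prop
  | single {s g} : g ∈ S s → g ∉ S (!s) → AltWord S s s [g]
  | cons {s t g w} : g ∈ S s → g ∉ S (!s) → AltWord S (!s) t w → AltWord S s t (g :: w)

namespace AltWord

theorem pair {s : Bool} {x y : M} (hx : x ∈ S s) (hx' : x ∉ S (!s)) (hy : y ∈ S (!s))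
    (hy' : y ∉ S s) : AltWord S s (!s) [x, y] :=
  cons hx hx' (single hy (by rwa [Bool.not_not]))

theorem append {s t t' : Bool} {w w' : List M} (h : AltWord S s t w) (h' : AltWord S (!t) t' w') :
    AltWord S s t' (w ++ w') := by
  induction h with
  | single h1 h2 => exact cons h1 h2 h'
  | cons h1 h2 _ ih => exact cons h1 h2 (ih h')

theorem split {s t : Bool} {w w' : List M} (h : AltWord S s t (w ++ w')) (hw : w ≠ [])
    (hw' : w' ≠ []) : ∃ r, AltWord S s r w ∧ AltWord S (!r) t w' := by
  induction w generalizing s with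
  | nil => exact absurd rfl hw
  | cons g w ih =>
    cases w with
    | nil =>
      cases h with
      | single _ _ => exact absurd rfl hw'
      | cons h1 h2 h3 => exact ⟨s, single h1 h2, h3⟩
    | cons g' w =>
      cases h with
      | cons h1 h2 h3 =>
        obtain ⟨r, h4, h5⟩ := ih h3 (by simp)
        exact ⟨r, cons h1 h2 h4, h5⟩

theorem inv {s t : Bool} {w : List M} (h : AltWord S s t w) :
    AltWord S t s (w.map (·⁻¹)).reverse := by
  induction h with
  | single h1 h2 => exact single (inv_mem h1) (fun h => h2 (by simpa using h))
  | @cons s t g w h1 h2 _ ih =>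
    rw [List.map_cons, List.reverse_cons]
    have h' : AltWord S (!(!s)) s [g⁻¹] := by
      rw [Bool.not_not]; exact single (inv_mem h1) (fun h => h2 (by simpa using h))
    exact ih.append h'

theorem ne_nil {s t : Bool} {w : List M} (h : AltWord S s t w) : w ≠ [] := by
  cases h <;> simp

theorem even_length {s t : Bool} {w : List M} (h : AltWord S s t w) :
    Even w.length ↔ t = !s := by
  induction h with
  | single => simp
  | @cons s t _ _ _ _ _ ih =>
    rw [List.length_cons, Nat.even_add_one, ih]
    cases s <;> cases t <;> simp

variable (hB : BassSerre S d v)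
include hB

/-- The word traces a path without backtracking from the base edge to its translate; the four values
depend on which ends of the two edges are compared. -/
theorem dist {s t : Bool} {w : List M} (h : AltWord S s t w) :
    (d (v s) (w.prod • v (!t)) = w.length ∧ d (v (!s)) (w.prod • v (!t)) = w.length + 1) ∧
      d (v s) (w.prod • v t) + 1 = w.length ∧ d (v (!s)) (w.prod • v t) = w.length := by
  -- A letter of type `s` fixes `v s` and turns the base edge away, so a point beyond `v (!s)` is
  -- moved to one that `v (!s)` reaches only through `v s`.
  have key : ∀ s (g : M), g ∈ S s → g ∉ S (!s) → ∀ z n, d (v (!s)) z = n → d (v s) z = n + 1 →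
      d (v s) (g • z) = n + 1 ∧ d (v (!s)) (g • z) = n + 1 + 1 := by
    intro s g h1 h2 z n h3 h4
    have h5 : g⁻¹ • v s = v s := (hB.stab s _).2 (inv_mem h1)
    have h6 : d (v s) (g • z) = d (v s) z := by
      rw [← hB.isom g⁻¹, h5, inv_smul_smul]
    refine ⟨by rw [h6, h4], ?_⟩
    rw [← hB.isom g⁻¹, inv_smul_smul, hB.tree.symm]
    have h7 := hB.edge s
    rw [hB.tree.symm] at h4
    rw [hB.tree.symm] at h3
    rw [hB.tree.dist_away (y := v s) (y' := v (!s)) h7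
      (by conv_lhs => rw [← h5]
          rw [hB.isom]; exact h7) ?_ (by rw [h3, h4]), h4]
    intro h
    rw [eq_comm, hB.stab] at h
    exact h2 (by simpa using h)
  induction h with
  | @single s g h1 h2 =>
    have h3 : g • v s = v s := (hB.stab s _).2 h1
    have e : d (v (!s)) (v s) = 1 := by rw [hB.tree.symm]; exact hB.edge s
    have h4 := key s g h1 h2 (v (!s)) 0 (hB.tree.self _) (hB.edge s)
    simp only [List.prod_cons, List.prod_nil, mul_one, List.length_cons, List.length_nil]
    exact ⟨h4, by rw [h3, hB.tree.self], by rw [h3, e]⟩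
  | @cons s t g w h1 h2 _ ih =>
    rw [Bool.not_not] at ih
    obtain ⟨⟨i1, i2⟩, i3, i4⟩ := ih
    rw [List.prod_cons, mul_smul, mul_smul, List.length_cons]
    refine ⟨key s g h1 h2 _ _ i1 i2, ?_⟩
    have h4 := key s g h1 h2 _ (d (v (!s)) (w.prod • v t)) rfl (by rw [i4, i3])
    rw [i3] at h4
    exact ⟨by rw [h4.1], h4.2⟩

end AltWord

theorem exists_altWord {w : List M} (hw : w ≠ []) (h1 : ∀ x ∈ w, x ∈ S true ∨ x ∈ S false)
    (h2 : ∀ x ∈ w, x ∉ S true ⊓ S false)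
    (h3 : w.IsChain fun x y => (x ∈ S true ↔ y ∈ S false)) : ∃ s t, AltWord S s t w := by
  have hx : ∀ x ∈ w, ∃ s, x ∈ S s ∧ x ∉ S (!s) := by
    intro x hx
    have h4 := h2 x hx
    rw [Subgroup.mem_inf] at h4
    rcases h1 x hx with h | h
    · exact ⟨true, h, fun h' => h4 ⟨h, h'⟩⟩
    · exact ⟨false, h, fun h' => h4 ⟨h', h⟩⟩
  induction w with
  | nil => exact absurd rfl hw
  | cons x w ih =>
    obtain ⟨s, hs, hs'⟩ := hx x (by simp)
    cases w with
    | nil => exact ⟨s, s, AltWord.single hs hs'⟩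
    | cons y w =>
      obtain ⟨s', t, h⟩ := ih (by simp) (fun z hz => h1 z (List.mem_cons_of_mem _ hz))
        (fun z hz => h2 z (List.mem_cons_of_mem _ hz)) (List.isChain_cons_cons.1 h3).2
        (fun z hz => hx z (List.mem_cons_of_mem _ hz))
      have hxy := (List.isChain_cons_cons.1 h3).1
      have hy : y ∈ S s' ∧ y ∉ S (!s') := by cases h <;> exact ⟨by assumption, by assumption⟩
      have : s' = !s := by
        cases s <;> cases s' <;> simp_all
      subst this
      exact ⟨s, t, AltWord.cons hs hs' h⟩

end Words

/-! ### Short elements and malnormality in the quotient -/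

section Quotient

variable {M V : Type*} [Group M] [MulAction M V] {d : V → V → ℕ} {v : Bool → V}
  {S : Bool → Subgroup M}

namespace BassSerre

variable (hB : BassSerre S d v)
include hB

theorem displacement_le {s : Bool} {g : M} (hg : g ∈ S s) (t : Bool) :
    d (v t) (g • v t) ≤ 2 := by
  have h1 : g • v s = v s := (hB.stab s g).2 hg
  have h2 := hB.tree.tri (v t) (v s) (g • v t)
  have h3 : d (v s) (g • v t) = d (v s) (v t) := by rw [← h1, hB.isom, h1]
  rcases Bool.eq_or_eq_not t s with rfl | rfl
  · rw [h1, hB.tree.self]; omega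
  · have h4 := hB.edge s
    have h5 := hB.tree.symm (v s) (v !s)
    omega

theorem displacement_mul (t : Bool) (g g' : M) :
    d (v t) ((g * g') • v t) ≤ d (v t) (g • v t) + d (v t) (g' • v t) := by
  have h1 := hB.tree.tri (v t) (g • v t) (g • g' • v t)
  rw [hB.isom] at h1
  rwa [mul_smul]

theorem displacement_inv (t : Bool) (g : M) : d (v t) (g⁻¹ • v t) = d (v t) (g • v t) := by
  rw [← hB.isom g, smul_inv_smul, hB.tree.symm]

/-- An equality between conjugates by elements of one factor takes place in the edge group. -/
theorem mem_of_double_coset {s : Bool} {x y k k' : M} (hx : x ∈ S s) (hy : y ∈ S s)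
    (hk : k ∈ S (!s)) (hk' : k' ∈ S (!s)) (hxy : ¬ (x ∈ S (!s) ∧ y ∈ S (!s)))
    (h : x = k * y * k') : k ∈ S s ∧ k' ∈ S s := by
  have hy' : y ∉ S (!s) := fun hy' => hxy ⟨by rw [h]; exact mul_mem (mul_mem hk hy') hk', hy'⟩
  have hks : k ∈ S s := by
    -- Otherwise `k * y` moves `v (!s)` to distance 3 from `v s`, while `x` keeps it at distance 1.
    by_contra hks
    have h1 := ((AltWord.pair (s := !s) hk (by rwa [Bool.not_not]) (by rwa [Bool.not_not])
      hy').dist hB).1.2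
    simp only [Bool.not_not, List.prod_cons, List.prod_nil, mul_one, List.length_cons,
      List.length_nil] at h1
    have h2 : x • v (!s) = (k * y) • v (!s) := by
      rw [h, mul_smul (k * y), (hB.stab _ k').2 hk']
    rw [← h2, ← (hB.stab s x).2 hx, hB.isom, hB.edge] at h1
    omega
  refine ⟨hks, ?_⟩
  rw [show k' = y⁻¹ * k⁻¹ * x by rw [h]; group]
  exact mul_mem (mul_mem (inv_mem hy) (inv_mem hks)) hx

theorem fix_geodesic {k : M} {x y z : V} (hx : k • x = x) (hy : k • y = y)
    (hz : d x z + d z y = d x y) : k • z = z := by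
  have e1 : d x (k • z) = d x z := by rw [← hx, hB.isom, hx]
  have e2 : d (k • z) y = d z y := by rw [← hy, hB.isom, hy]
  exact hB.tree.eq_of_geodesic (by rw [e1, e2]; exact hz) hz e1

/-- A vertex group is malnormal if the edge group is malnormal in the other vertex group. -/
theorem malnormal_vertex {t : Bool} (mal : ∀ x ∈ S t, x ∈ S (!t) → ∀ l ∈ S (!t), l ∉ S t →
    l⁻¹ * x * l ∈ S t → x = 1) {k g : M} (hk : k ∈ S t) (hg : g ∉ S t)
    (h : g⁻¹ * k * g ∈ S t) : k = 1 := by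
  have hkv : k • v t = v t := (hB.stab t k).2 hk
  have hky : k • g • v t = g • v t := by
    rw [← hB.stab, mul_smul, mul_smul, inv_smul_eq_iff] at h; exact h
  have hne : v t ≠ g • v t := fun e => hg ((hB.stab t g).1 e.symm)
  -- `k` fixes the geodesic from `v t` to `g • v t`, whose length is even and positive. Its next two
  -- vertices are `k₁ • v (!t)` and `k₁ • l • v t`. So `k₁⁻¹ * k * k₁` is in the edge group and its
  -- conjugate by `l` is in `S t`.
  obtain ⟨x₁, h1, h2⟩ := hB.tree.step _ _ hne
  obtain ⟨k₁, hk₁, rfl⟩ := hB.nbr t x₁ h1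
  have heven := hB.even g (v t)
  have hne' : k₁ • v (!t) ≠ g • v t := by
    intro e
    rw [e, hB.tree.self] at h2
    rw [← h2] at heven
    simp at heven
  obtain ⟨x₂, h3, h4⟩ := hB.tree.step _ _ hne'
  obtain ⟨l, hl, hx₂⟩ := hB.nbr (!t) (k₁⁻¹ • x₂) (by rw [← hB.isom k₁, smul_inv_smul]; exact h3)
  rw [Bool.not_not, inv_smul_eq_iff] at hx₂
  have hlt : l ∉ S t := by
    intro hlt
    rw [(hB.stab t l).2 hlt, (hB.stab t k₁).2 hk₁] at hx₂
    rw [hx₂] at h4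
    omega
  have f1 : k • k₁ • v (!t) = k₁ • v (!t) := hB.fix_geodesic hkv hky (by omega)
  have f2 : k • x₂ = x₂ := by
    refine hB.fix_geodesic hkv hky ?_
    have h5 := hB.tree.tri (v t) (k₁ • v (!t)) x₂
    have h6 := hB.tree.tri (v t) x₂ (g • v t)
    omega
  have key : ∀ x : V, k • k₁ • x = k₁ • x → (k₁⁻¹ * k * k₁) • x = x := by
    intro x hx; rw [mul_smul, mul_smul, hx, inv_smul_smul]
  have g1 : k₁⁻¹ * k * k₁ ∈ S t := mul_mem (mul_mem (inv_mem hk₁) hk) hk₁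
  have g2 : k₁⁻¹ * k * k₁ ∈ S (!t) := (hB.stab _ _).1 (key _ f1)
  have g3 := key (l • v t) (by rw [← hx₂]; exact f2)
  have g4 : l⁻¹ * (k₁⁻¹ * k * k₁) * l ∈ S t := by
    rw [← hB.stab, mul_smul, mul_smul, g3, inv_smul_smul]
  have := mal _ g1 g2 l hl hlt g4
  rw [mul_assoc, inv_mul_eq_one] at this
  exact mul_eq_right.1 this.symm

end BassSerre

theorem TreeMetric.dist_on_geodesic {d : V → V → ℕ} (hd : TreeMetric d) {x y z w : V}
    (hz : d x z + d z y = d x y) (hw : d x w + d w y = d x y) (h : d x z ≤ d x w) :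
    d x z + d z w = d x w := by
  have h1 := hd.four x y z w
  have h2 := hd.tri x z w
  have h3 := hd.symm y z
  have h4 := hd.symm y w
  omega

namespace RelatorData

variable {I : Type*} {h a b b' : I → M} (hD : RelatorData S h a b b') (hB : BassSerre S d v)
include hD hB

/-- Relators are long. -/
theorem eq_one_of_short {w : M} (hw : w ∈ Subgroup.normalClosure (relatorConj h a b b')) (x : V)
    (hx : d x (w • x) < 4825) : w = 1 := by
  by_contra hne
  have hR := hD.smallOverlap hB
  -- A nontrivial `w` displaces every vertex by at least 6640 - 3 * 605 = 4825.
  obtain ⟨r, hr, h1⟩ := greendlinger hR hw hne x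
  have h2 := hB.tree.gate_pair (hR.isGate hr x) (hR.isGate hr (w • x)) (by
    intro e
    rw [e, hB.tree.self] at h1
    omega)
  omega

/-- The bound 100 is ample: the elements compared later have displacement at most 6. -/
theorem eq_of_short {x y : M} (hxy : x⁻¹ * y ∈ Subgroup.normalClosure (relatorConj h a b b'))
    (t : Bool) (hx : d (v t) (x • v t) ≤ 100) (hy : d (v t) (y • v t) ≤ 100) : x = y := by
  have h1 := hD.eq_one_of_short hB hxy (v t) (by
    have h1 := hB.displacement_mul t x⁻¹ y
    rw [hB.displacement_inv] at h1
    omega)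
  exact inv_mul_eq_one.1 h1

/-- Some power of the relator moves a point of the axis towards a given one. -/
theorem exists_shift {r : M} (hr : r ∈ relatorConj h a b b') {x y : V} (hx : x ∈ Axis d 6640 r)
    (hy : y ∈ Axis d 6640 r) :
    ∃ ε : ℤ, (d (r ^ ε • x) y : ℤ) = |6640 - (d x y : ℤ)| := by
  obtain ⟨p, h0, hp, hax⟩ := hD.exists_lines hB
  obtain ⟨i, c, rfl⟩ := hr
  rw [hax] at hx hy
  obtain ⟨_, ⟨s, rfl⟩, rfl⟩ := hx
  obtain ⟨_, ⟨t, rfl⟩, rfl⟩ := hy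
  have hdist := hB.dist_lineOf (hD.wordLine (hp i))
  have key : ∀ ε : ℤ, (d ((c * relatorIn h a b b' i * c⁻¹) ^ ε • c • lineOf v (p i) s)
      (c • lineOf v (p i) t) : ℤ) = |s + 6640 * ε - t| := by
    intro ε
    rw [conj_zpow, mul_smul, mul_smul, inv_smul_smul, hB.isom,
      relator_zpow_smul_lineOf (h0 i) (hp i), hdist]
  dsimp only
  rw [hB.isom, hdist]
  rcases le_total s t with hst | hst
  · refine ⟨1, ?_⟩
    rw [key, abs_of_nonpos (show s - t ≤ 0 by omega)]
    congr 1; ring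
  · refine ⟨-1, ?_⟩
    rw [key, abs_of_nonneg (show 0 ≤ s - t by omega), abs_sub_comm]
    congr 1; ring

/-- If the gates were more than half a period apart, `r` or its inverse would bring `g • v t` closer
to `v t`. -/
theorem gate_le_of_minimal {g : M} {t : Bool}
    (hmin : ∀ n ∈ Subgroup.normalClosure (relatorConj h a b b'),
      d (v t) (g • v t) ≤ d (v t) (n • g • v t)) {r : M} (hr : r ∈ relatorConj h a b b')
    {p c : V} (hp : IsGate d (Axis d 6640 r) (g • v t) p) (hc : IsGate d (Axis d 6640 r) (v t) c) :
    d c p ≤ 3320 := by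
  by_contra hlt
  have hpc : c ≠ p := by
    rintro rfl; rw [hB.tree.self] at hlt; omega
  have h1 := hB.tree.gate_pair hc hp hpc
  obtain ⟨ε, hε⟩ := hD.exists_shift hB hr hp.1 hc.1
  have h2 := hmin (r ^ ε) (zpow_mem (Subgroup.subset_normalClosure hr) ε)
  have h3 := hB.tree.tri (v t) c (r ^ ε • g • v t)
  have h4 := hB.tree.tri c (r ^ ε • p) (r ^ ε • g • v t)
  rw [hB.isom] at h4
  have h5 := hB.tree.symm c (r ^ ε • p)
  have h6 := hB.tree.symm c p
  rcases abs_cases (6640 - (d p c : ℤ)) with ⟨h7, -⟩ | ⟨h7, -⟩ <;> omega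

/-- Vertex groups are malnormal in the quotient. -/
theorem malnormal_quotient {t : Bool} (mal : ∀ x ∈ S t, x ∈ S (!t) → ∀ l ∈ S (!t), l ∉ S t →
    l⁻¹ * x * l ∈ S t → x = 1) {k k' g : M} (hk : k ∈ S t) (hk1 : k ≠ 1) (hk' : k' ∈ S t)
    (hN : g⁻¹ * k * g * k'⁻¹ ∈ Subgroup.normalClosure (relatorConj h a b b')) :
    ∃ s ∈ S t, s⁻¹ * g ∈ Subgroup.normalClosure (relatorConj h a b b') := by
  set N := Subgroup.normalClosure (relatorConj h a b b') with hNdef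
  have hR := hD.smallOverlap hB
  obtain ⟨n, hn, hmin⟩ : ∃ n ∈ N, ∀ n' ∈ N, d (v t) (n • g • v t) ≤ d (v t) (n' • g • v t) := by
    obtain ⟨n, hn, hm⟩ := WellFounded.has_min
      (measure fun n : M => d (v t) (n • g • v t)).wf (N : Set M) ⟨1, N.one_mem⟩
    exact ⟨n, hn, fun n' hn' => not_lt.1 (hm n' hn')⟩
  set g' := n * g with hg'
  have hmin' : ∀ n ∈ N, d (v t) (g' • v t) ≤ d (v t) (n • g' • v t) := by
    intro n' hn'
    have := hmin (n' * n) (N.mul_mem hn' hn)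
    rwa [mul_smul, ← mul_smul n g] at this
  have hkv : k • v t = v t := (hB.stab t k).2 hk
  have hw : k * g' * k'⁻¹ * g'⁻¹ ∈ N := by
    have e : k * g' * k'⁻¹ * g'⁻¹ =
        (k * n * k⁻¹) * (g * (g⁻¹ * k * g * k'⁻¹) * g⁻¹) * n⁻¹ := by rw [hg']; group
    rw [e]
    exact N.mul_mem (N.mul_mem (Subgroup.normalClosure_normal.conj_mem n hn k)
      (Subgroup.normalClosure_normal.conj_mem _ hN g)) (N.inv_mem hn)
  have hgoal : g' ∈ S t → ∃ s ∈ S t, s⁻¹ * g ∈ N := by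
    intro hg
    refine ⟨g', hg, ?_⟩
    rw [show g'⁻¹ * g = g⁻¹ * n⁻¹ * g by rw [hg']; group]
    simpa using Subgroup.normalClosure_normal.conj_mem n⁻¹ (N.inv_mem hn) g⁻¹
  by_cases hw1 : k * g' * k'⁻¹ * g'⁻¹ = 1
  · apply hgoal
    by_contra hg
    refine hk1 (hB.malnormal_vertex mal hk hg ?_)
    rw [show g'⁻¹ * k * g' = g'⁻¹ * (k * g' * k'⁻¹ * g'⁻¹) * g' * k' by group, hw1]
    simpa using hk'
  exfalso
  -- The gates `p` and `q` of `g' • v t` and `k • g' • v t` are at least 4825 apart. By minimality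
  -- each is at most 3320 from the gate `c` of `v t`, so each is at least 1505 from `c`.
  obtain ⟨r, hr, hlong⟩ := greendlinger hR hw hw1 (g' • v t)
  have hky : (k * g' * k'⁻¹ * g'⁻¹) • g' • v t = k • g' • v t := by
    rw [mul_smul _ g'⁻¹, inv_smul_smul, mul_smul _ k'⁻¹, (hB.stab t _).2 (inv_mem hk'), mul_smul]
  rw [hky] at hlong
  have hp := hR.isGate hr (g' • v t)
  have hq := hR.isGate hr (k • g' • v t)
  have hc := hR.isGate hr (v t)
  set p := gate d (Axis d 6640 r) (g' • v t)
  set q := gate d (Axis d 6640 r) (k • g' • v t)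
  set c := gate d (Axis d 6640 r) (v t)
  have m1 := hD.gate_le_of_minimal hB hmin' hr hp hc
  have m2 : d c q ≤ 3320 := by
    have h1 := hR.isGate_smul k⁻¹ hq
    have h2 := hR.isGate_smul k⁻¹ hc
    rw [inv_smul_smul] at h1
    rw [(hB.stab t _).2 (inv_mem hk)] at h2
    have := hD.gate_le_of_minimal hB hmin' (hR.conj r hr k⁻¹) h1 h2
    rwa [hB.isom] at this
  have htri := hB.tree.tri p c q
  have hpc := hB.tree.symm p c
  have ecp : c ≠ p := by
    intro e
    have h0 : d c p = 0 := by rw [← e]; exact hB.tree.self c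
    omega
  have ecq : c ≠ q := by
    intro e
    have h0 : d c q = 0 := by rw [← e]; exact hB.tree.self c
    omega
  have e1 := hB.tree.gate_pair hc hp ecp
  have e2 := hB.tree.gate_pair hc hq ecq
  have e3 := hc.2 p hp.1
  have e4 := hc.2 q hq.1
  -- transport of the first half of the geodesic by `k`
  have t1 : ∀ x, d (v t) (k • x) = d (v t) x := fun x => by rw [← hkv, hB.isom, hkv]
  have t2 := hB.isom k
  have f1 : d (v t) (k • c) = d (v t) c := t1 c
  have f2 : d (v t) (k • p) = d (v t) p := t1 p
  have f3 : d (v t) (k • g' • v t) = d (v t) (g' • v t) := t1 _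
  have f4 := t2 c (g' • v t)
  have f5 := t2 p (g' • v t)
  have f6 := t2 c p
  have f7 := hB.tree.tri c p (g' • v t)
  have f8 := hB.tree.tri (v t) c (g' • v t)
  have f9 := hB.tree.tri c q (k • g' • v t)
  have f10 := hB.tree.tri (v t) c (k • g' • v t)
  -- Both geodesics from `v t` pass through `c`, and `k` carries one to the other, preserving the
  -- distance from `v t`.
  have kc : k • c = c := hB.tree.eq_of_geodesic (x := v t) (y := k • g' • v t) (by omega)
    (by omega) f1
  rw [kc] at f6
  have hcr : c ∈ Axis d 6640 (k * r * k⁻¹) := by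
    have := hR.smul_mem_axis k hc.1
    rwa [kc] at this
  have hpr := hR.smul_mem_axis k hp.1
  -- The axes of `r` and `k * r * k⁻¹` share a segment of length at least 1505 starting at `c`. A
  -- nontrivial power of `r` cannot fix `c`, which is the contradiction.
  have hkr : k ∈ Subgroup.zpowers r := by
    rcases le_total (d c p) (d c q) with hle | hle
    · have h5 := hB.tree.dist_on_geodesic (x := v t) (y := k • g' • v t) (z := k • p) (w := q)
        (by omega) (by omega) (by omega)
      have hz := hR.convex r hr c hc.1 q hq.1 (k • p) (by omega)
      exact hD.mem_zpowers_of_axis_overlap hB hr hc.1 hz hcr hpr (by omega)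
    · have h5 := hB.tree.dist_on_geodesic (x := v t) (y := k • g' • v t) (z := q) (w := k • p)
        (by omega) (by omega) (by omega)
      have hz := hR.convex _ (hR.conj r hr k) c hcr _ hpr q (by omega)
      exact hD.mem_zpowers_of_axis_overlap hB hr hc.1 hq.1 hcr hz (by omega)
  obtain ⟨m, rfl⟩ := Subgroup.mem_zpowers_iff.1 hkr
  have hm : m ≠ 0 := by rintro rfl; simp at hk1
  have := hR.trans r hr c hc.1 m hm
  rw [kc, hB.tree.self] at this
  omega

end RelatorData
end Quotient
-- Axes of isometries and torsion in the quotient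
section Lines

variable {M V : Type*} [Group M] [MulAction M V] {d : V → V → ℕ}

theorem TreeMetric.exists_geodesic (hd : TreeMetric d) (x y : V) :
    ∃ γ : ℕ → V, γ 0 = x ∧ γ (d x y) = y ∧
      ∀ i j, i ≤ j → j ≤ d x y → d (γ i) (γ j) + i = j := by
  obtain ⟨n, hn⟩ : ∃ n, d x y = n := ⟨_, rfl⟩
  induction n generalizing x with
  | zero =>
    refine ⟨fun _ => x, rfl, hd.eq_of_zero _ _ hn, fun i j h1 h2 => ?_⟩
    rw [hd.self]; omega
  | succ n ih =>
    obtain ⟨z, h1, h2⟩ := hd.step x y (by rintro rfl; rw [hd.self] at hn; omega)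
    obtain ⟨γ, g0, g1, g2⟩ := ih z (by omega)
    have e : d z y = n := by omega
    rw [e] at g1 g2
    refine ⟨fun k => Nat.casesOn k x γ, rfl, by rw [hn]; exact g1, ?_⟩
    rintro (_ | i) (_ | j) h3 h4
    · exact (hd.self x).symm ▸ rfl
    · change d x (γ j) + 0 = j + 1
      have h5 := g2 0 j (by omega) (by omega)
      have h6 := g2 j n (by omega) le_rfl
      have h7 := hd.tri x z (γ j)
      have h8 := hd.tri x (γ j) y
      rw [g0] at h5
      rw [g1] at h6
      omega
    · omega
    · change d (γ i) (γ j) + (i + 1) = j + 1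
      have := g2 i j (by omega) (by omega)
      omega

/-- An isometry whose displacement has a minimum greater than `1` has an axis. -/
theorem TreeMetric.exists_axis (hd : TreeMetric d)
    (isom : ∀ (g : M) x y, d (g • x) (g • y) = d x y) {f : M} {x : V} (hx : 2 ≤ d x (f • x))
    (hmin : ∀ y, d x (f • x) ≤ d y (f • y)) :
    ∃ β : ℤ → V, (∀ s t, (d (β s) (β t) : ℤ) = |s - t|) ∧
      ∀ t, f • β t = β (t + d x (f • x)) := by
  obtain ⟨γ, g0, g1, g2⟩ := hd.exists_geodesic x (f • x)
  set D := d x (f • x) with hD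
  set β : ℤ → V := fun t => f ^ (t / D) • γ (t % D).toNat with hβ
  have hD0 : (D : ℤ) ≠ 0 := by omega
  have key : ∀ (q : ℤ) (i : ℕ), i ≤ D → β (q * D + i) = f ^ q • γ i := by
    intro q i hi
    rcases hi.lt_or_eq with hi | rfl
    · have h1 : (q * D + i) / (D : ℤ) = q := by
        rw [add_comm, Int.add_mul_ediv_right _ _ hD0, Int.ediv_eq_zero_of_lt (by omega) (by omega),
          zero_add]
      have h2 : (q * D + i) % (D : ℤ) = i := by
        rw [add_comm, Int.add_mul_emod_self_right, Int.emod_eq_of_lt (by omega) (by omega)]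
      rw [hβ]
      dsimp only
      rw [h1, h2, Int.toNat_natCast]
    · have h1 : (q * D + D) / (D : ℤ) = q + 1 := by
        rw [show q * D + D = (q + 1) * (D : ℤ) by ring, Int.mul_ediv_cancel _ hD0]
      have h2 : (q * D + D) % (D : ℤ) = 0 := by
        rw [show q * D + D = (q + 1) * (D : ℤ) by ring, Int.mul_emod_left]
      rw [hβ]
      dsimp only
      rw [h1, h2, Int.toNat_zero, g0, g1, zpow_add_one, mul_smul]
  have rep : ∀ t : ℤ, ∃ (q : ℤ) (i : ℕ), i < D ∧ t = q * D + i := by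
    intro t
    have h1 := Int.emod_lt_of_pos t (show (0 : ℤ) < D by omega)
    have h2 := Int.emod_nonneg t hD0
    refine ⟨t / D, (t % D).toNat, by omega, ?_⟩
    rw [Int.toNat_of_nonneg h2, mul_comm, Int.mul_ediv_add_emod]
  refine ⟨β, hd.dist_line ?_ ?_, ?_⟩
  · intro t
    obtain ⟨q, i, hi, rfl⟩ := rep t
    have h1 := key q (i + 1) hi
    push_cast at h1
    rw [add_assoc, h1, key q i hi.le, isom]
    have := g2 i (i + 1) (by omega) hi
    omega
  · intro t
    obtain ⟨q, i, hi, rfl⟩ := rep t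
    rw [key q i hi.le]
    intro h
    rcases Nat.lt_or_ge (i + 1) D with h1 | h1
    · have h2 := key q (i + 2) h1
      push_cast at h2
      rw [add_assoc, h2] at h
      have h3 := g2 i (i + 2) (by omega) h1
      rw [smul_left_cancel _ h, hd.self] at h3
      omega
    -- At a junction, backtracking would mean `f • γ 1 = γ (D - 1)`, so `γ 1` would be displaced by
    -- only `D - 2`.
    · have h2 := key (q + 1) 1 (by omega)
      rw [show q * D + i + 2 = (q + 1) * D + (1 : ℕ) by
        have : (D : ℤ) = i + 1 := by omega
        rw [add_mul, this]; push_cast; ring, h2, zpow_add_one, mul_smul] at h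
      have h3 := smul_left_cancel _ h
      have h4 := g2 1 i (by omega) (by omega)
      have h5 := hmin (γ 1)
      rw [← h3] at h5
      omega
  · intro t
    obtain ⟨q, i, hi, rfl⟩ := rep t
    rw [show q * D + i + D = (q + 1) * D + (i : ℤ) by ring, key _ _ hi.le, key _ _ hi.le,
      add_comm q 1, zpow_one_add, mul_smul]

end Lines

section Quotient

variable {M V : Type*} [Group M] [MulAction M V] {d : V → V → ℕ} {v : Bool → V}
  {S : Bool → Subgroup M}

namespace BassSerre

variable (hB : BassSerre S d v)
include hB

theorem displacement_sandwich {t : Bool} {x y : M} (hx : x ∈ S t) (hy : y ∈ S t) (g : M) :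
    d (v t) ((x * g * y) • v t) = d (v t) (g • v t) := by
  rw [mul_smul, (hB.stab t y).2 hy, mul_smul]
  conv_lhs => rw [← (hB.stab t x).2 hx]
  rw [hB.isom, (hB.stab t x).2 hx]

end BassSerre

namespace RelatorData

variable {I : Type*} {h a b b' : I → M} (hD : RelatorData S h a b b') (hB : BassSerre S d v)
include hD hB

/-- The quotient is torsion-free if the vertex groups are. -/
theorem mem_of_pow_mem (htf : ∀ t, ∀ s ∈ S t, s ≠ 1 → ¬ IsOfFinOrder s) {g : M} {n : ℕ}
    (hn : 0 < n) (hg : g ^ n ∈ Subgroup.normalClosure (relatorConj h a b b')) :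
    g ∈ Subgroup.normalClosure (relatorConj h a b b') := by
  set N := Subgroup.normalClosure (relatorConj h a b b') with hNdef
  have hR := hD.smallOverlap hB
  have hNn : N.Normal := Subgroup.normalClosure_normal
  by_contra hgN
  -- Minimise the displacement over all representatives of `g` modulo `N` and all vertices.
  obtain ⟨⟨f, x⟩, hf, hmin⟩ := WellFounded.has_min
    (measure fun q : M × V => d q.2 (q.1 • q.2)).wf {q | g⁻¹ * q.1 ∈ N}
    ⟨(g, v true), by change g⁻¹ * g ∈ N; rw [inv_mul_cancel]; exact N.one_mem⟩
  change g⁻¹ * f ∈ N at hf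
  have hmin' : ∀ f' y, g⁻¹ * f' ∈ N → d x (f • x) ≤ d y (f' • y) :=
    fun f' y h' => not_lt.1 (hmin (f', y) h')
  have hfN : f ∉ N := fun h' => hgN (by
    have := N.mul_mem h' (N.inv_mem hf)
    simpa using this)
  have hfn : f ^ n ∈ N := by
    rw [← QuotientGroup.eq_one_iff] at hg ⊢
    rw [← QuotientGroup.eq] at hf
    rw [QuotientGroup.mk_pow, ← hf, ← QuotientGroup.mk_pow, hg]
  -- If `f` fixes a vertex, it is in a conjugate of a vertex group, where its `n`-th power is short
  -- and hence trivial.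
  rcases Nat.eq_zero_or_pos (d x (f • x)) with h0 | hpos
  · obtain ⟨c, t, rfl⟩ := hB.cover x
    have h1 := hB.tree.eq_of_zero _ _ h0
    have h2 : c⁻¹ * f * c ∈ S t := by
      rw [← hB.stab, mul_smul, mul_smul, ← h1, inv_smul_smul]
    have h3 : (c⁻¹ * f * c) ^ n = c⁻¹ * f ^ n * c := by
      simpa using conj_pow (a := c⁻¹) (b := f) (i := n)
    have h4 := hB.displacement_le (pow_mem h2 n) t
    have h5 := hD.eq_one_of_short hB (w := (c⁻¹ * f * c) ^ n) (by
      rw [h3]; simpa using hNn.conj_mem _ hfn c⁻¹) (v t) (by omega)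
    have h6 : c⁻¹ * f * c = 1 := by
      by_contra hne
      exact htf t _ h2 hne (isOfFinOrder_iff_pow_eq_one.2 ⟨n, hn, h5⟩)
    apply hfN
    have : f = 1 := by
      rw [mul_assoc, inv_mul_eq_one] at h6
      exact mul_eq_right.1 h6.symm
    rw [this]; exact N.one_mem
  have heven := hB.even f x
  have hD2 : 2 ≤ d x (f • x) := by
    rcases heven with ⟨k, hk⟩; omega
  obtain ⟨β, hβ, hfβ⟩ := hB.tree.exists_axis hB.isom hD2 (fun y => hmin' f y hf)
  set D := d x (f • x) with hDdef
  have hpow : ∀ k : ℕ, f ^ k • β 0 = β (k * D) := by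
    intro k
    induction k with
    | zero => simp
    | succ k ih =>
      rw [pow_succ', mul_smul, ih, hfβ]
      congr 1; push_cast; ring
  have hlen : (d (β 0) (β (n * D)) : ℤ) = n * D := by
    rw [hβ, zero_sub, abs_neg, abs_of_nonneg (by positivity)]
  have hnD : 0 < n * D := Nat.mul_pos hn hpos
  have hfn1 : f ^ n ≠ 1 := by
    intro e
    have h1 := hpow n
    rw [e, one_smul] at h1
    rw [← h1, hB.tree.self] at hlen
    norm_cast at hlen
    omega
  obtain ⟨r, hr, hlong⟩ := greendlinger hR hfn hfn1 (β 0)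
  rw [hpow] at hlong
  have hp := hR.isGate hr (β 0)
  have hq := hR.isGate hr (β (n * D))
  set p := gate d (Axis d 6640 r) (β 0)
  set q := gate d (Axis d 6640 r) (β (n * D))
  have hpq := hB.tree.gate_pair hp hq (by
    intro e
    have h0 : d p q = 0 := by rw [← e]; exact hB.tree.self p
    omega)
  have h1 := hp.2 q hq.1
  have h2 := hq.2 p hp.1
  have hs : ∀ z, d (β 0) z + d z (β (n * D)) = d (β 0) (β (n * D)) → z = β (d (β 0) z) := by
    intro z hz
    have e1 := hβ 0 (d (β 0) z)
    have e2 := hβ (d (β 0) z) (n * D)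
    rw [zero_sub, abs_neg, abs_of_nonneg (by positivity)] at e1
    rw [abs_of_nonpos (by omega)] at e2
    exact hB.tree.eq_of_geodesic hz (by omega) (by omega)
  have h3 := hB.tree.symm q p
  have h4 := hB.tree.symm q (β (n * D))
  have h5 := hB.tree.symm p (β (n * D))
  have hps := hs p (by omega)
  have hqs := hs q (by omega)
  have hax : ∀ t : ℤ, d (β 0) p ≤ t → t ≤ d (β 0) q → β t ∈ Axis d 6640 r := by
    intro t ht1 ht2
    refine hR.convex r hr p hp.1 q hq.1 _ ?_
    have e1 := hβ (d (β 0) p) t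
    have e2 := hβ t (d (β 0) q)
    rw [← hps, abs_of_nonpos (by omega)] at e1
    rw [← hqs, abs_of_nonpos (by omega)] at e2
    omega
  set s₀ := d (β 0) p
  -- The axes of `r` and `f` share a segment of length at least 4825. If `D` exceeds half a period,
  -- `r ^ ε * f` displaces a vertex by less than `D`. Otherwise the axes of `r` and `f * r * f⁻¹`
  -- share at least 4825 - 3320 = 1505, so `f` is a power of `r`.
  rcases Nat.lt_or_ge 3320 D with hDl | hDl
  · have hy := hax s₀ le_rfl (by omega)
    have hz := hax (s₀ + min D 4825) (by omega) (by omega)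
    obtain ⟨ε, hε⟩ := hD.exists_shift hB hr hz hy
    have e1 := hβ (s₀ + min D 4825) s₀
    have e2 := hβ (s₀ + min D 4825) (s₀ + D)
    rw [abs_of_nonneg (by omega)] at e1
    rw [abs_of_nonpos (by omega)] at e2
    have hm := hmin' (r ^ ε * f) (β s₀) (by
      rw [show g⁻¹ * (r ^ ε * f) = (g⁻¹ * r ^ ε * g⁻¹⁻¹) * (g⁻¹ * f) by group]
      exact N.mul_mem (hNn.conj_mem _ (zpow_mem (Subgroup.subset_normalClosure hr) ε) _) hf)
    rw [mul_smul, hfβ] at hm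
    have h5 := hB.tree.tri (β s₀) (r ^ ε • β (s₀ + min D 4825)) (r ^ ε • β (s₀ + D))
    rw [hB.isom] at h5
    have h6 := hB.tree.symm (β s₀) (r ^ ε • β (s₀ + min D 4825))
    rw [abs_of_nonneg (by omega)] at hε
    omega
  · have hx1 := hax (s₀ + D) (by omega) (by omega)
    have hx2 := hax (s₀ + 4825) (by omega) (by omega)
    have hy1 := hR.smul_mem_axis f (hax s₀ le_rfl (by omega))
    have hy2 := hR.smul_mem_axis f (hax (s₀ + 4825 - D) (by omega) (by omega))
    rw [hfβ] at hy1 hy2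
    rw [sub_add_cancel] at hy2
    have e1 := hβ (s₀ + D) (s₀ + 4825)
    rw [abs_of_nonpos (by omega)] at e1
    have := hD.mem_zpowers_of_axis_overlap hB hr hx1 hx2 hy1 hy2 (by omega)
    obtain ⟨k, rfl⟩ := Subgroup.mem_zpowers_iff.1 this
    exact hfN (zpow_mem (Subgroup.subset_normalClosure hr) k)

end RelatorData
end Quotient
-- The symmetric closure and small cancellation
section Symmetrized

variable {M V : Type*} [Group M] [MulAction M V] {d : V → V → ℕ} {v : Bool → V}
  {S : Bool → Subgroup M}

/-- The canonical forms with respect to the edge group and the two vertex groups. -/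
theorem IsCanonical.altWord {w : List M}
    (hw : IsCanonical (S true ⊓ S false) (S true) (S false) w) :
    (∃ s, w.prod ∈ S s) ∨ 1 < w.length ∧ ∃ s t, AltWord S s t w := by
  obtain ⟨h1, h2 | ⟨h2, h3, h4⟩⟩ := hw
  · obtain ⟨x, rfl⟩ := List.length_eq_one_iff.1 h2
    left
    rcases h1 x (by simp) with h | h
    · exact ⟨true, by simpa using h⟩
    · exact ⟨false, by simpa using h⟩
  · exact Or.inr ⟨h2, exists_altWord (by rintro rfl; simp at h2) h1 h3 h4⟩

/-- The conjugates of the relators and of their inverses which have one of the base vertices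
on their axis. -/
def relatorSymm (d : V → V → ℕ) (v : Bool → V) {I : Type*} (h a b b' : I → M) : Set M :=
  {u | (u ∈ relatorConj h a b b' ∨ u⁻¹ ∈ relatorConj h a b b') ∧ ∃ t, v t ∈ Axis d 6640 u}

namespace BassSerre

variable (hB : BassSerre S d v)
include hB

theorem axis_inv (τ : ℕ) (r : M) : Axis d τ r⁻¹ = Axis d τ r := by
  ext x
  change d x (r⁻¹ • x) = τ ↔ d x (r • x) = τ
  rw [← hB.isom r, smul_inv_smul, hB.tree.symm]

end BassSerre

namespace RelatorData

variable {I : Type*} {h a b b' : I → M} (hD : RelatorData S h a b b') (hB : BassSerre S d v)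
include hD hB

theorem dist_sq {r : M} (hr : r ∈ relatorConj h a b b') {x : V} (hx : x ∈ Axis d 6640 r) :
    d x (r • r • x) = 13280 := by
  obtain ⟨p, h0, hp, hax⟩ := hD.exists_lines hB
  obtain ⟨i, c, rfl⟩ := hr
  rw [hax] at hx
  obtain ⟨_, ⟨t, rfl⟩, rfl⟩ := hx
  have h1 := hB.dist_lineOf (hD.wordLine (hp i)) t (t + 6640 * 2)
  rw [← mul_smul, ← pow_two]
  dsimp only
  rw [conj_pow, mul_smul, mul_smul, inv_smul_smul, hB.isom]
  have h2 := relator_zpow_smul_lineOf (v := v) (h0 i) (hp i) t 2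
  rw [zpow_ofNat] at h2
  rw [h2]
  rw [abs_of_nonpos (by omega)] at h1
  omega

/-- `e` is the distance from `x` to the axis: squaring `u` doubles the translation length but not
the detour. -/
theorem le_displacement {u : M} (hu : u ∈ relatorConj h a b b' ∨ u⁻¹ ∈ relatorConj h a b b')
    (x : V) : ∃ e, d x (u • x) = 6640 + 2 * e ∧ d x (u • u • x) ≤ 13280 + 2 * e := by
  have hR := hD.smallOverlap hB
  wlog hu' : u ∈ relatorConj h a b b' generalizing u
  · obtain ⟨e, h1, h2⟩ := this (u := u⁻¹) (Or.inl (hu.resolve_left hu')) (hu.resolve_left hu')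
    refine ⟨e, ?_, ?_⟩
    · rwa [← hB.isom u, smul_inv_smul, hB.tree.symm] at h1
    · rwa [← hB.isom u, smul_inv_smul, ← hB.isom u, smul_inv_smul, hB.tree.symm] at h2
  have hc := hR.isGate hu' x
  set c := gate d (Axis d 6640 u) x
  have hca : d c (u • c) = 6640 := hc.1
  have h1 := hR.isGate_smul u hc
  rw [show u * u * u⁻¹ = u by group] at h1
  have h2 := hB.tree.gate_pair hc h1 (by
    intro e
    rw [← e, hB.tree.self] at hca
    omega)
  have h3 := hB.isom u c x
  have h4 := hB.tree.symm c x
  have h5 := hB.isom u (u • c) (u • x)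
  have h6 := hB.isom u c (u • c)
  have h7 := hB.tree.tri x c (u • u • x)
  have h8 := hB.tree.tri c (u • c) (u • u • x)
  have h9 := hB.tree.tri (u • c) (u • u • c) (u • u • x)
  exact ⟨d x c, by omega, by omega⟩

theorem not_mem_of_mem_relatorSymm {u : M} (hu : u ∈ relatorSymm d v h a b b') (s : Bool) :
    u ∉ S s := by
  intro hs
  obtain ⟨e, h1, -⟩ := hD.le_displacement hB hu.1 (v s)
  have := hB.displacement_le hs s
  omega

/-- Weak cyclic reducedness makes the square displace a base vertex at least twice as far. With
`le_displacement` this reads `2 * (6640 + 2 * e) ≤ 13280 + 2 * e`, so `e = 0`. -/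
theorem mem_relatorSymm_of_reduced {u : M}
    (hu : u ∈ relatorConj h a b b' ∨ u⁻¹ ∈ relatorConj h a b b')
    (hw : WeaklyCyclicallyReduced (S true ⊓ S false) (S true) (S false) u) :
    u ∈ relatorSymm d v h a b b' := by
  obtain ⟨-, w, hne, hcan, rfl, hcyc⟩ := hw
  rcases hcan.altWord with ⟨s, hs⟩ | ⟨hlen, s, t, hst⟩
  · obtain ⟨e, h1, -⟩ := hD.le_displacement hB hu (v s)
    have := hB.displacement_le hs s
    omega
  refine ⟨hu, s, ?_⟩
  obtain ⟨e, h1, h2⟩ := hD.le_displacement hB hu (v s)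
  suffices h3 : 2 * d (v s) (w.prod • v s) ≤ d (v s) (w.prod • w.prod • v s) by
    change d _ _ = _
    omega
  rw [← mul_smul]
  by_cases heven : Even w.length
  · obtain rfl := hst.even_length.1 heven
    have h3 := (hst.dist hB).1.1
    have h4 := ((hst.append (by rwa [Bool.not_not])).dist hB).1.1
    rw [Bool.not_not] at h3 h4
    rw [List.prod_append, List.length_append] at h4
    omega
  · have hts : t = s := by
      have := mt hst.even_length.2 heven
      cases s <;> cases t <;> simp_all
    subst hts
    obtain ⟨w₁, z, rfl⟩ := List.eq_nil_or_concat' w |>.resolve_left hne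
    have hw₁ : w₁ ≠ [] := by rintro rfl; simp at hlen
    obtain ⟨g, w', rfl⟩ := List.exists_cons_of_ne_nil hw₁
    have h3 := (hst.dist hB).2.1
    obtain ⟨r, hr, hz⟩ := hst.split (by simp) (by simp)
    have hw' : w' ≠ [] := by
      rintro rfl
      exact heven (by simp)
    obtain ⟨hg, hgw⟩ : (g ∈ S t ∧ g ∉ S (!t)) ∧ AltWord S (!t) t (w' ++ [z]) := by
      have hq : w' ++ [z] ≠ [] := by simp
      rw [List.cons_append] at hst
      clear hcyc hne hcan hu h1 h2 heven hlen h3 hr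
      generalize w' ++ [z] = q at hst hq ⊢
      cases hst with
      | single => exact absurd rfl hq
      | cons a1 a2 a3 => exact ⟨⟨a1, a2⟩, a3⟩
    obtain ⟨hzt, rfl⟩ : z ∈ S t ∧ r = !t := by
      generalize hq : (!r) = q at hz
      cases hz with
      | single a1 a2 => exact ⟨a1, by rw [← hq, Bool.not_not]⟩
      | cons a1 a2 a3 => exact absurd rfl a3.ne_nil
    have hzg : z * g ∉ S (!t) := by
      have hlen' : (g :: w' ++ [z]).length ≠ 1 := by omega
      have h5 := (hcyc.resolve_left hlen').resolve_left heven
      simp only [List.cons_append, List.head_cons] at h5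
      rw [List.getLast_cons (by simp), List.getLast_append_singleton] at h5
      intro h6
      apply h5
      rw [Subgroup.mem_inf]
      cases t
      · exact ⟨h6, mul_mem hzt hg.1⟩
      · exact ⟨mul_mem hzt hg.1, h6⟩
    -- In odd length the last and the first letter merge to `z * g`, outside `H`. The square loses
    -- one letter, but the displacement of `v t` is one less than the length, so it still doubles.
    have h4 := ((hr.append (w' := (z * g) :: (w' ++ [z])) (by
      rw [Bool.not_not]
      exact AltWord.cons (mul_mem hzt hg.1) hzg hgw)).dist hB).2.1
    have e : (g :: w' ++ [z]).prod * (g :: w' ++ [z]).prod =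
        (g :: w' ++ (z * g) :: (w' ++ [z])).prod := by
      simp [mul_assoc]
    rw [e]
    simp only [List.length_append, List.length_cons, List.length_nil] at h3 h4 ⊢
    omega

theorem symmetrized_relatorSymm :
    Symmetrized (S true ⊓ S false) (S true) (S false) (relatorSymm d v h a b b') := by
  have hR := hD.smallOverlap hB
  rintro u ⟨hu, t, ht⟩
  refine ⟨⟨?_, t, by rwa [hB.axis_inv]⟩, fun u' hc hw => hD.mem_relatorSymm_of_reduced hB ?_ hw⟩
  · rw [inv_inv]; exact hu.symm
  · obtain ⟨c, rfl⟩ := isConj_iff.1 hc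
    rcases hu with hu | hu
    · exact Or.inl (hR.conj _ hu c)
    · right
      rw [show (c * u * c⁻¹)⁻¹ = c * u⁻¹ * c⁻¹ by group]
      exact hR.conj _ hu c

theorem relatorIn_mem_relatorSymm (i : I) :
    relatorIn h a b b' i ∈ relatorSymm d v h a b b' := by
  obtain ⟨p, h0, hp, hax⟩ := hD.exists_lines hB
  refine ⟨Or.inl ⟨i, 1, by group⟩, true, ?_⟩
  have h1 := hax i 1
  simp only [one_mul, inv_one, mul_one, one_smul, Set.image_id'] at h1
  rw [h1]
  refine ⟨0, ?_⟩
  have := lineOf_even (v := v) (p i) 0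
  rw [mul_zero] at this
  rw [this, h0, one_smul]

/-- The canonical forms of symmetrized relators run along the axis. -/
theorem prefix_mem_axis {w w' : List M} {s t r : Bool} (hw : AltWord S s r w)
    (hw' : AltWord S (!r) t w') (hu : (w ++ w').prod ∈ relatorSymm d v h a b b') :
    6640 ≤ (w ++ w').length ∧ v s ∈ Axis d 6640 (w ++ w').prod ∧
      w.prod • v r ∈ Axis d 6640 (w ++ w').prod ∧
      d (w.prod • v r) ((w ++ w').prod • v s) + w.length = 6641 := by
  have hst := hw.append hw'
  have hR := hD.smallOverlap hB
  have hle := fun x => hD.le_displacement hB hu.1 x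
  obtain ⟨e, he, -⟩ := hle (v s)
  have h1 := hst.dist hB
  have h2 := (hw.dist hB).2.1
  have h3 := hw'.dist hB
  rw [Bool.not_not] at h3
  obtain ⟨t', ht'⟩ := hu.2
  change d _ _ = _ at ht'
  -- The base vertex on the axis can be taken to be `v s`, since `v (!s)` is displaced at least as
  -- far. The constant 6641 arises because `w.prod • v r` is at distance `w.length - 1` from `v s`.
  have hax : v s ∈ Axis d 6640 (w ++ w').prod ∧ 6640 ≤ (w ++ w').length ∧
      d (w.prod • v r) ((w ++ w').prod • v s) + w.length = 6641 := by
    have hsplit : d (w.prod • v r) ((w ++ w').prod • v s) = d (v r) (w'.prod • v s) := by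
      rw [List.prod_append, mul_smul, hB.isom]
    rw [hsplit]
    change d _ _ = _ ∧ _
    rw [List.length_append] at h1 ⊢
    rcases Bool.eq_or_eq_not t s with rfl | rfl
    · rcases Bool.eq_or_eq_not t' t with rfl | rfl <;> omega
    · rw [Bool.not_not] at h1 h3
      rcases Bool.eq_or_eq_not t' s with rfl | rfl <;> omega
  refine ⟨hax.2.1, hax.1, ?_, hax.2.2⟩
  have hwax : (w ++ w').prod • v s ∈ Axis d 6640 (w ++ w').prod := by
    have := hax.1
    change d _ _ = _ at this ⊢
    rw [hB.isom]; exact this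
  have hd := hax.1
  change d _ _ = _ at hd
  rcases hu.1 with h4 | h4
  · exact hR.convex _ h4 _ hax.1 _ hwax _ (by omega)
  · rw [← hB.axis_inv] at hwax ⊢
    exact hR.convex _ h4 _ (by rw [hB.axis_inv]; exact hax.1) _ hwax _ (by omega)

theorem smallCancellation {R : Set M} (hRs : R ⊆ relatorSymm d v h a b b') :
    SmallCancellation (S true ⊓ S false) (S true) (S false) (1 / 10) R := by
  intro u₁ u₂ v₁ v₂ ℓ hcu hcv hu hv hne hl hl' hlu hlv hmem
  obtain ⟨-, s, t, hst⟩ :=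
    hcv.altWord.resolve_left fun ⟨s, hs⟩ => hD.not_mem_of_mem_relatorSymm hB (hRs hv) s hs
  obtain ⟨-, s', t', hst'⟩ :=
    hcu.altWord.resolve_left fun ⟨s, hs⟩ => hD.not_mem_of_mem_relatorSymm hB (hRs hu) s hs
  by_contra hlt
  have hpos : 0 < ℓ := by
    rcases Nat.eq_zero_or_pos ℓ with rfl | h0
    · refine absurd ?_ hlt
      have : (0 : ℝ) < (min (u₁ ++ u₂).length (v₁ ++ v₂).length : ℕ) := by
        exact_mod_cast lt_min hlu hlv
      push_cast at this ⊢
      positivity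
    · exact h0
  have hst'' := hst'.inv
  have huinv := (hD.symmetrized_relatorSymm hB _ (hRs hu)).1
  have hinv := List.prod_inv_reverse (u₁ ++ u₂)
  rw [List.map_append, List.reverse_append] at hst'' hinv
  rw [hinv] at huinv
  have hp : u₂.prod⁻¹ = (u₂.map (·⁻¹)).reverse.prod := List.prod_inv_reverse u₂
  have hlen : (u₂.map (·⁻¹)).reverse.length = ℓ := by simpa using hl
  have hlen' : ((u₂.map (·⁻¹)).reverse ++ (u₁.map (·⁻¹)).reverse).length =
      (u₁ ++ u₂).length := by simp [add_comm]
  set w₁ := (u₂.map (·⁻¹)).reverse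
  set w₂ := (u₁.map (·⁻¹)).reverse
  have hsplit : ∀ {p q : List M}, p.length = ℓ → ℓ < (p ++ q).length → p ≠ [] ∧ q ≠ [] := by
    intro p q h1 h2
    rw [List.length_append] at h2
    exact ⟨List.ne_nil_of_length_pos (by omega), List.ne_nil_of_length_pos (by omega)⟩
  obtain ⟨r, hv1, hv2⟩ := hst.split (hsplit hl' hlv).1 (hsplit hl' hlv).2
  obtain ⟨r', hw1, hw2⟩ := hst''.split (hsplit hlen (hlen' ▸ hlu)).1 (hsplit hlen (hlen' ▸ hlu)).2
  obtain ⟨a1, a2, a3, a4⟩ := hD.prefix_mem_axis hB hv1 hv2 (hRs hv)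
  obtain ⟨b1, b2, b3, b4⟩ := hD.prefix_mem_axis hB hw1 hw2 huinv
  have hℓ : 664 ≤ ℓ := by
    rw [hlen'] at b1
    have h1 : (6640 : ℝ) ≤ (min (u₁ ++ u₂).length (v₁ ++ v₂).length : ℕ) := by
      exact_mod_cast le_min b1 a1
    have h2 : (664 : ℝ) ≤ ℓ := by linarith
    exact_mod_cast h2
  -- `w₁` spells the inverse of `u₂`, so a product in `H` means that `w₁` and `v₁` take the base
  -- edge to the same edge.
  have hpt : ∀ x, w₁.prod • v x = v₁.prod • v x := by
    intro x
    rw [hB.smul_eq_smul_iff, ← hp, inv_inv]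
    cases x
    · exact (Subgroup.mem_inf.1 hmem).2
    · exact (Subgroup.mem_inf.1 hmem).1
  have c1 := hv1.dist hB
  have c2 := hw1.dist hB
  rw [hpt, hpt, hlen] at c2
  rw [hl'] at c1 a4
  rw [hlen] at b4
  rw [hpt] at b3 b4
  obtain ⟨rfl, rfl⟩ : s = t' ∧ r = r' := by
    cases s <;> cases t' <;> cases r <;> cases r' <;> simp only [Bool.not_true, Bool.not_false,
      and_self, reduceCtorEq, and_true, and_false] at c1 c2 ⊢ <;> omega
  have huw : (w₁ ++ w₂).prod = (u₁ ++ u₂).prod⁻¹ := hinv.symm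
  have hne' : (v₁ ++ v₂).prod ≠ (w₁ ++ w₂).prod := by
    rw [huw]
    exact fun h => hne (by rw [h, mul_inv_cancel])
  rw [← inv_inv (u₁ ++ u₂).prod, ← huw] at hu
  have hu1 := huinv.1
  have hv1' := (hRs hv).1
  generalize (w₁ ++ w₂).prod = y at *
  generalize (v₁ ++ v₂).prod = x at *
  -- Otherwise `y⁻¹ • v s` and `y • v s` would both be at distance `6641 - ℓ` from `v₁.prod • v r`,
  -- although they are 13280 apart.
  have hyx : x ≠ y⁻¹ := by
    rintro rfl
    have h1 : d (v s) (y • y • v s) = 13280 := by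
      rcases hu1 with h1 | h1
      · exact hD.dist_sq hB h1 b2
      · have := hD.dist_sq hB h1 (x := v s) (by rwa [hB.axis_inv])
        rwa [← hB.isom y, smul_inv_smul, ← hB.isom y, smul_inv_smul, hB.tree.symm] at this
    have h2 := hB.isom y (y⁻¹ • v s) (y • v s)
    rw [smul_inv_smul, h1] at h2
    have h3 := hB.tree.tri (y⁻¹ • v s) (v₁.prod • v r) (y • v s)
    have h4 := hB.tree.symm (y⁻¹ • v s) (v₁.prod • v r)
    omega
  have hR := hD.smallOverlap hB
  -- The axes share a segment of length `ℓ - 1 ≥ 663 > 605`.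
  have hov : ∀ x' y', x' ∈ relatorConj h a b b' → y' ∈ relatorConj h a b b' →
      Axis d 6640 x' = Axis d 6640 x → Axis d 6640 y' = Axis d 6640 y → x' = y' := by
    intro x' y' hx hy ex ey
    by_contra hxy
    have := hR.overlap _ hx _ hy hxy (v s) (ex ▸ a2) (ey ▸ b2) (v₁.prod • v r) (ex ▸ a3) (ey ▸ b3)
    omega
  rcases hv1' with hx | hx <;> rcases hu1 with hy | hy
  · exact hne' (hov _ _ hx hy rfl rfl)
  · exact hyx (hov _ _ hx hy rfl (hB.axis_inv _ _))
  · exact hyx (inv_eq_iff_eq_inv.1 (hov _ _ hx hy (hB.axis_inv _ _) rfl))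
  · exact hne' (inv_injective (hov _ _ hx hy (hB.axis_inv _ _) (hB.axis_inv _ _)))

end RelatorData
end Symmetrized
-- Good fellows and vertex groups in the quotient
section Quotient

variable {M V : Type*} [Group M] [MulAction M V] {d : V → V → ℕ} {v : Bool → V}
  {S : Bool → Subgroup M}

theorem GoodFellows.mono {J J' : Subgroup M} {x y : M} (h : GoodFellows J' x y) (hJ : J ≤ J') :
    GoodFellows J x y := fun s hs t ht => h s (hJ hs) t (hJ ht)

theorem GoodFellows.map {G : Type*} [Group G] {f : G →* M} (hf : Function.Injective f)
    {J : Subgroup G} {x y : G} (h : GoodFellows J x y) : GoodFellows (J.map f) (f x) (f y) := by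
  rintro _ ⟨s, hs, rfl⟩ _ ⟨t, ht, rfl⟩
  simpa only [← map_inv, ← map_mul, ne_eq, hf.eq_iff] using h s hs t ht

namespace RelatorData

variable {I : Type*} {h a b b' : I → M} (hD : RelatorData S h a b b') (hB : BassSerre S d v)
  {Q : Type*} [Group Q] {π : M →* Q}
  (hker : π.ker = Subgroup.normalClosure (relatorConj h a b b'))
include hD hB hker

theorem eq_of_map_eq {x y : M} (hxy : π x = π y) (t : Bool) (hx : d (v t) (x • v t) ≤ 100)
    (hy : d (v t) (y • v t) ≤ 100) : x = y := by
  rw [eq_comm, MonoidHom.eq_iff, hker] at hxy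
  exact hD.eq_of_short hB hxy t hx hy

theorem injOn_quotient : Set.InjOn π (S true ∪ S false) := by
  have key : ∀ x ∈ (S true : Set M) ∪ S false, d (v true) (x • v true) ≤ 100 := by
    rintro x (hx | hx) <;> exact (hB.displacement_le hx true).trans (by norm_num)
  intro x hx y hy hxy
  exact hD.eq_of_map_eq hB hker hxy true (key x hx) (key y hy)

theorem malnormal_map (hπ : Function.Surjective π) {t : Bool}
    (mal : ∀ x ∈ S t, x ∈ S (!t) → ∀ l ∈ S (!t), l ∉ S t → l⁻¹ * x * l ∈ S t → x = 1) :
    Malnormal ((S t).map π) := by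
  rintro _ ⟨k, hk, rfl⟩ hk1 g hg ⟨k', hk', he⟩
  obtain ⟨g, rfl⟩ := hπ g
  obtain ⟨s, hs, hsg⟩ := hD.malnormal_quotient hB mal hk (fun h => hk1 (by rw [h, map_one])) hk'
    (g := g) (by
      rw [← hker, MonoidHom.mem_ker]
      simp only [map_mul, map_inv]
      rw [he, mul_inv_cancel])
  rw [← hker, ← MonoidHom.eq_iff] at hsg
  exact hg ⟨s, hs, hsg.symm⟩

/-- The displacement of `v t` is constant on double cosets of `S t` and invariant under inversion.
-/
theorem goodFellows_of_displacement {t : Bool} {x y : M} (hx : d (v t) (x • v t) ≤ 100)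
    (hy : d (v t) (y • v t) ≤ 100) (hne : d (v t) (x • v t) ≠ d (v t) (y • v t)) :
    GoodFellows ((S t).map π) (π x) (π y) := by
  rintro _ ⟨s, hs, rfl⟩ _ ⟨s', hs', rfl⟩
  simp only [← map_inv, ← map_mul]
  refine ⟨fun h => ?_, fun h => ?_⟩
  · have h1 := hB.displacement_sandwich hs hs' y
    exact hne (by rw [hD.eq_of_map_eq hB hker h t hx (by rwa [h1]), h1])
  · have h1 := hB.displacement_sandwich hs hs' y⁻¹
    rw [hB.displacement_inv] at h1
    exact hne (by rw [hD.eq_of_map_eq hB hker h t hx (by rwa [h1]), h1])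

theorem goodFellows_words {c c' e : M} (hc : c ∈ S false) (hc1 : c ∉ S true)
    (hc' : c' ∈ S false) (hc1' : c' ∉ S true) (he : e ∈ S true) (he1 : e ∉ S false) :
    GoodFellows ((S true).map π) (π (e * c')) (π (e * c * e * c)) := by
  have h1 := ((AltWord.pair (s := true) he he1 hc' hc1').dist hB).1.1
  have hw := AltWord.pair (s := true) he he1 hc hc1
  have h2 := ((hw.append hw).dist hB).1.1
  simp only [Bool.not_not, List.cons_append, List.nil_append, List.prod_cons, List.prod_nil,
    mul_one, List.length_cons, List.length_nil, zero_add, ← mul_assoc] at h1 h2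
  exact hD.goodFellows_of_displacement hB hker (by omega) (by omega) (by omega)

theorem not_mem_map {t : Bool} {w : M} (hw : d (v t) (w • v t) ≤ 100)
    (hw0 : d (v t) (w • v t) ≠ 0) : π w ∉ (S t).map π := by
  rintro ⟨k, hk, he⟩
  have h0 := hB.tree.self (v t)
  have hkv := (hB.stab t k).2 hk
  rw [← hD.eq_of_map_eq hB hker he t (by rw [hkv]; omega) hw, hkv] at hw0
  exact hw0 h0

theorem not_mem_map_words {t : Bool} {c c' e : M} (hc : c ∈ S (!t)) (hc1 : c ∉ S t)
    (hc' : c' ∈ S (!t)) (hc1' : c' ∉ S t) (he : e ∈ S t) (he1 : e ∉ S (!t)) :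
    π (c * e * c') ∉ (S t).map π ∧ π (c * e) ∉ (S t).map π := by
  have h0 : c' ∉ S (!(!t)) := by rwa [Bool.not_not]
  have hw : AltWord S (!t) t [c, e] := by
    have := AltWord.pair (S := S) (s := !t) (x := c) (y := e) hc (by rwa [Bool.not_not])
      (by rwa [Bool.not_not]) he1
    rwa [Bool.not_not] at this
  have h1 := (hw.dist hB).2.2
  have h2 := ((hw.append (AltWord.single hc' h0)).dist hB).1.2
  simp only [Bool.not_not, List.cons_append, List.nil_append, List.prod_cons, List.prod_nil,
    mul_one, List.length_cons, List.length_nil, zero_add, ← mul_assoc] at h1 h2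
  exact ⟨hD.not_mem_map hB hker (by omega) (by omega),
    hD.not_mem_map hB hker (by omega) (by omega)⟩

/-- An equation between short elements in the quotient already holds in `M`. There
`mem_of_double_coset` forces `k` and `k'` into the edge group, so only `A ⊓ S s` matters. -/
theorem goodFellows_map {s : Bool} {A : Subgroup M} (hA : A ≤ S (!s)) {x y : M} (hx : x ∈ S s)
    (hy : y ∈ S s) (hxy : ¬ (x ∈ S (!s) ∧ y ∈ S (!s))) (hg : GoodFellows (A ⊓ S s) x y) :
    GoodFellows (A.map π) (π x) (π y) := by
  rintro _ ⟨k, hk, rfl⟩ _ ⟨k', hk', rfl⟩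
  have key : ∀ z ∈ S s, π x = π k * π z * π k' → x = k * z * k' := by
    intro z hz he
    rw [← map_mul, ← map_mul] at he
    refine hD.eq_of_map_eq hB hker he s ?_ ?_
    · exact (hB.displacement_le hx s).trans (by norm_num)
    · have h1 := hB.displacement_mul s (k * z) k'
      have h2 := hB.displacement_mul s k z
      have h3 := hB.displacement_le (hA hk) s
      have h4 := hB.displacement_le (hA hk') s
      have h5 := hB.displacement_le hz s
      omega
  refine ⟨fun he => ?_, fun he => ?_⟩
  · have he' := key y hy he
    obtain ⟨h1, h2⟩ := hB.mem_of_double_coset hx hy (hA hk) (hA hk') hxy he'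
    exact (hg k (Subgroup.mem_inf.2 ⟨hk, h1⟩) k' (Subgroup.mem_inf.2 ⟨hk', h2⟩)).1 he'
  · rw [← map_inv] at he
    have he' := key y⁻¹ (inv_mem hy) he
    obtain ⟨h1, h2⟩ := hB.mem_of_double_coset hx (inv_mem hy) (hA hk) (hA hk')
      (by rwa [inv_mem_iff]) he'
    exact (hg k (Subgroup.mem_inf.2 ⟨hk, h1⟩) k' (Subgroup.mem_inf.2 ⟨hk', h2⟩)).2 he'

end RelatorData
end Quotient

theorem torsionFree_quotient {M V : Type*} {Q : Type u} [Group M] [MulAction M V] {d : V → V → ℕ}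
    {v : Bool → V} {S : Bool → Subgroup M} {I : Type*} {h a b b' : I → M}
    (hD : RelatorData S h a b b') (hB : BassSerre S d v) [Group Q] {π : M →* Q}
    (hker : π.ker = Subgroup.normalClosure (relatorConj h a b b'))
    (hπ : Function.Surjective π) (htf : ∀ t, ∀ s ∈ S t, s ≠ 1 → ¬ IsOfFinOrder s) :
    TorsionFree Q := by
  intro g hg hfin
  obtain ⟨g, rfl⟩ := hπ g
  obtain ⟨n, hn, hgn⟩ := isOfFinOrder_iff_pow_eq_one.1 hfin
  apply hg
  rw [← map_pow, ← MonoidHom.mem_ker, hker] at hgn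
  rw [← MonoidHom.mem_ker, hker]
  exact hD.mem_of_pow_mem hB htf hn hgn

/-! ### From the given groups to subgroups of the amalgam -/

section Transfer

open Monoid

variable {H : Type v} {K L : Type u} [Group H] [Group K] [Group L] {φ : H →* K} {ψ : H →* L}

theorem Malnormal.of_range {M G : Type*} [Group M] [Group G] {f : G →* M} {J : Subgroup G}
    {T : Subgroup M} (hJ : Malnormal J) (hT : ∀ x, f x ∈ T ↔ x ∈ J) :
    ∀ x ∈ T, x ∈ f.range → ∀ l ∈ f.range, l ∉ T → l⁻¹ * x * l ∈ T → x = 1 := by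
  rintro _ hx ⟨x, rfl⟩ _ ⟨l, rfl⟩ hl h
  by_contra hne
  rw [← map_inv, ← map_mul, ← map_mul, hT] at h
  exact hJ x ((hT x).1 hx) (fun e => hne (by rw [e, map_one])) l (fun e => hl ((hT l).2 e)) h

/-- The images of `K` and `L` in the amalgam. -/
def factorRange (φ : H →* K) (ψ : H →* L) (t : Bool) : Subgroup (Amalgam φ ψ) :=
  (PushoutI.of (φ := factorMap φ ψ) t).range

theorem inK_comp (x : H) : inK φ ψ (φ x) = inH φ ψ x :=
  PushoutI.of_apply_eq_base (factorMap φ ψ) true x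

theorem inL_comp (x : H) : inL φ ψ (ψ x) = inH φ ψ x :=
  PushoutI.of_apply_eq_base (factorMap φ ψ) false x

section Injective

variable (hφ : Function.Injective φ) (hψ : Function.Injective ψ)
include hφ hψ

theorem factorMap_injective : ∀ t, Function.Injective (factorMap φ ψ t)
  | true => hφ
  | false => hψ

theorem inK_injective : Function.Injective (inK φ ψ) :=
  PushoutI.of_injective (factorMap_injective hφ hψ) true

theorem inL_injective : Function.Injective (inL φ ψ) :=
  PushoutI.of_injective (factorMap_injective hφ hψ) false

theorem inH_range : (inH φ ψ).range = factorRange φ ψ true ⊓ factorRange φ ψ false :=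
  (PushoutI.inf_of_range_eq_base_range (factorMap_injective hφ hψ) (by simp)).symm

theorem inK_mem (x : K) : inK φ ψ x ∈ factorRange φ ψ false ↔ x ∈ φ.range := by
  constructor
  · intro h
    obtain ⟨y, hy⟩ : inK φ ψ x ∈ (inH φ ψ).range := by
      rw [inH_range hφ hψ]; exact Subgroup.mem_inf.2 ⟨⟨x, rfl⟩, h⟩
    rw [← inK_comp] at hy
    exact ⟨y, inK_injective hφ hψ hy⟩
  · rintro ⟨y, rfl⟩
    exact ⟨ψ y, (inL_comp y).trans (inK_comp y).symm⟩

theorem inL_mem (x : L) : inL φ ψ x ∈ factorRange φ ψ true ↔ x ∈ ψ.range := by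
  constructor
  · intro h
    obtain ⟨y, hy⟩ : inL φ ψ x ∈ (inH φ ψ).range := by
      rw [inH_range hφ hψ]; exact Subgroup.mem_inf.2 ⟨h, ⟨x, rfl⟩⟩
    rw [← inL_comp] at hy
    exact ⟨y, inL_injective hφ hψ hy⟩
  · rintro ⟨y, rfl⟩
    exact ⟨φ y, (inK_comp y).trans (inL_comp y).symm⟩

theorem bassSerre_amalgam : BassSerre (factorRange φ ψ) (treeGraph (factorRange φ ψ)).dist
    (vtx (factorRange φ ψ)) :=
  bassSerre_treeGraph (isSplitting_pushoutI (factorMap_injective hφ hψ))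

theorem map_inK_le {H' : Subgroup H} {K' : Subgroup K} (h : K' ⊓ φ.range ≤ H'.map φ) :
    K'.map (inK φ ψ) ⊓ factorRange φ ψ false ≤ (H'.map ψ).map (inL φ ψ) := by
  intro x hx
  obtain ⟨⟨k, hk, rfl⟩, hx⟩ := Subgroup.mem_inf.1 hx
  obtain ⟨y, hy, rfl⟩ := h (Subgroup.mem_inf.2 ⟨hk, (inK_mem hφ hψ k).1 hx⟩)
  exact ⟨ψ y, ⟨y, hy, rfl⟩, (inL_comp y).trans (inK_comp y).symm⟩

theorem map_inL_le {H' : Subgroup H} {L' : Subgroup L} (h : L' ⊓ ψ.range ≤ H'.map ψ) :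
    L'.map (inL φ ψ) ⊓ factorRange φ ψ true ≤ (H'.map φ).map (inK φ ψ) := by
  intro x hx
  obtain ⟨⟨k, hk, rfl⟩, hx⟩ := Subgroup.mem_inf.1 hx
  obtain ⟨y, hy, rfl⟩ := h (Subgroup.mem_inf.2 ⟨hk, (inL_mem hφ hψ k).1 hx⟩)
  exact ⟨φ y, ⟨y, hy, rfl⟩, (inK_comp y).trans (inL_comp y).symm⟩

theorem inf_le_map_inK :
    factorRange φ ψ true ⊓ factorRange φ ψ false ≤ φ.range.map (inK φ ψ) := by
  rw [← inH_range hφ hψ]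
  rintro _ ⟨y, rfl⟩
  exact ⟨φ y, ⟨y, rfl⟩, inK_comp y⟩

theorem inf_le_map_inL :
    factorRange φ ψ true ⊓ factorRange φ ψ false ≤ ψ.range.map (inL φ ψ) := by
  rw [← inH_range hφ hψ]
  rintro _ ⟨y, rfl⟩
  exact ⟨ψ y, ⟨y, rfl⟩, inL_comp y⟩

theorem goodFellows_inK {x y : K} (h : GoodFellows φ.range x y) :
    GoodFellows (factorRange φ ψ true ⊓ factorRange φ ψ false) (inK φ ψ x) (inK φ ψ y) :=
  (h.map (inK_injective hφ hψ)).mono (inf_le_map_inK hφ hψ)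

theorem goodFellows_inL {x y : L} (h : GoodFellows ψ.range x y) :
    GoodFellows (factorRange φ ψ true ⊓ factorRange φ ψ false) (inL φ ψ x) (inL φ ψ y) :=
  (h.map (inL_injective hφ hψ)).mono (inf_le_map_inL hφ hψ)

variable {I : Type w} {h : I → H} {a : I → K} {b b' : I → L}

theorem Compatible.compatibleIn {i k : I} (hc : Compatible φ ψ a b b' i k) :
    CompatibleIn (factorRange φ ψ) (fun i => inK φ ψ (a i)) (fun i => inL φ ψ (b i))
      (fun i => inL φ ψ (b' i)) i k := by
  rcases hc with h | ⟨h1, h2, h3⟩ | h | ⟨H', K', h1, h2, h3, h4, h5, h6⟩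
  · exact Or.inl (goodFellows_inK hφ hψ h)
  · refine Or.inr (Or.inl ⟨?_, ?_, fun e => h3 (inK_injective hφ hψ e)⟩) <;> dsimp only
    · rw [h1]
    · rw [h2]
  · exact Or.inr (Or.inr (Or.inl (goodFellows_inL hφ hψ h)))
  · refine Or.inr (Or.inr (Or.inr ⟨K'.map (inK φ ψ), ⟨_, h2.1, rfl⟩, ⟨_, h3.1, rfl⟩, ?_, ?_⟩))
    · refine (h4.map (inL_injective hφ hψ)).mono (le_trans ?_ (map_inK_le hφ hψ h1.le))
      exact inf_le_inf_left _ inf_le_right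
    · rintro _ ⟨x, hx, rfl⟩ - hx' y hy hy' _ ⟨z, hz, rfl⟩ - hz' hxyz
      obtain ⟨_, ⟨y, rfl⟩, rfl⟩ := inf_le_map_inK hφ hψ hy
      rw [← map_mul, ← map_mul, inK_mem hφ hψ] at hxyz
      rw [inK_mem hφ hψ] at hx' hz'
      exact h6 x hx hx' _ ⟨y, rfl⟩ (fun hyK => hy' ⟨_, hyK, rfl⟩) z hz hz' hxyz

theorem relatorData_amalgam (hmal : Malnormal ψ.range)
    (ha : ∀ i, a i ∉ φ.range) (hb : ∀ i, b i ∉ ψ.range) (hb' : ∀ i, b' i ∉ ψ.range)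
    (hgood : ∀ i, GoodFellows ψ.range (b i) (b' i))
    (hcompat : ∀ i k, i ≠ k → Compatible φ ψ a b b' i k) :
    RelatorData (factorRange φ ψ) (fun i => inH φ ψ (h i)) (fun i => inK φ ψ (a i))
      (fun i => inL φ ψ (b i)) (fun i => inL φ ψ (b' i)) where
  mal := hmal.of_range (inL_mem hφ hψ)
  h_mem i
    | true => ⟨φ (h i), inK_comp (h i)⟩
    | false => ⟨ψ (h i), inL_comp (h i)⟩
  a_mem i := ⟨a i, rfl⟩
  a_not i := fun h => ha i ((inK_mem hφ hψ _).1 h)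
  b_mem i := ⟨b i, rfl⟩
  b_not i := fun h => hb i ((inL_mem hφ hψ _).1 h)
  b'_mem i := ⟨b' i, rfl⟩
  b'_not i := fun h => hb' i ((inL_mem hφ hψ _).1 h)
  good i := goodFellows_inL hφ hψ (hgood i)
  compat i k hik := (hcompat i k hik).compatibleIn hφ hψ

/-- By minimality of the symmetric closure it is enough that `relatorSymm` is symmetrized and
contains the relators. -/
theorem relators_subset {V : Type*} [MulAction (Amalgam φ ψ) V] {d : V → V → ℕ} {v : Bool → V}
    (hB : BassSerre (factorRange φ ψ) d v)
    (hD : RelatorData (factorRange φ ψ) (fun i => inH φ ψ (h i)) (fun i => inK φ ψ (a i))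
      (fun i => inL φ ψ (b i)) (fun i => inL φ ψ (b' i))) :
    relators φ ψ h a b b' ⊆ relatorSymm d v (fun i => inH φ ψ (h i)) (fun i => inK φ ψ (a i))
      (fun i => inL φ ψ (b i)) (fun i => inL φ ψ (b' i)) := by
  refine Set.sInter_subset_of_mem ⟨?_, ?_⟩
  · rintro _ ⟨i, rfl⟩
    exact hD.relatorIn_mem_relatorSymm hB i
  · rw [inH_range hφ hψ]
    exact hD.symmetrized_relatorSymm hB

/-- Replaces `R` by a conjugation invariant generating set, as `greendlinger` requires. -/
theorem normalClosure_relators {V : Type*} [MulAction (Amalgam φ ψ) V] {d : V → V → ℕ}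
    {v : Bool → V} (hB : BassSerre (factorRange φ ψ) d v)
    (hD : RelatorData (factorRange φ ψ) (fun i => inH φ ψ (h i)) (fun i => inK φ ψ (a i))
      (fun i => inL φ ψ (b i)) (fun i => inL φ ψ (b' i))) :
    Subgroup.normalClosure (relators φ ψ h a b b') = Subgroup.normalClosure
      (relatorConj (fun i => inH φ ψ (h i)) (fun i => inK φ ψ (a i))
        (fun i => inL φ ψ (b i)) (fun i => inL φ ψ (b' i))) := by
  apply le_antisymm
  · refine Subgroup.normalClosure_le_normal fun u hu => ?_
    rcases (relators_subset hφ hψ hB hD hu).1 with h1 | h1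
    · exact Subgroup.subset_normalClosure h1
    · exact inv_mem_iff.1 (Subgroup.subset_normalClosure h1 : u⁻¹ ∈ Subgroup.normalClosure _)
  · refine Subgroup.normalClosure_le_normal ?_
    rintro _ ⟨i, c, rfl⟩
    refine Subgroup.normalClosure_normal.conj_mem _ (Subgroup.subset_normalClosure ?_) c
    exact Set.mem_sInter.2 fun R hR => hR.1 ⟨i, rfl⟩

end Injective

theorem symmetrized_symmetricClosure {M : Type*} [Group M] (J S T : Subgroup M) (X : Set M) :
    Symmetrized J S T (symmetricClosure J S T X) := by
  intro g hg
  refine ⟨Set.mem_sInter.2 fun R hR => (hR.2 g (hg R hR)).1, fun g' hc hw =>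
    Set.mem_sInter.2 fun R hR => (hR.2 g (hg R hR)).2 g' hc hw⟩

end Transfer
end HesseAmalgam

/-! ### The amalgamation lemma -/

theorem mainTheorem5 {H : Type v} {K L : Type u} [Group H] [Group K] [Group L]
    (φ : H →* K) (ψ : H →* L) (hφ : Function.Injective φ) (hψ : Function.Injective ψ)
    (hmal : HesseAmalgam.Malnormal ψ.range)
    {I : Type w} (h : I → H) (a : I → K) (b b' : I → L)
    (ha : ∀ i, a i ∉ φ.range) (hb : ∀ i, b i ∉ ψ.range) (hb' : ∀ i, b' i ∉ ψ.range)
    (hgood : ∀ i, HesseAmalgam.GoodFellows ψ.range (b i) (b' i))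
    (hcompat : ∀ i k, i ≠ k → HesseAmalgam.Compatible φ ψ a b b' i k) :
    let R := HesseAmalgam.relators φ ψ h a b b'
    let π := HesseAmalgam.proj φ ψ h a b b'
    let πK := HesseAmalgam.toMStarK φ ψ h a b b'
    let πL := HesseAmalgam.toMStarL φ ψ h a b b'
    -- (A)
    (HesseAmalgam.SymmetrizedInAmalgam φ ψ R ∧
      HesseAmalgam.SmallCancellationInAmalgam φ ψ (1 / 10) R ∧
      Set.InjOn π (Set.range (HesseAmalgam.inK φ ψ) ∪ Set.range (HesseAmalgam.inL φ ψ)) ∧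
      Function.Injective πK ∧ Function.Injective πL) ∧
    -- (B)
    (HesseAmalgam.Malnormal πK.range ∧
      (HesseAmalgam.Malnormal φ.range → HesseAmalgam.Malnormal πL.range)) ∧
    -- (C)
    (∀ c c' : L, c ∉ ψ.range → c' ∉ ψ.range → ¬ HesseAmalgam.GoodFellows ψ.range c c' →
      ∀ d : K, d ∉ φ.range →
        HesseAmalgam.GoodFellows πK.range (πK d * πL c') (πK d * πL c * πK d * πL c)) ∧
    -- (D)
    ((∀ c c' : L, c ∉ ψ.range → c' ∉ ψ.range → ∀ d : K, d ∉ φ.range →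
        πL c * πK d * πL c' ∉ πK.range ∧ πL c * πK d ∉ πK.range) ∧
      (∀ d d' : K, d ∉ φ.range → d' ∉ φ.range → ∀ c : L, c ∉ ψ.range →
        πK d * πL c * πK d' ∉ πL.range ∧ πK d * πL c ∉ πL.range)) ∧
    -- (E)
    (∀ (H' : Subgroup H) (L' : Subgroup L) (d d' : K),
      HesseAmalgam.GoodFellows (H'.map φ) d d' →
      ¬ (d ∈ φ.range ∧ d' ∈ φ.range) →
      L' ⊓ ψ.range = H'.map ψ →
        HesseAmalgam.GoodFellows (L'.map πL) (πK d) (πK d')) ∧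
    -- (F)
    (∀ c c' : L, HesseAmalgam.GoodFellows ψ.range c c' →
      HesseAmalgam.GoodFellows πK.range (πL c) (πL c')) ∧
    -- (G)
    (HesseAmalgam.TorsionFree K → HesseAmalgam.TorsionFree L →
      HesseAmalgam.TorsionFree (HesseAmalgam.MStar φ ψ h a b b')) := by
  intro R π πK πL
  have hB := HesseAmalgam.bassSerre_amalgam hφ hψ
  have hD := HesseAmalgam.relatorData_amalgam (h := h) hφ hψ hmal ha hb hb' hgood hcompat
  have hker : π.ker = _ :=
    (QuotientGroup.ker_mk' _).trans (HesseAmalgam.normalClosure_relators hφ hψ hB hD)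
  have hπ : Function.Surjective π := QuotientGroup.mk'_surjective _
  have hrK : πK.range = (HesseAmalgam.factorRange φ ψ true).map π := MonoidHom.range_comp _ _
  have hrL : πL.range = (HesseAmalgam.factorRange φ ψ false).map π := MonoidHom.range_comp _ _
  have hinj := hD.injOn_quotient hB hker
  refine ⟨⟨HesseAmalgam.symmetrized_symmetricClosure _ _ _ _, ?_, hinj, ?_, ?_⟩, ⟨?_, ?_⟩,
    ?_, ⟨?_, ?_⟩, ?_, ?_, ?_⟩
  · change HesseAmalgam.SmallCancellation _ _ _ _ _
    rw [HesseAmalgam.inH_range hφ hψ]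
    exact hD.smallCancellation hB (HesseAmalgam.relators_subset hφ hψ hB hD)
  · intro x y hxy
    exact HesseAmalgam.inK_injective hφ hψ (hinj (Or.inl ⟨x, rfl⟩) (Or.inl ⟨y, rfl⟩) hxy)
  · intro x y hxy
    exact HesseAmalgam.inL_injective hφ hψ (hinj (Or.inr ⟨x, rfl⟩) (Or.inr ⟨y, rfl⟩) hxy)
  · rw [hrK]
    exact hD.malnormal_map hB hker hπ hD.mal
  · intro hmalK
    rw [hrL]
    refine hD.malnormal_map hB hker hπ (t := false) ?_
    exact hmalK.of_range (HesseAmalgam.inK_mem hφ hψ)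
  · intro c c' hc hc' _ e he
    have := hD.goodFellows_words hB hker (c := HesseAmalgam.inL φ ψ c)
      (c' := HesseAmalgam.inL φ ψ c') (e := HesseAmalgam.inK φ ψ e)
      ⟨c, rfl⟩ (fun h => hc ((HesseAmalgam.inL_mem hφ hψ _).1 h))
      ⟨c', rfl⟩ (fun h => hc' ((HesseAmalgam.inL_mem hφ hψ _).1 h))
      ⟨e, rfl⟩ (fun h => he ((HesseAmalgam.inK_mem hφ hψ _).1 h))
    rw [hrK]
    simp only [map_mul] at this
    exact this
  · intro c c' hc hc' e he
    have := hD.not_mem_map_words hB hker (t := true) (c := HesseAmalgam.inL φ ψ c)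
      (c' := HesseAmalgam.inL φ ψ c') (e := HesseAmalgam.inK φ ψ e)
      ⟨c, rfl⟩ (fun h => hc ((HesseAmalgam.inL_mem hφ hψ _).1 h))
      ⟨c', rfl⟩ (fun h => hc' ((HesseAmalgam.inL_mem hφ hψ _).1 h))
      ⟨e, rfl⟩ (fun h => he ((HesseAmalgam.inK_mem hφ hψ _).1 h))
    rw [hrK]
    simp only [map_mul] at this
    exact this
  · intro e e' he he' c hc
    have := hD.not_mem_map_words hB hker (t := false) (c := HesseAmalgam.inK φ ψ e)
      (c' := HesseAmalgam.inK φ ψ e') (e := HesseAmalgam.inL φ ψ c)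
      ⟨e, rfl⟩ (fun h => he ((HesseAmalgam.inK_mem hφ hψ _).1 h))
      ⟨e', rfl⟩ (fun h => he' ((HesseAmalgam.inK_mem hφ hψ _).1 h))
      ⟨c, rfl⟩ (fun h => hc ((HesseAmalgam.inL_mem hφ hψ _).1 h))
    rw [hrL]
    simp only [map_mul] at this
    exact this
  · intro H' L' e e' hg hee hL
    have := hD.goodFellows_map hB hker (s := true) (A := L'.map (HesseAmalgam.inL φ ψ))
      (x := HesseAmalgam.inK φ ψ e) (y := HesseAmalgam.inK φ ψ e')
      (Subgroup.map_le_range _ _) ⟨e, rfl⟩ ⟨e', rfl⟩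
      (fun h => hee ⟨(HesseAmalgam.inK_mem hφ hψ _).1 h.1, (HesseAmalgam.inK_mem hφ hψ _).1 h.2⟩)
      ((hg.map (HesseAmalgam.inK_injective hφ hψ)).mono (HesseAmalgam.map_inL_le hφ hψ hL.le))
    rwa [Subgroup.map_map] at this
  · intro c c' hg
    rw [hrK]
    refine hD.goodFellows_map hB hker (s := false) (A := HesseAmalgam.factorRange φ ψ true)
      le_rfl ⟨c, rfl⟩ ⟨c', rfl⟩ (fun h => ?_) (HesseAmalgam.goodFellows_inL hφ hψ hg)
    have h1 := (HesseAmalgam.inL_mem hφ hψ _).1 h.1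
    have h2 := (HesseAmalgam.inL_mem hφ hψ _).1 h.2
    -- Two elements of `H` are never good fellows over `H`.
    exact (hg (c * c'⁻¹) (mul_mem h1 (inv_mem h2)) 1 (one_mem _)).1 (by group)
  · intro hK hL
    refine HesseAmalgam.torsionFree_quotient hD hB hker hπ ?_
    rintro (_ | _) _ ⟨x, rfl⟩ hx hfin
    · exact hL x (fun e => hx (by rw [e]; exact map_one _))
        (((HesseAmalgam.inL_injective hφ hψ).isOfFinOrder_iff).1 hfin)
    · exact hK x (fun e => hx (by rw [e]; exact map_one _))
        (((HesseAmalgam.inK_injective hφ hψ).isOfFinOrder_iff).1 hfin)
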